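/- Fix $a>-1/2$, $\mathfrak a,\mathfrak b\in(0,1)$ and $T>0$. Let $\Omega=(-1,1)$, $\chi(r)=r(1-r)$, $D(r)=1+2ar$, $\sigma=\chi D$. Let $\mathcal M$ be the set of non-negative measures on $\Omega$ with total mass at most $2$, with the weak topology; $\langle\pi,F\rangle=\int_\Omega F\,d\pi$ (for a density $u$, $\langle u,F\rangle=\int_{-1}^1uF\,dx$). Let $\mathcal M^0\subset\mathcal M$ be the set of measures $g(x)\,dx$ with $0\le g\le 1$ a.e. Let $D([0,T],\mathcal M)$ be the space of right-continuous functions with left limits from $[0,T]$ to $\mathcal M$, with the Skorohod $J_1$ topology. Let $C^{m,n}([0,T]\times[-1,1])$ be the space of real functions with $m$ derivatives in time and $n$ derivatives in space, all continuous on $[0,T]\times[-1,1]$. For $\pi\in D([0,T],\mathcal M)$ with $\pi_t\in\mathcal M^0$ for all $t$, $\pi_t(dx)=u_t(x)\,dx$, define the energy $$\mathcal Q(\pi)=\sup_G\Big\{2\int_0^T\langle u_t,\nabla G_t\rangle\,dt-\int_0^T\!\!\int_{-1}^1\chi(u_t(x))\,G(t,x)^2\,dx\,dt\Big\}\in[0,\infty],$$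 where the supremum is over $G\in C^{1,2}([0,T]\times[-1,1])$ with compact support in $[0,T]\times\Omega$. If $\mathcal Q(\pi)<\infty$, then for almost every $t$ the function $u_t$ belongs to the Sobolev space $H^1(\Omega)$; write $\nabla u_t$ for its generalized derivative and $u_t(\pm1)$ for the boundary values of its continuous version. For such $\pi$ and $H\in C^{1,1}([0,T]\times[-1,1])$ let $$\hat J_H(\pi)=\langle\pi_T,H_T\rangle-\langle\pi_0,H_0\rangle-\int_0^T\langle\pi_t,\partial_tH_t\rangle\,dt+\int_0^T\!\!\int_{-1}^1D(u_t)\,\nabla u_t\,\nabla H_t\,dx\,dt-\int_0^T\!\!\int_{-1}^1\sigma(u_t)(\nabla H_t)^2\,dx\,dt-\int_0^TB(u_t,H_t)\,dt,$$ where $$B(u,h)=u(1)(1-\mathfrak b)(e^{-h(1)}-1)+\mathfrak b(1-u(1))(e^{h(1)}-1)+u(-1)(1-\mathfrak a)(e^{-h(-1)}-1)+\mathfrak a(1-u(-1))(e^{h(-1)}-1).$$ Set $J_H(\pi)=\hat J_H(\pi)$ if $\pi_t\in\mathcal M^0$ for all $t\in[0,T]$ and $\mathcal Q(\pi)<\infty$,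 and $J_H(\pi)=+\infty$ otherwise. Let $I_{[0,T]}(\pi)=\sup\{J_H(\pi):H\in C^{1,1}([0,T]\times[-1,1])\}$ and, for measurable $\gamma:[-1,1]\to[0,1]$, let $I_{[0,T]}(\pi|\gamma)=I_{[0,T]}(\pi)$ if $\pi_0(dx)=\gamma(x)\,dx$ and $I_{[0,T]}(\pi|\gamma)=+\infty$ otherwise. Theorem. For each measurable $\gamma:[-1,1]\to[0,1]$, the functional $I_{[0,T]}(\cdot|\gamma)$ takes values in $[0,\infty]$, is lower semicontinuous on $D([0,T],\mathcal M)$, and has compact level sets: $\{\pi: I_{[0,T]}(\pi|\gamma)\le q\}$ is compact for every real $q$. The same holds for the functional $I_{[0,T]}$ on $D([0,T],\mathcal M)$. -/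

import Mathlib

open MeasureTheory Set Filter Topology
open scoped Uniformity NNReal ENNReal ContDiff

noncomputable section

namespace Exclusion

attribute [local instance] Measure.Subtype.measureSpace

/-! ### The space of càdlàg trajectories and the Skorohod topology -/

/-- Right-continuous functions with left limits from `[0, T]` to `E`. (At the left end point the
filter `𝓝[<] t` is trivial, and at the right end point right-continuity is void.) -/
structure CadlagPath (T : ℝ) (E : Type*) [TopologicalSpace E] where
  toFun : Icc (0 : ℝ) T → E
  right_continuous : ∀ t, ContinuousWithinAt toFun (Ici t) t
  left_limit : ∀ t, ∃ l, Tendsto toFun (𝓝[<] t) (𝓝 l)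

instance CadlagPath.instCoeFun (T : ℝ) (E : Type*) [TopologicalSpace E] :
    CoeFun (CadlagPath T E) (fun _ => Icc (0 : ℝ) T → E) := ⟨CadlagPath.toFun⟩

/-- Two trajectories are `(V, ε)`-close if, after an increasing change of time of `[0, T]` which
moves every instant by less than `ε`, their values are everywhere `V`-close. -/
def skorohodEntourage (T : ℝ) {E : Type*} [UniformSpace E] (V : Set (E × E)) (ε : ℝ) :
    Set (CadlagPath T E × CadlagPath T E) :=
  {p | ∃ φ : Icc (0 : ℝ) T ≃o Icc (0 : ℝ) T,
    ∀ t, |(φ t : ℝ) - (t : ℝ)| < ε ∧ (p.1 t, p.2 (φ t)) ∈ V}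

/-- The sets `skorohodEntourage T V ε`, with `V` an entourage of `E` and `ε > 0`. -/
def skorohodBasis (T : ℝ) (E : Type*) [UniformSpace E] :
    FilterBasis (CadlagPath T E × CadlagPath T E) where
  sets := {s | ∃ V ∈ 𝓤 E, ∃ ε : ℝ, 0 < ε ∧ s = skorohodEntourage T V ε}
  nonempty := ⟨_, univ, univ_mem, 1, one_pos, rfl⟩
  inter_sets := by
    rintro _ _ ⟨V, hV, ε, hε, rfl⟩ ⟨W, hW, δ, hδ, rfl⟩
    refine ⟨_, ⟨V ∩ W, inter_mem hV hW, min ε δ, lt_min hε hδ, rfl⟩, ?_⟩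
    rintro p ⟨φ, h⟩
    exact ⟨⟨φ, fun t => ⟨(h t).1.trans_le (min_le_left _ _), (h t).2.1⟩⟩,
      ⟨φ, fun t => ⟨(h t).1.trans_le (min_le_right _ _), (h t).2.2⟩⟩⟩

/-- The Skorohod (J1) topology on `D([0, T], E)`, as the topology of the uniform structure generated
by the sets `skorohodEntourage T V ε`. When `E` is a metric space this is the uniform structure of
the Skorohod distance `inf_φ max (sup_t |φ t - t|) (sup_t d (x t) (y (φ t)))`. -/
instance CadlagPath.instUniformSpace (T : ℝ) (E : Type*) [UniformSpace E] :
    UniformSpace (CadlagPath T E) :=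
  UniformSpace.ofCore <| UniformSpace.Core.mkOfBasis (skorohodBasis T E)
    (by
      rintro _ ⟨V, hV, ε, hε, rfl⟩ x
      exact ⟨OrderIso.refl _, fun t => ⟨by simpa using hε, refl_mem_uniformity hV⟩⟩)
    (by
      rintro _ ⟨V, hV, ε, hε, rfl⟩
      refine ⟨_, ⟨Prod.swap ⁻¹' V, symm_le_uniformity hV, ε, hε, rfl⟩, ?_⟩
      rintro ⟨x, y⟩ ⟨φ, h⟩
      refine ⟨φ.symm, fun t => ⟨?_, ?_⟩⟩
      · have := (h (φ.symm t)).1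
        rw [OrderIso.apply_symm_apply, abs_sub_comm] at this
        exact this
      · have := (h (φ.symm t)).2
        rw [OrderIso.apply_symm_apply] at this
        exact this)
    (by
      rintro _ ⟨V, hV, ε, hε, rfl⟩
      obtain ⟨W, hW, hWV⟩ := comp_mem_uniformity_sets hV
      refine ⟨_, ⟨W, hW, ε / 2, half_pos hε, rfl⟩, ?_⟩
      rintro ⟨x, z⟩ ⟨y, ⟨φ, h⟩, ⟨ψ, k⟩⟩
      refine ⟨φ.trans ψ, fun t => ⟨?_, hWV ⟨y (φ t), (h t).2, (k (φ t)).2⟩⟩⟩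
      have h1 := abs_lt.1 (h t).1
      have h2 := abs_lt.1 (k (φ t)).1
      rw [abs_lt]
      simp only [OrderIso.trans_apply]
      constructor <;> linarith [h1.1, h1.2, h2.1, h2.2])

theorem hasBasis_uniformity_cadlagPath (T : ℝ) (E : Type*) [UniformSpace E] :
    (𝓤 (CadlagPath T E)).HasBasis (fun p : Set (E × E) × ℝ => p.1 ∈ 𝓤 E ∧ 0 < p.2)
      (fun p => skorohodEntourage T p.1 p.2) := by
  refine ⟨fun s => ?_⟩
  refine (skorohodBasis T E).mem_filter_iff.trans ⟨?_, ?_⟩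
  · rintro ⟨_, ⟨V, hV, ε, hε, rfl⟩, hs⟩
    exact ⟨(V, ε), ⟨hV, hε⟩, hs⟩
  · rintro ⟨⟨V, ε⟩, ⟨hV, hε⟩, hs⟩
    exact ⟨_, ⟨V, hV, ε, hε, rfl⟩, hs⟩

/-! ### The measures -/

/-- The open interval `Ω = ]-1, 1[`. -/
abbrev Om : Set ℝ := Ioo (-1 : ℝ) 1

/-- The set `𝓜` of non-negative measures on `Ω` with total mass at most `2`, with the topology of
weak convergence. -/
abbrev MeasSpace : Type := {μ : FiniteMeasure Om // μ.mass ≤ 2}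

/-- The map `μ ↦ (f ↦ ⟨μ, f⟩)`, `f` ranging over the bounded continuous functions on `Ω`. -/
def MeasSpace.eval (μ : MeasSpace) (f : BoundedContinuousFunction Om ℝ≥0) : ℝ≥0 :=
  μ.1.testAgainstNN f

theorem MeasSpace.topology_eq :
    (inferInstance : TopologicalSpace MeasSpace) =
      TopologicalSpace.induced MeasSpace.eval inferInstance := by
  have h1 : IsInducing (fun μ : MeasSpace => μ.1) := IsInducing.subtypeVal
  have h2 : IsInducing (FiniteMeasure.toWeakDualBCNN : FiniteMeasure Om → _) := ⟨rfl⟩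
  have h3 : IsInducing
      (fun (x : WeakDual ℝ≥0 (BoundedContinuousFunction Om ℝ≥0))
        (f : BoundedContinuousFunction Om ℝ≥0) => x f) := ⟨rfl⟩
  exact ((h3.comp h2).comp h1).eq_induced

/-- The weak uniform structure of `𝓜`; its topology is the topology of weak convergence. -/
instance MeasSpace.instUniformSpace : UniformSpace MeasSpace :=
  (UniformSpace.comap MeasSpace.eval inferInstance).replaceTopology MeasSpace.topology_eq

/-- The density `x ↦ u(x)` of (the absolutely continuous part of) a measure. -/
def density (μ : MeasSpace) (x : Om) : ℝ := ((μ.1 : Measure Om).rnDeriv volume x).toReal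

/-- The pairing `⟨μ, F⟩ = ∫_Ω F dμ`. -/
def pairing (μ : MeasSpace) (F : ℝ → ℝ) : ℝ := ∫ x : Om, F x ∂(μ.1 : Measure Om)

/-- The set `𝓜⁰` of the measures `g(x) dx` with `0 ≤ g ≤ 1`. -/
def AbsCont : Set MeasSpace :=
  {μ | ∃ g : Om → ℝ, Measurable g ∧ (∀ᵐ x : Om, 0 ≤ g x ∧ g x ≤ 1) ∧
    (μ.1 : Measure Om) = (volume : Measure Om).withDensity (fun x => ENNReal.ofReal (g x))}

/-! ### Test functions -/

/-- `G ∈ C^{m,n}([0, T] × [-1, 1])`: the function `G` has `m` derivatives in time and `n`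
derivatives in space, and all of them are continuous on `[0, T] × [-1, 1]`. Only the values of `G`
on `[0, T] × [-1, 1]` matter. -/
def IsCmn (m n : ℕ) (T : ℝ) (G : ℝ → ℝ → ℝ) : Prop :=
  (∀ x ∈ Icc (-1 : ℝ) 1, ContDiffOn ℝ m (fun t => G t x) (Icc 0 T)) ∧
  (∀ t ∈ Icc 0 T, ContDiffOn ℝ n (G t) (Icc (-1 : ℝ) 1)) ∧
  (∀ k ≤ m, ContinuousOn
    (fun p : ℝ × ℝ => iteratedDerivWithin k (fun t => G t p.2) (Icc 0 T) p.1)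
    (Icc 0 T ×ˢ Icc (-1 : ℝ) 1)) ∧
  (∀ k ≤ n, ContinuousOn
    (fun p : ℝ × ℝ => iteratedDerivWithin k (G p.1) (Icc (-1 : ℝ) 1) p.2)
    (Icc 0 T ×ˢ Icc (-1 : ℝ) 1))

/-- `G` has compact support in `[0, T] × Ω`. -/
def HasCompactSupportInOm (T : ℝ) (G : ℝ → ℝ → ℝ) : Prop :=
  ∃ K : Set (ℝ × ℝ), IsCompact K ∧ K ⊆ Icc 0 T ×ˢ Om ∧
    ∀ t ∈ Icc 0 T, ∀ x ∈ Icc (-1 : ℝ) 1, (t, x) ∉ K → G t x = 0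

/-- The time derivative `∂_t G (t, x)` on `[0, T] × [-1, 1]`. -/
def dt (T : ℝ) (G : ℝ → ℝ → ℝ) (t x : ℝ) : ℝ := derivWithin (fun s => G s x) (Icc 0 T) t

/-- The space derivative `∇G (t, x)` on `[0, T] × [-1, 1]`. -/
def dx (G : ℝ → ℝ → ℝ) (t x : ℝ) : ℝ := derivWithin (G t) (Icc (-1 : ℝ) 1) x

/-! ### Weak gradients and boundary values of functions on `Ω` -/

/-- `v` is the generalized derivative of `u` on `Ω`. -/
def HasWeakGrad (u v : Om → ℝ) : Prop :=
  ∀ φ : ℝ → ℝ, ContDiff ℝ ∞ φ → HasCompactSupport φ → tsupport φ ⊆ Om →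
    ∫ x : Om, u x * deriv φ x = - ∫ x : Om, v x * φ x

open Classical in
/-- The square-integrable generalized derivative `∇u` (unique up to null sets) of `u`; it is `0`
when there is none. -/
def weakGrad (u : Om → ℝ) : Om → ℝ :=
  if h : ∃ v : Om → ℝ, MemLp v 2 volume ∧ HasWeakGrad u v then h.choose else 0

open Classical in
/-- The value at a point of `[-1, 1]` of the continuous version of `u` on `[-1, 1]`; it is `0` when
there is none. -/
def boundaryValue (u : Om → ℝ) (y : Icc (-1 : ℝ) 1) : ℝ :=
  if h : ∃ w : C(Icc (-1 : ℝ) 1, ℝ), ∀ᵐ x : Om, w (inclusion Ioo_subset_Icc_self x) = u x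
    then h.choose y else 0

/-- The right end point `1` of `[-1, 1]`. -/
def rightEnd : Icc (-1 : ℝ) 1 := ⟨1, by norm_num⟩

/-- The left end point `-1` of `[-1, 1]`. -/
def leftEnd : Icc (-1 : ℝ) 1 := ⟨-1, by norm_num⟩

/-! ### The energy -/

/-- The static compressibility `χ(r) = r (1 - r)`. -/
def chi (r : ℝ) : ℝ := r * (1 - r)

/-- The diffusivity `D(r) = 1 + 2 a r`. -/
def diffusivity (a r : ℝ) : ℝ := 1 + 2 * a * r

/-- The mobility `σ(r) = χ(r) D(r)`. -/
def mobility (a r : ℝ) : ℝ := chi r * diffusivity a r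

/-- `2 ∫_0^T ⟨u_t, ∇G_t⟩ dt - ∫_0^T ∫_{-1}^1 χ(u(t,x)) G(t,x)² dx dt`. -/
def energyFun {T : ℝ} (π : CadlagPath T MeasSpace) (G : ℝ → ℝ → ℝ) : ℝ :=
  2 * (∫ t : Icc (0 : ℝ) T, ∫ x : Om, density (π t) x * dx G t x)
    - ∫ t : Icc (0 : ℝ) T, ∫ x : Om, chi (density (π t) x) * G t x ^ 2

/-- The energy of a trajectory. -/
def energy {T : ℝ} (π : CadlagPath T MeasSpace) : EReal :=
  ⨆ G ∈ {G : ℝ → ℝ → ℝ | IsCmn 1 2 T G ∧ HasCompactSupportInOm T G}, (energyFun π G : EReal)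

/-- The trajectories in `D([0, T], 𝓜⁰)` with finite energy. -/
def FiniteEnergy {T : ℝ} (π : CadlagPath T MeasSpace) : Prop :=
  (∀ t, π t ∈ AbsCont) ∧ energy π < ⊤

/-! ### The rate functional -/

/-- The time `0`, as a point of `[0, T]`. -/
def startTime {T : ℝ} (hT : 0 < T) : Icc (0 : ℝ) T := ⟨0, left_mem_Icc.2 hT.le⟩

/-- The time `T`, as a point of `[0, T]`. -/
def endTime {T : ℝ} (hT : 0 < T) : Icc (0 : ℝ) T := ⟨T, right_mem_Icc.2 hT.le⟩

/-- `L_0(H) = ⟨π_T, H_T⟩ - ⟨π_0, H_0⟩ - ∫_0^T ⟨π_t, ∂_t H_t⟩ dt`. -/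
def L0 {T : ℝ} (hT : 0 < T) (π : CadlagPath T MeasSpace) (H : ℝ → ℝ → ℝ) : ℝ :=
  pairing (π (endTime hT)) (H T) - pairing (π (startTime hT)) (H 0)
    - ∫ t : Icc (0 : ℝ) T, pairing (π t) (dt T H t)

/-- The boundary term `B(u, h)`, for `u` a function on `Ω` and `h` a function on `[-1, 1]`; `al` and
`be` are the densities of the left and of the right reservoir. -/
def boundaryTerm (al be : ℝ) (u : Om → ℝ) (h : ℝ → ℝ) : ℝ :=
  boundaryValue u rightEnd * (1 - be) * (Real.exp (-h 1) - 1)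
    + be * (1 - boundaryValue u rightEnd) * (Real.exp (h 1) - 1)
    + boundaryValue u leftEnd * (1 - al) * (Real.exp (-h (-1)) - 1)
    + al * (1 - boundaryValue u leftEnd) * (Real.exp (h (-1)) - 1)

/-- The functional `Ĵ_H`, for trajectories of finite energy. -/
def Jhat (a al be : ℝ) {T : ℝ} (hT : 0 < T) (H : ℝ → ℝ → ℝ) (π : CadlagPath T MeasSpace) : ℝ :=
  L0 hT π H
    + (∫ t : Icc (0 : ℝ) T, ∫ x : Om,
        diffusivity a (density (π t) x) * weakGrad (density (π t)) x * dx H t x)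
    - (∫ t : Icc (0 : ℝ) T, ∫ x : Om, mobility a (density (π t) x) * dx H t x ^ 2)
    - ∫ t : Icc (0 : ℝ) T, boundaryTerm al be (density (π t)) (H t)

open Classical in
/-- The functional `J_H` on `D([0, T], 𝓜)`. -/
def J (a al be : ℝ) {T : ℝ} (hT : 0 < T) (H : ℝ → ℝ → ℝ) (π : CadlagPath T MeasSpace) : EReal :=
  if FiniteEnergy π then (Jhat a al be hT H π : EReal) else ⊤

/-- The functional `I_{[0,T]}` on `D([0, T], 𝓜)`. -/
def rate (a al be : ℝ) {T : ℝ} (hT : 0 < T) (π : CadlagPath T MeasSpace) : EReal :=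
  ⨆ H ∈ {H : ℝ → ℝ → ℝ | IsCmn 1 1 T H}, J a al be hT H π

open Classical in
/-- The rate functional `I_{[0,T]}(· | γ)` on `D([0, T], 𝓜)`. -/
def rateFrom (a al be : ℝ) {T : ℝ} (hT : 0 < T) (γ : Icc (-1 : ℝ) 1 → Icc (0 : ℝ) 1)
    (π : CadlagPath T MeasSpace) : EReal :=
  if ((π (startTime hT)).1 : Measure Om) = (volume : Measure Om).withDensity
      (fun x => ENNReal.ofReal (γ (inclusion Ioo_subset_Icc_self x)))
    then rate a al be hT π else ⊤

end Exclusion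

end

open MeasureTheory Set Filter Topology
open scoped Uniformity NNReal ENNReal ContDiff

noncomputable section

namespace Exclusion

attribute [local instance] Measure.Subtype.measureSpace

/-! Everything rests on an a priori estimate, `energy_estimate`: if `I(π) ≤ q`, then `∬ |∇u|² / ((u
+ κ)(1 - u + κ))` is bounded, for every `κ ∈ (0, 1]`, by a constant depending only on `q`, `T` and
`a`. Formally it comes from the test function `H = s'(u)`, where `s` is half of the entropy `u log u
+ (1 - u) log (1 - u)`, regularized by `κ`. The time part of `Ĵ_H` is then an entropy increment,
which is bounded. Drift minus mobility is `D(u) s''(u) (1 - χ(u) s''(u)) |∇u|²`; the factor one half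
gives `χ s'' ≤ 1/2`, and `a > -1/2` keeps `D` away from zero. The boundary exponentials are harmless
because `r exp (-s'(r))` and `(1 - r) exp (s'(r))` stay bounded.

The function `s'(u)` is in general not an admissible test function. In space it is mollified, before
and after applying `s'`, with the kernel `refl` of the even reflection at the end points. The
derivative of an even mollification is the odd mollification (`oddRefl`) of `∇u`: no boundary term
appears and the operator contracts `L²`. In time the test function is averaged over `[t, t + ε]`,
and convexity of `s` replaces the chain rule (`le_increment_of_fenchel`). This needs continuity of
`π` in time, which is proved beforehand: finite energy and `χ ≤ 1` give a square-integrable gradient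
by Riesz representation (`FiniteEnergy.exists_hasSpaceGrad`), and the test functions `l θ(t) φ(x)`
then bound the increments of `⟨π_t, φ⟩` (`abs_increment_le`).

The estimate with `κ = 1` bounds `∇u` in `L²` uniformly on the level set, and `κ → 0` bounds the
energy `𝓠`. Along an ultrafilter on a level set the trajectories are therefore equicontinuous with
values in the compact set `𝓜⁰`, and converge uniformly in time to a continuous trajectory
(`exists_limit_path`). The gradients converge weakly in `L²`. The densities converge strongly, since
mollification moves them little, uniformly over the level set, and the mollified densities converge
uniformly (`tendsto_integral_sq_sub`). Every `Ĵ_H` and every energy functional then passes to the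
limit (`tendsto_Jhat`, `tendsto_energyFun`), so the limit lies in the level set
(`exists_limit_of_rate_le`).

This gives compactness. Closedness of the level sets, hence lower semicontinuity, follows because a
continuous limit is the only limit in the Skorohod topology. Prescribing `π_0` intersects with a
closed set, as evaluation at time `0` is continuous. -/

theorem volume_coe_map {s : Set ℝ} (hs : MeasurableSet s) :
    (volume : Measure s).map ((↑) : s → ℝ) = volume.restrict s :=
  hs.map_coe_volume

/-! ### Lebesgue measure on `Ω` and on `[0, T]` -/

instance isFiniteMeasure_Om : IsFiniteMeasure (volume : Measure Om) :=
  ⟨by rw [Measure.Subtype.volume_univ measurableSet_Ioo.nullMeasurableSet]; simp⟩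

instance isFiniteMeasure_Icc (T : ℝ) : IsFiniteMeasure (volume : Measure (Icc (0 : ℝ) T)) :=
  ⟨by rw [Measure.Subtype.volume_univ measurableSet_Icc.nullMeasurableSet]; simp⟩

theorem volume_real_Om : (volume : Measure Om).real univ = 2 := by
  rw [Measure.real, Measure.Subtype.volume_univ measurableSet_Ioo.nullMeasurableSet]
  simp; norm_num

theorem volume_real_Icc {T : ℝ} (hT : 0 ≤ T) : (volume : Measure (Icc (0 : ℝ) T)).real univ = T := by
  rw [Measure.real, Measure.Subtype.volume_univ measurableSet_Icc.nullMeasurableSet]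
  simp [hT]

theorem integral_coe {s : Set ℝ} (hs : MeasurableSet s) (f : ℝ → ℝ) :
    ∫ x : s, f x = ∫ x in s, f x :=
  integral_subtype_comap hs f

theorem integral_Om (f : ℝ → ℝ) : ∫ x : Om, f x = ∫ x in (-1 : ℝ)..1, f x := by
  rw [integral_coe measurableSet_Ioo f, intervalIntegral.integral_of_le (by norm_num),
    integral_Ioc_eq_integral_Ioo]

theorem integral_Tm {T : ℝ} (hT : 0 ≤ T) (f : ℝ → ℝ) :
    ∫ t : Icc (0 : ℝ) T, f t = ∫ t in (0 : ℝ)..T, f t := by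
  rw [integral_coe measurableSet_Icc f, intervalIntegral.integral_of_le hT,
    integral_Icc_eq_integral_Ioc]

/-- Extension by zero of a function on `Ω`. -/
def extZero (v : Om → ℝ) : ℝ → ℝ := fun x => if h : x ∈ Om then v ⟨x, h⟩ else 0

@[simp] theorem extZero_coe (v : Om → ℝ) (x : Om) : extZero v x = v x := by
  simp only [extZero, Subtype.coe_eta]
  rw [dif_pos x.2]

theorem integrable_Om_iff {f : ℝ → ℝ} :
    Integrable (fun x : Om => f x) ↔ IntegrableOn f Om := by
  rw [IntegrableOn, ← volume_coe_map measurableSet_Ioo,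
    (MeasurableEmbedding.subtype_coe measurableSet_Ioo).integrable_map_iff]
  rfl

theorem intervalIntegrable_extZero {v : Om → ℝ} (hv : Integrable v) :
    IntervalIntegrable (extZero v) volume (-1) 1 := by
  rw [intervalIntegrable_iff_integrableOn_Ioo_of_le (by norm_num)]
  apply integrable_Om_iff.1
  simpa using hv

theorem integrable_extZero {v : Om → ℝ} (hv : Integrable v) : Integrable (extZero v) := by
  have h : IntegrableOn (extZero v) Om := integrable_Om_iff.1 (by simpa using hv)
  rw [← integrable_indicator_iff measurableSet_Ioo] at h
  have e : Om.indicator (extZero v) = extZero v := by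
    funext x
    by_cases hx : x ∈ Om
    · simp [hx]
    · rw [indicator_of_notMem hx, extZero, dif_neg hx]
  rwa [e] at h

theorem ae_Om_iff {p : ℝ → Prop} : (∀ᵐ x : Om, p x) ↔ ∀ᵐ x : ℝ, x ∈ Om → p x := by
  rw [← ae_restrict_iff' measurableSet_Ioo, ae_restrict_iff_subtype measurableSet_Ioo]
  rfl

/-! ### Weak derivatives and continuous versions on `Ω` -/

/-- Cauchy-Schwarz inequality. -/
theorem abs_integral_mul_le {α : Type*} [MeasurableSpace α] {μ : Measure α} {f g : α → ℝ}
    (hf : MemLp f 2 μ) (hg : MemLp g 2 μ) :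
    |∫ x, f x * g x ∂μ| ≤ √(∫ x, f x ^ 2 ∂μ) * √(∫ x, g x ^ 2 ∂μ) := by
  have key : ∀ {f g : α → ℝ}, (hf : MemLp f 2 μ) → (hg : MemLp g 2 μ) →
      inner ℝ hf.toLp hg.toLp = ∫ x, f x * g x ∂μ := by
    intro f g hf hg
    rw [L2.inner_def]
    apply integral_congr_ae
    filter_upwards [hf.coeFn_toLp, hg.coeFn_toLp] with x h1 h2
    rw [h1, h2]; simp [mul_comm]
  have hn : ∀ {f : α → ℝ} (hf : MemLp f 2 μ), √(∫ x, f x ^ 2 ∂μ) = ‖hf.toLp‖ := by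
    intro f hf
    rw [norm_eq_sqrt_real_inner, key hf hf]
    simp [sq]
  rw [hn hf, hn hg, ← key hf hg]
  exact abs_real_inner_le_norm _ _

theorem exists_contDiff_integral_eq_one :
    ∃ ρ : ℝ → ℝ, ContDiff ℝ ∞ ρ ∧ HasCompactSupport ρ ∧ tsupport ρ ⊆ Om ∧
      ∫ x : Om, ρ x = 1 := by
  let f : ContDiffBump (0 : ℝ) := ⟨1 / 4, 1 / 2, by norm_num, by norm_num⟩
  have ht : tsupport (f.normed volume) ⊆ Om := by
    rw [f.tsupport_normed_eq, Real.closedBall_eq_Icc]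
    intro x hx
    simp only [f] at hx
    constructor <;> linarith [hx.1, hx.2]
  refine ⟨f.normed volume, f.contDiff_normed, f.hasCompactSupport_normed, ht, ?_⟩
  rw [integral_coe measurableSet_Ioo (f.normed volume),
    setIntegral_eq_integral_of_forall_compl_eq_zero]
  · exact f.integral_normed
  · intro x hx
    exact image_eq_zero_of_notMem_tsupport (fun h => hx (ht h))

theorem integrable_mul_of_continuous {w : Om → ℝ} (hw : Integrable w) {ψ : ℝ → ℝ}
    (hψ : ContinuousOn ψ (Icc (-1) 1)) : Integrable fun x : Om => w x * ψ x := by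
  obtain ⟨C, hC⟩ := isCompact_Icc.exists_bound_of_continuousOn hψ
  refine hw.mul_bdd (c := C) ?_ ?_
  · exact (hψ.comp_continuous continuous_subtype_val
      (fun x => Ioo_subset_Icc_self x.2)).aestronglyMeasurable
  · exact ae_of_all _ fun x => hC _ (Ioo_subset_Icc_self x.2)

/-- The du Bois-Reymond lemma. -/
theorem ae_eq_const_of_integral_deriv_eq_zero {w : Om → ℝ} (hw : Integrable w)
    (h : ∀ φ : ℝ → ℝ, ContDiff ℝ ∞ φ → HasCompactSupport φ → tsupport φ ⊆ Om →
      ∫ x : Om, w x * deriv φ x = 0) : ∃ c, ∀ᵐ x : Om, w x = c := by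
  obtain ⟨ρ, hρ, hρc, hρs, hρ1⟩ := exists_contDiff_integral_eq_one
  set c := ∫ x : Om, w x * ρ x with hc
  refine ⟨c, ?_⟩
  have key : ∀ᵐ x : ℝ, x ∈ Om → extZero w x - c = 0 := by
    refine isOpen_Ioo.ae_eq_zero_of_integral_contDiff_smul_eq_zero ?_ ?_
    · exact ((integrable_extZero hw).locallyIntegrable.sub
        (locallyIntegrable_const c)).locallyIntegrableOn _
    · intro ψ hψ hψc hψs
      set m := ∫ x : Om, ψ x with hm
      -- Removing the mean with the reference bump `ρ` makes the primitive `φ` of `g` vanish near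
      -- both end points, so that `φ` is itself an admissible test function with derivative `g`.
      set g : ℝ → ℝ := fun x => ψ x - m * ρ x with hg
      have hgc : ContDiff ℝ ∞ g := hψ.sub (contDiff_const.mul hρ)
      set φ : ℝ → ℝ := fun x => ∫ y in (-1 : ℝ)..x, g y with hφ
      have hd : ∀ x, HasDerivAt φ (g x) x := fun x =>
        (intervalIntegral.integral_hasDerivAt_right (hgc.continuous.intervalIntegrable _ _)
          (hgc.continuous.stronglyMeasurableAtFilter _ _) hgc.continuous.continuousAt)
      have hderiv : deriv φ = g := funext fun x => (hd x).deriv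
      have hφc : ContDiff ℝ ∞ φ := by
        rw [contDiff_infty_iff_deriv]
        exact ⟨fun x => (hd x).differentiableAt, hderiv ▸ hgc⟩
      -- the support
      obtain ⟨a, ha, ha1, hsup⟩ : ∃ a, 0 < a ∧ a < 1 ∧ ∀ x, x ∉ Icc (-a) a → ψ x = 0 ∧ ρ x = 0 := by
        have hK : IsCompact (tsupport ψ ∪ tsupport ρ ∪ {0}) := (hψc.isCompact.union hρc.isCompact).union isCompact_singleton
        obtain ⟨z, hz, hzmax⟩ := hK.exists_isMaxOn ⟨0, by simp⟩ (continuous_abs (G := ℝ)).continuousOn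
        have hz1 : |z| < 1 := by
          have : z ∈ Om := by
            rcases hz with (hz | hz) | hz
            · exact hψs hz
            · exact hρs hz
            · rw [hz]; constructor <;> norm_num
          exact abs_lt.2 this
        refine ⟨(|z| + 1) / 2, by positivity, by linarith, fun x hx => ?_⟩
        have hx' : x ∉ tsupport ψ ∪ tsupport ρ ∪ {0} := by
          intro h'
          have h1 : |x| ≤ |z| := hzmax h'
          apply hx
          rw [mem_Icc, ← abs_le]
          linarith
        simp only [mem_union, not_or] at hx'
        exact ⟨image_eq_zero_of_notMem_tsupport hx'.1.1, image_eq_zero_of_notMem_tsupport hx'.1.2⟩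
      have hg0 : ∀ x, x ∉ Icc (-a) a → g x = 0 := fun x hx => by simp [hg, hsup x hx]
      have hgint : ∫ y in (-1 : ℝ)..1, g y = 0 := by
        rw [← integral_Om]
        simp only [hg]
        rw [integral_sub, integral_const_mul, hρ1, ← hm]
        · ring
        · simpa using integrable_mul_of_continuous (integrable_const (1 : ℝ)) hψ.continuous.continuousOn
        · simpa using integrable_mul_of_continuous (integrable_const m) hρ.continuous.continuousOn
      have hφ0 : ∀ x, x ∉ Icc (-a) a → φ x = 0 := by
        intro x hx
        rw [mem_Icc, not_and_or, not_le, not_le] at hx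
        have hz : ∀ p q : ℝ, (∀ y ∈ uIcc p q, y ∉ Icc (-a) a) → ∫ y in p..q, g y = 0 := by
          intro p q hpq
          rw [intervalIntegral.integral_congr (g := fun _ => 0) (fun y hy => hg0 y (hpq y hy))]
          simp
        rcases hx with hx | hx
        · apply hz
          intro y hy hy'
          rw [mem_uIcc] at hy
          rcases hy with hy | hy <;> linarith [hy.1, hy.2, hy'.1, hy'.2]
        · have : φ x = (∫ y in (-1 : ℝ)..1, g y) + ∫ y in (1 : ℝ)..x, g y :=
            (intervalIntegral.integral_add_adjacent_intervals (hgc.continuous.intervalIntegrable _ _)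
              (hgc.continuous.intervalIntegrable _ _)).symm
          rw [this, hgint, zero_add]
          apply hz
          intro y hy hy'
          rw [mem_uIcc] at hy
          rcases hy with hy | hy <;> linarith [hy.1, hy.2, hy'.1, hy'.2]
      have hts : tsupport φ ⊆ Icc (-a) a := by
        refine closure_minimal ?_ isClosed_Icc
        intro x hx
        by_contra hx'
        exact hx (hφ0 x hx')
      have h0 := h φ hφc (isCompact_Icc.of_isClosed_subset (isClosed_tsupport _) hts)
        (hts.trans fun x hx => ⟨by linarith [hx.1], by linarith [hx.2]⟩)
      rw [hderiv] at h0
      have hψint : Integrable fun x : Om => ψ x := by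
        simpa using integrable_mul_of_continuous (integrable_const (1 : ℝ)) hψ.continuous.continuousOn
      have e1 : ∫ x : Om, w x * g x = (∫ x : Om, w x * ψ x) - m * c := by
        rw [hc, ← integral_const_mul, ← integral_sub]
        · congr 1; ext x; simp only [hg]; ring
        · exact integrable_mul_of_continuous hw hψ.continuous.continuousOn
        · exact (integrable_mul_of_continuous hw hρ.continuous.continuousOn).const_mul m
      have e2 : ∫ x, ψ x • (extZero w x - c) = ∫ x : Om, ψ x * (extZero w x - c) := by
        rw [integral_coe measurableSet_Ioo (fun x => ψ x * (extZero w x - c)),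
          setIntegral_eq_integral_of_forall_compl_eq_zero]
        · rfl
        · intro x hx
          rw [image_eq_zero_of_notMem_tsupport (fun h => hx (hψs h)), zero_mul]
      rw [e2]
      simp only [extZero_coe, mul_sub]
      rw [integral_sub, integral_mul_const, ← hm]
      · rw [e1] at h0
        rw [← h0]
        congr 1
        congr 1; ext x; ring
      · simpa [mul_comm] using integrable_mul_of_continuous hw hψ.continuous.continuousOn
      · exact hψint.mul_const c
  have := ae_Om_iff.2 key
  filter_upwards [this] with x hx
  rw [extZero_coe] at hx
  linarith

theorem derivWithin_Icc_of_mem {ψ : ℝ → ℝ} {x : ℝ} (hx : x ∈ Om) :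
    derivWithin ψ (Icc (-1) 1) x = deriv ψ x :=
  derivWithin_of_mem_nhds (Icc_mem_nhds hx.1 hx.2)

theorem continuousOn_derivWithin_Icc {ψ : ℝ → ℝ} (hψ : ContDiffOn ℝ 1 ψ (Icc (-1) 1)) :
    ContinuousOn (derivWithin ψ (Icc (-1) 1)) (Icc (-1) 1) :=
  hψ.continuousOn_derivWithin (uniqueDiffOn_Icc (by norm_num)) le_rfl

/-- A function with a square-integrable generalized derivative has a continuous version, for which
integration by parts holds up to the boundary. -/
theorem HasWeakGrad.exists_continuous {u v : Om → ℝ} (hu : Integrable u)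
    (hv : MemLp v 2 volume) (h : HasWeakGrad u v) :
    ∃ U : ℝ → ℝ, Continuous U ∧ (∀ᵐ x : Om, u x = U x) ∧
      (∀ ψ : ℝ → ℝ, ContDiffOn ℝ 1 ψ (Icc (-1) 1) →
        (∫ x : Om, u x * derivWithin ψ (Icc (-1) 1) x) + ∫ x : Om, v x * ψ x =
          U 1 * ψ 1 - U (-1) * ψ (-1)) ∧
      ∀ x ∈ Icc (-1 : ℝ) 1, ∀ y ∈ Icc (-1 : ℝ) 1, |U x - U y| ≤ √|x - y| * √(∫ x, v x ^ 2) := by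
  have hvi : Integrable v := hv.integrable one_le_two
  -- The primitive `V` of `v` is absolutely continuous and has the weak derivative `v`. By the du
  -- Bois-Reymond lemma `u - V` is constant, so all claims reduce to `V`.
  set V : ℝ → ℝ := fun x => ∫ y in (-1 : ℝ)..x, extZero v y with hV
  have hAC : AbsolutelyContinuousOnInterval V (-1) 1 :=
    (intervalIntegrable_extZero hvi).absolutelyContinuousOnInterval_intervalIntegral (by simp)
  have hVd : ∀ᵐ x : Om, deriv V x = v x := by
    have := (intervalIntegrable_extZero hvi).ae_hasDerivAt_integral
    have h2 : ∀ᵐ x : Om, deriv V x = extZero v x := by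
      refine (ae_Om_iff (p := fun x => deriv V x = extZero v x)).2 ?_
      filter_upwards [this] with x hx hxO
      refine (hx ?_ (-1) (by simp)).deriv
      rw [uIcc_of_le (by norm_num)]
      exact Ioo_subset_Icc_self hxO
    simpa using h2
  have hVc : Continuous V := intervalIntegral.continuous_primitive
    (fun a b => (integrable_extZero hvi).intervalIntegrable) _
  have hVint : Integrable fun x : Om => V x := by
    simpa using integrable_mul_of_continuous (integrable_const (1 : ℝ)) hVc.continuousOn
  have ibp : ∀ ψ : ℝ → ℝ, ContDiffOn ℝ 1 ψ (Icc (-1) 1) →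
      (∫ x : Om, V x * derivWithin ψ (Icc (-1) 1) x) + ∫ x : Om, v x * ψ x =
          V 1 * ψ 1 - V (-1) * ψ (-1) := by
    intro ψ hψ
    have hψAC : AbsolutelyContinuousOnInterval ψ (-1) 1 := by
      apply ContDiffOn.absolutelyContinuousOnInterval
      rwa [uIcc_of_le (by norm_num)]
    have h1 := hAC.integral_mul_deriv_eq_deriv_mul hψAC
    rw [← integral_Om, ← integral_Om] at h1
    have e1 : ∫ x : Om, V x * derivWithin ψ (Icc (-1) 1) x = ∫ x : Om, V x * deriv ψ x := by
      congr 1; ext x; rw [derivWithin_Icc_of_mem x.2]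
    have e2 : ∫ x : Om, deriv V x * ψ x = ∫ x : Om, v x * ψ x := by
      apply integral_congr_ae
      filter_upwards [hVd] with x hx
      rw [hx]
    rw [e1, h1, e2]
    ring
  obtain ⟨c, hc⟩ := ae_eq_const_of_integral_deriv_eq_zero (w := fun x : Om => u x - V x)
    (hu.sub hVint) (by
      intro φ hφ hφc hφs
      have hφ1 : ContDiffOn ℝ 1 φ (Icc (-1) 1) := (hφ.of_le (by simp)).contDiffOn
      have h1 := ibp φ hφ1
      have h0 : φ 1 = 0 := image_eq_zero_of_notMem_tsupport (fun h => by simpa using (hφs h).2)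
      have h0' : φ (-1) = 0 := image_eq_zero_of_notMem_tsupport (fun h => by simpa using (hφs h).1)
      have hd : Continuous (deriv φ) := hφ.continuous_deriv (by simp)
      have e1 : ∫ x : Om, V x * derivWithin φ (Icc (-1) 1) x = ∫ x : Om, V x * deriv φ x := by
        congr 1; ext x; rw [derivWithin_Icc_of_mem x.2]
      rw [e1, h0, h0'] at h1
      simp only [sub_mul]
      rw [integral_sub (integrable_mul_of_continuous hu hd.continuousOn)
        (integrable_mul_of_continuous hVint hd.continuousOn), h φ hφ hφc hφs]
      linarith)
  refine ⟨fun x => V x + c, hVc.add continuous_const, ?_, ?_, ?_⟩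
  · filter_upwards [hc] with x hx
    linarith
  · intro ψ hψ
    have h1 := ibp ψ hψ
    have hd := continuousOn_derivWithin_Icc hψ
    have e1 : ∫ x : Om, u x * derivWithin ψ (Icc (-1) 1) x =
        (∫ x : Om, V x * derivWithin ψ (Icc (-1) 1) x) +
          ∫ x : Om, c * derivWithin ψ (Icc (-1) 1) x := by
      rw [← integral_add (integrable_mul_of_continuous hVint hd)
        (integrable_mul_of_continuous (integrable_const c) hd)]
      apply integral_congr_ae
      filter_upwards [hc] with x hx
      rw [← hx]; ring
    have e2 : ∫ x : Om, derivWithin ψ (Icc (-1) 1) x = ψ 1 - ψ (-1) := by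
      rw [integral_Om]
      have hψAC : AbsolutelyContinuousOnInterval ψ (-1) 1 := by
        apply ContDiffOn.absolutelyContinuousOnInterval
        rwa [uIcc_of_le (by norm_num)]
      rw [← hψAC.integral_deriv_eq_sub, ← integral_Om, ← integral_Om]
      congr 1; ext x; rw [derivWithin_Icc_of_mem x.2]
    rw [e1, integral_const_mul, e2]
    linarith
  · have key : ∀ x ∈ Icc (-1 : ℝ) 1, ∀ y ∈ Icc (-1 : ℝ) 1, x ≤ y →
        |V x + c - (V y + c)| ≤ √|x - y| * √(∫ x, v x ^ 2) := by
      intro x hx y hy hxy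
      -- Hölder continuity of exponent `1/2`: Cauchy-Schwarz for `v` against the indicator of `(x,
      -- y]`, whose `L²` norm is at most `√|x - y|`.
      have e : V y - V x = ∫ z : Om, (Ioc x y).indicator 1 (z : ℝ) * v z := by
        have e1 : V y - V x = ∫ z in x..y, extZero v z :=
          intervalIntegral.integral_interval_sub_left
            (integrable_extZero hvi).intervalIntegrable (integrable_extZero hvi).intervalIntegrable
        have e2 := integral_coe measurableSet_Ioo (s := Om)
          (fun z => (Ioc x y).indicator 1 (z : ℝ) * extZero v z)
        simp only [extZero_coe] at e2
        rw [e1, e2, intervalIntegral.integral_of_le hxy, ← integral_indicator measurableSet_Ioc,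
          setIntegral_eq_integral_of_forall_compl_eq_zero]
        · congr 1; ext z
          by_cases hz : z ∈ Ioc x y <;> simp [hz]
        · intro z hz
          rw [extZero, dif_neg hz, mul_zero]
      have hm : MemLp (fun z : Om => (Ioc x y).indicator (1 : ℝ → ℝ) (z : ℝ)) 2 volume := by
        refine MemLp.of_bound (C := 1) ?_ ?_
        · exact ((measurable_one.indicator measurableSet_Ioc).comp
            measurable_subtype_coe).aestronglyMeasurable
        · refine ae_of_all _ fun z => ?_
          by_cases hz : (z : ℝ) ∈ Ioc x y <;> simp [hz]
      have hcs := abs_integral_mul_le hm hv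
      rw [← e] at hcs
      have : |V x + c - (V y + c)| = |V y - V x| := by
        rw [abs_sub_comm]; congr 1; ring
      rw [this]
      refine hcs.trans ?_
      gcongr
      have e3 := integral_coe measurableSet_Ioo (s := Om)
        (fun z => (Ioc x y).indicator (1 : ℝ → ℝ) (z : ℝ) ^ 2)
      rw [e3]
      have e4 : (fun z => (Ioc x y).indicator (1 : ℝ → ℝ) (z : ℝ) ^ 2) =
          (Ioc x y).indicator (1 : ℝ → ℝ) := by
        ext z; by_cases hz : z ∈ Ioc x y <;> simp [hz]
      rw [e4, integral_indicator_one measurableSet_Ioc, abs_sub_comm, abs_of_nonneg (sub_nonneg.2 hxy)]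
      rw [Measure.real]
      refine ENNReal.toReal_le_of_le_ofReal (sub_nonneg.2 hxy) ?_
      rw [← Real.volume_Ioc]
      exact Measure.restrict_apply_le _ _
    intro x hx y hy
    rcases le_total x y with h | h
    · exact key x hx y hy h
    · rw [abs_sub_comm, abs_sub_comm x y]
      exact key y hy x hx h

theorem HasWeakGrad.ae_unique {u v v' : Om → ℝ} (hv : Integrable v) (hv' : Integrable v')
    (h : HasWeakGrad u v) (h' : HasWeakGrad u v') : v =ᵐ[volume] v' := by
  have key : ∀ᵐ x : ℝ, x ∈ Om → extZero v x - extZero v' x = 0 := by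
    refine isOpen_Ioo.ae_eq_zero_of_integral_contDiff_smul_eq_zero ?_ ?_
    · exact ((integrable_extZero hv).sub
        (integrable_extZero hv')).locallyIntegrable.locallyIntegrableOn _
    · intro ψ hψ hψc hψs
      have e2 : ∫ x, ψ x • (extZero v x - extZero v' x) =
          ∫ x : Om, ψ x * (extZero v x - extZero v' x) := by
        rw [integral_coe measurableSet_Ioo (fun x => ψ x * (extZero v x - extZero v' x)),
          setIntegral_eq_integral_of_forall_compl_eq_zero]
        · rfl
        · intro x hx
          rw [image_eq_zero_of_notMem_tsupport (fun h => hx (hψs h)), zero_mul]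
      rw [e2]
      have h1 := h ψ hψ hψc hψs
      have h2 := h' ψ hψ hψc hψs
      simp only [extZero_coe, mul_sub]
      simp only [mul_comm (ψ _)]
      rw [integral_sub (integrable_mul_of_continuous hv hψ.continuous.continuousOn)
        (integrable_mul_of_continuous hv' hψ.continuous.continuousOn)]
      linarith
  have := ae_Om_iff.2 key
  filter_upwards [this] with x hx
  rw [extZero_coe, extZero_coe] at hx
  linarith

theorem HasWeakGrad.congr {u u' v v' : Om → ℝ} (hu : u =ᵐ[volume] u') (hv : v =ᵐ[volume] v')
    (h : HasWeakGrad u v) : HasWeakGrad u' v' := by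
  intro φ h1 h2 h3
  have e1 : ∫ x : Om, u' x * deriv φ x = ∫ x : Om, u x * deriv φ x :=
    integral_congr_ae (by filter_upwards [hu] with x hx; rw [hx])
  have e2 : ∫ x : Om, v' x * φ x = ∫ x : Om, v x * φ x :=
    integral_congr_ae (by filter_upwards [hv] with x hx; rw [hx])
  rw [e1, e2, h φ h1 h2 h3]

theorem weakGrad_ae_eq {u v : Om → ℝ} (hv : MemLp v 2 volume) (h : HasWeakGrad u v) :
    weakGrad u =ᵐ[volume] v := by
  have hex : ∃ v : Om → ℝ, MemLp v 2 volume ∧ HasWeakGrad u v := ⟨v, hv, h⟩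
  rw [weakGrad, dif_pos hex]
  exact hex.choose_spec.2.ae_unique (hex.choose_spec.1.integrable one_le_two)
    (hv.integrable one_le_two) h

theorem eq_of_ae_eq_Om {f g : ℝ → ℝ} (hf : ContinuousOn f (Icc (-1) 1))
    (hg : ContinuousOn g (Icc (-1) 1)) (h : ∀ᵐ x : Om, f x = g x) :
    EqOn f g (Icc (-1) 1) := by
  have h1 : ∀ᵐ x ∂(volume.restrict (Ioo (-1 : ℝ) 1)), f x = g x := by
    rw [ae_restrict_iff' measurableSet_Ioo]; exact ae_Om_iff.1 h
  have h2 : EqOn f g (Ioo (-1) 1) :=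
    Measure.eqOn_Ioo_of_ae_eq volume h1 (hf.mono Ioo_subset_Icc_self) (hg.mono Ioo_subset_Icc_self)
  have hcl : closure (Ioo (-1 : ℝ) 1) = Icc (-1) 1 := closure_Ioo (by norm_num)
  exact h2.of_subset_closure hf hg Ioo_subset_Icc_self hcl.ge

/-- Two continuous functions on `[-1, 1]` that agree almost everywhere in `Ω` agree everywhere, so
the arbitrary choice in `boundaryValue` is immaterial. -/
theorem boundaryValue_eq {u : Om → ℝ} {U : ℝ → ℝ} (hU : Continuous U)
    (h : ∀ᵐ x : Om, u x = U x) (y : Icc (-1 : ℝ) 1) : boundaryValue u y = U y := by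
  have hex : ∃ w : C(Icc (-1 : ℝ) 1, ℝ), ∀ᵐ x : Om, w (inclusion Ioo_subset_Icc_self x) = u x :=
    ⟨⟨fun y => U y, by fun_prop⟩, by filter_upwards [h] with x hx; exact hx.symm⟩
  rw [boundaryValue, dif_pos hex]
  have hw := hex.choose_spec
  set w := hex.choose
  have hE : ContinuousOn (IccExtend (by norm_num : (-1 : ℝ) ≤ 1) w) (Icc (-1) 1) :=
    (w.continuous.Icc_extend' (h := by norm_num)).continuousOn
  have := eq_of_ae_eq_Om hE hU.continuousOn (by
    filter_upwards [h, hw] with x hx hx'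
    rw [← hx, ← hx', IccExtend_of_mem _ _ (Ioo_subset_Icc_self x.2)])
  have h2 := this y.2
  rwa [IccExtend_of_mem _ _ y.2] at h2

/-! ### Measurability in time and densities of trajectories -/

section

/-- `g` is the pointwise limit of `g ∘ s n`, where `s n t` is the first point of the grid of mesh `1
/ (n + 1)` strictly to the right of `t`, cut off at `T`. Each `g ∘ s n` factors through a natural
number. -/
theorem measurable_of_rightContinuous {T : ℝ} {β : Type*} [TopologicalSpace β]
    [TopologicalSpace.PseudoMetrizableSpace β] [MeasurableSpace β] [BorelSpace β]
    {g : Icc (0 : ℝ) T → β} (hg : ∀ t, ContinuousWithinAt g (Ici t) t) : Measurable g := by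
  rcases lt_or_ge T 0 with hT | hT
  · have : IsEmpty (Icc (0 : ℝ) T) := by rw [Icc_eq_empty (not_le.2 hT)]; infer_instance
    exact measurable_of_empty g
  have hmem : ∀ (n k : ℕ), min T (((k : ℝ) + 1) / ((n : ℝ) + 1)) ∈ Icc (0 : ℝ) T := fun n k =>
    ⟨le_min hT (by positivity), min_le_left _ _⟩
  let s : ℕ → Icc (0 : ℝ) T → Icc (0 : ℝ) T := fun n t => ⟨_, hmem n ⌊((n : ℝ) + 1) * t⌋₊⟩
  have hms : ∀ n, Measurable (g ∘ s n) := by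
    intro n
    have h1 : Measurable fun k : ℕ => g ⟨_, hmem n k⟩ := measurable_from_nat
    have h2 : Measurable fun t : Icc (0 : ℝ) T => ⌊((n : ℝ) + 1) * t⌋₊ :=
      Nat.measurable_floor.comp (measurable_subtype_coe.const_mul _)
    exact h1.comp h2
  refine measurable_of_tendsto_metrizable hms (tendsto_pi_nhds.2 fun t => ?_)
  have hge : ∀ n, t ≤ s n t := by
    intro n
    refine Subtype.coe_le_coe.1 (le_min t.2.2 ?_)
    rw [le_div_iff₀ (by positivity), mul_comm]
    exact (Nat.lt_floor_add_one _).le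
  have hle : ∀ n, (s n t : ℝ) ≤ t + 1 / ((n : ℝ) + 1) := by
    intro n
    refine (min_le_right _ _).trans ?_
    have e : ((t : ℝ) + 1 / ((n : ℝ) + 1)) * ((n : ℝ) + 1) = ((n : ℝ) + 1) * t + 1 := by
      field_simp
    rw [div_le_iff₀ (by positivity), e]
    have := Nat.floor_le (show 0 ≤ ((n : ℝ) + 1) * t from mul_nonneg (by positivity) t.2.1)
    linarith
  have hlim : Tendsto (fun n => s n t) atTop (𝓝 t) := by
    rw [tendsto_subtype_rng]
    refine tendsto_of_tendsto_of_tendsto_of_le_of_le tendsto_const_nhds ?_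
      (fun n => Subtype.coe_le_coe.2 (hge n)) hle
    simpa using tendsto_const_nhds.add (tendsto_one_div_add_atTop_nhds_zero_nat (𝕜 := ℝ))
  exact (hg t).tendsto.comp (tendsto_nhdsWithin_iff.2 ⟨hlim, Eventually.of_forall hge⟩)

variable {T : ℝ}

theorem continuous_testAgainstNN (f : BoundedContinuousFunction Om ℝ≥0) :
    Continuous fun μ : MeasSpace => μ.1.testAgainstNN f :=
  (FiniteMeasure.continuous_testAgainstNN_eval f).comp continuous_subtype_val

/-- Integrals of bounded continuous functions are right-continuous in time, hence measurable.
Indicators of closed sets are limits of such functions, and the closed sets form a generating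
π-system. -/
theorem CadlagPath.measurable_measure (π : CadlagPath T MeasSpace) :
    Measurable fun t => ((π t).1 : Measure Om) := by
  have hb : ∀ f : BoundedContinuousFunction Om ℝ≥0,
      Measurable fun t => ∫⁻ x, f x ∂((π t).1 : Measure Om) := by
    intro f
    have h1 : Measurable fun t => (π t).1.testAgainstNN f :=
      measurable_of_rightContinuous fun t =>
        (continuous_testAgainstNN f).continuousAt.comp_continuousWithinAt (π.right_continuous t)
    simpa [FiniteMeasure.testAgainstNN_coe_eq] using h1.coe_nnreal_ennreal
  refine Measurable.measure_of_isPiSystem (S := {s | IsClosed s}) ?_ isPiSystem_isClosed ?_ ?_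
  · rw [BorelSpace.measurable_eq (α := Om), borel_eq_generateFrom_isClosed]
  · intro F hF
    exact measurable_of_tendsto_metrizable (fun n => hb (IsClosed.apprSeq hF n))
      (tendsto_pi_nhds.2 fun t => HasOuterApproxClosed.tendsto_lintegral_apprSeq hF _)
  · simpa using hb 1

/-- `u` is a jointly measurable density of the trajectory `π`, with values in `[0, 1]`. -/
structure IsVersion (π : CadlagPath T MeasSpace) (u : Icc (0 : ℝ) T × Om → ℝ) : Prop where
  measurable : Measurable u
  nonneg : ∀ p, 0 ≤ u p
  le_one : ∀ p, u p ≤ 1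
  eq_withDensity : ∀ t, ((π t).1 : Measure Om) =
    (volume : Measure Om).withDensity (fun x => ENNReal.ofReal (u (t, x)))

/-- Radon-Nikodym derivatives taken separately at each time need not be jointly measurable; the
derivative of one kernel with respect to another is. Truncation at `1` turns the almost everywhere
bound into one that holds everywhere. -/
theorem exists_isVersion {π : CadlagPath T MeasSpace} (h : ∀ t, π t ∈ AbsCont) :
    ∃ u, IsVersion π u := by
  let κ : ProbabilityTheory.Kernel (Icc (0 : ℝ) T) Om := ⟨fun t => (π t).1, π.measurable_measure⟩
  let η : ProbabilityTheory.Kernel (Icc (0 : ℝ) T) Om := ProbabilityTheory.Kernel.const _ volume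
  have hκ : ProbabilityTheory.IsFiniteKernel κ := by
    refine ⟨2, by simp, fun t => ?_⟩
    have h1 : (((π t).1 : Measure Om) univ) ≤ ((2 : ℝ≥0) : ℝ≥0∞) := by
      rw [← FiniteMeasure.ennreal_mass]
      exact ENNReal.coe_le_coe.2 (π t).2
    exact h1
  let u : Icc (0 : ℝ) T × Om → ℝ := fun p => min 1 (κ.rnDeriv η p.1 p.2).toReal
  refine ⟨u, ?_, fun p => le_min zero_le_one ENNReal.toReal_nonneg, fun p => min_le_left _ _, ?_⟩
  · exact measurable_const.min (ProbabilityTheory.Kernel.measurable_rnDeriv κ η).ennreal_toReal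
  · intro t
    obtain ⟨g, hg, hg01, hgt⟩ := h t
    have h1 : κ.rnDeriv η t =ᵐ[volume] ((π t).1 : Measure Om).rnDeriv volume :=
      ProbabilityTheory.Kernel.rnDeriv_eq_rnDeriv_measure (κ := κ) (η := η) (a := t)
    have h2 : ((π t).1 : Measure Om).rnDeriv volume =ᵐ[volume] fun x => ENNReal.ofReal (g x) := by
      rw [hgt]
      exact Measure.rnDeriv_withDensity _ hg.ennreal_ofReal
    rw [hgt]
    apply withDensity_congr_ae
    filter_upwards [h1, h2, hg01] with x hx1 hx2 hx3
    simp only [u]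
    rw [hx1, hx2, ENNReal.toReal_ofReal hx3.1, min_eq_right hx3.2]

namespace IsVersion

variable {π : CadlagPath T MeasSpace} {u : Icc (0 : ℝ) T × Om → ℝ}

theorem measurable_slice (h : IsVersion π u) (t : Icc (0 : ℝ) T) : Measurable fun x => u (t, x) :=
  h.measurable.comp measurable_prodMk_left

theorem density_ae_eq (h : IsVersion π u) (t : Icc (0 : ℝ) T) :
    density (π t) =ᵐ[volume] fun x => u (t, x) := by
  have h1 := Measure.rnDeriv_withDensity (volume : Measure Om) (h.measurable_slice t).ennreal_ofReal
  rw [← h.eq_withDensity t] at h1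
  filter_upwards [h1] with x hx
  rw [density, hx, ENNReal.toReal_ofReal (h.nonneg _)]

theorem integral_eq (h : IsVersion π u) (t : Icc (0 : ℝ) T) (F : Om → ℝ) :
    ∫ x, F x ∂((π t).1 : Measure Om) = ∫ x : Om, u (t, x) * F x := by
  rw [h.eq_withDensity t, integral_withDensity_eq_integral_toReal_smul
    (h.measurable_slice t).ennreal_ofReal (by simp)]
  simp [ENNReal.toReal_ofReal (h.nonneg _)]

theorem pairing_eq (h : IsVersion π u) (t : Icc (0 : ℝ) T) (F : ℝ → ℝ) :
    pairing (π t) F = ∫ x : Om, u (t, x) * F x :=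
  h.integral_eq t fun x => F x

theorem mem_absCont (h : IsVersion π u) (t : Icc (0 : ℝ) T) : π t ∈ AbsCont :=
  ⟨fun x => u (t, x), h.measurable_slice t, ae_of_all _ fun _ => ⟨h.nonneg _, h.le_one _⟩,
    h.eq_withDensity t⟩

theorem abs_le_one (h : IsVersion π u) (p) : |u p| ≤ 1 :=
  abs_le.2 ⟨by linarith [h.nonneg p], h.le_one p⟩

theorem integrable_slice (h : IsVersion π u) (t : Icc (0 : ℝ) T) :
    Integrable fun x => u (t, x) :=
  Integrable.of_bound (h.measurable_slice t).aestronglyMeasurable 1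
    (ae_of_all _ fun _ => h.abs_le_one _)

end IsVersion

end

section

variable {T : ℝ}

/-! ### Test functions -/

theorem continuous_rect {F : ℝ × ℝ → ℝ} (hF : ContinuousOn F (Icc 0 T ×ˢ Icc (-1 : ℝ) 1)) :
    Continuous fun p : Icc (0 : ℝ) T × Om => F (p.1, p.2) :=
  hF.comp_continuous (by fun_prop) fun p => ⟨p.1.2, Ioo_subset_Icc_self p.2.2⟩

theorem exists_bound_rect {F : ℝ × ℝ → ℝ} (hF : ContinuousOn F (Icc 0 T ×ˢ Icc (-1 : ℝ) 1)) :
    ∃ C, 0 ≤ C ∧ ∀ t ∈ Icc 0 T, ∀ x ∈ Icc (-1 : ℝ) 1, |F (t, x)| ≤ C := by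
  obtain ⟨C, hC⟩ := (isCompact_Icc.prod isCompact_Icc).exists_bound_of_continuousOn hF
  exact ⟨max C 0, le_max_right _ _, fun t ht x hx => (hC (t, x) ⟨ht, hx⟩).trans (le_max_left _ _)⟩

namespace IsCmn

variable {m n : ℕ} {G : ℝ → ℝ → ℝ}

theorem continuousOn (h : IsCmn m n T G) :
    ContinuousOn (fun p : ℝ × ℝ => G p.1 p.2) (Icc 0 T ×ˢ Icc (-1 : ℝ) 1) := by
  simpa using h.2.2.2 0 (Nat.zero_le _)

theorem continuousOn_dx (h : IsCmn m n T G) (hn : 1 ≤ n) :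
    ContinuousOn (fun p : ℝ × ℝ => dx G p.1 p.2) (Icc 0 T ×ˢ Icc (-1 : ℝ) 1) := by
  simpa [iteratedDerivWithin_one, dx] using h.2.2.2 1 hn

theorem continuousOn_dt (h : IsCmn m n T G) (hm : 1 ≤ m) :
    ContinuousOn (fun p : ℝ × ℝ => dt T G p.1 p.2) (Icc 0 T ×ˢ Icc (-1 : ℝ) 1) := by
  simpa [iteratedDerivWithin_one, dt] using h.2.2.1 1 hm

theorem contDiffOn_slice (h : IsCmn m n T G) (hn : 1 ≤ n) {t : ℝ} (ht : t ∈ Icc 0 T) :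
    ContDiffOn ℝ 1 (G t) (Icc (-1) 1) :=
  (h.2.1 t ht).of_le (by exact_mod_cast hn)

end IsCmn

theorem dt_eq_of_hasDerivAt (hT : 0 < T) {G Gt : ℝ → ℝ → ℝ}
    (ht : ∀ t x, HasDerivAt (fun s => G s x) (Gt t x) t) {t : ℝ} (hmem : t ∈ Icc 0 T) (x : ℝ) :
    dt T G t x = Gt t x :=
  (ht t x).hasDerivWithinAt.derivWithin (uniqueDiffOn_Icc hT t hmem)

theorem dx_eq_of_hasDerivAt {G Gx : ℝ → ℝ → ℝ}
    (hx : ∀ t x, HasDerivAt (G t) (Gx t x) x) (t : ℝ) {x : ℝ} (hmem : x ∈ Icc (-1 : ℝ) 1) :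
    dx G t x = Gx t x :=
  (hx t x).hasDerivWithinAt.derivWithin (uniqueDiffOn_Icc (by norm_num) x hmem)

theorem contDiff_one_of_hasDerivAt {f g : ℝ → ℝ} (h : ∀ x, HasDerivAt f (g x) x)
    (hg : Continuous g) : ContDiff ℝ 1 f := by
  rw [contDiff_one_iff_deriv]
  have : deriv f = g := funext fun x => (h x).deriv
  exact ⟨fun x => (h x).differentiableAt, this ▸ hg⟩

theorem isCmn_one_one (hT : 0 < T) {G Gt Gx : ℝ → ℝ → ℝ}
    (ht : ∀ t x, HasDerivAt (fun s => G s x) (Gt t x) t) (hx : ∀ t x, HasDerivAt (G t) (Gx t x) x)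
    (hc : Continuous fun p : ℝ × ℝ => G p.1 p.2) (hct : Continuous fun p : ℝ × ℝ => Gt p.1 p.2)
    (hcx : Continuous fun p : ℝ × ℝ => Gx p.1 p.2) : IsCmn 1 1 T G := by
  refine ⟨fun x _ => ?_, fun t _ => ?_, fun k hk => ?_, fun k hk => ?_⟩
  · exact (contDiff_one_of_hasDerivAt (fun t => ht t x) (hct.comp (by fun_prop :
      Continuous fun t : ℝ => (t, x)))).contDiffOn
  · exact (contDiff_one_of_hasDerivAt (fun x => hx t x) (hcx.comp (by fun_prop :
      Continuous fun x : ℝ => (t, x)))).contDiffOn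
  · interval_cases k
    · simpa using hc.continuousOn
    · refine hct.continuousOn.congr fun p hp => ?_
      rw [iteratedDerivWithin_one]
      exact dt_eq_of_hasDerivAt hT ht hp.1 p.2
  · interval_cases k
    · simpa using hc.continuousOn
    · refine hcx.continuousOn.congr fun p hp => ?_
      rw [iteratedDerivWithin_one]
      exact dx_eq_of_hasDerivAt hx p.1 hp.2

theorem isCmn_one_two (hT : 0 < T) {G Gt Gx Gxx : ℝ → ℝ → ℝ}
    (ht : ∀ t x, HasDerivAt (fun s => G s x) (Gt t x) t) (hx : ∀ t x, HasDerivAt (G t) (Gx t x) x)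
    (hxx : ∀ t x, HasDerivAt (Gx t) (Gxx t x) x)
    (hc : Continuous fun p : ℝ × ℝ => G p.1 p.2) (hct : Continuous fun p : ℝ × ℝ => Gt p.1 p.2)
    (hcx : Continuous fun p : ℝ × ℝ => Gx p.1 p.2)
    (hcxx : Continuous fun p : ℝ × ℝ => Gxx p.1 p.2) : IsCmn 1 2 T G := by
  obtain ⟨h1, h2, h3, h4⟩ := isCmn_one_one hT ht hx hc hct hcx
  refine ⟨h1, fun t _ => ?_, h3, fun k hk => ?_⟩
  · refine ContDiff.contDiffOn ?_
    have e : deriv (G t) = Gx t := funext fun x => (hx t x).deriv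
    rw [show ((2 : ℕ) : WithTop ℕ∞) = 1 + 1 from by norm_num, contDiff_succ_iff_deriv, e]
    exact ⟨fun x => (hx t x).differentiableAt, by simp,
      contDiff_one_of_hasDerivAt (fun x => hxx t x) (hcxx.comp (by fun_prop :
        Continuous fun x : ℝ => (t, x)))⟩
  · interval_cases k
    · exact h4 0 (by norm_num)
    · exact h4 1 le_rfl
    · refine hcxx.continuousOn.congr fun p hp => ?_
      have hu : UniqueDiffOn ℝ (Icc (-1 : ℝ) 1) := uniqueDiffOn_Icc (by norm_num)
      simp only
      rw [iteratedDerivWithin_succ]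
      have : EqOn (iteratedDerivWithin 1 (G p.1) (Icc (-1) 1)) (Gx p.1) (Icc (-1) 1) := by
        intro x hx'
        rw [iteratedDerivWithin_one]
        exact dx_eq_of_hasDerivAt hx p.1 hx'
      rw [derivWithin_congr this (this hp.2)]
      exact (hxx p.1 p.2).hasDerivWithinAt.derivWithin (hu _ hp.2)

/-! ### Space gradients of trajectories -/

/-- `v` is the generalized space derivative of `u`, square-integrable on `[0, T] × Ω`. -/
structure HasSpaceGrad (u v : Icc (0 : ℝ) T × Om → ℝ) : Prop where
  measurable : Measurable v
  memLp : MemLp v 2 volume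
  ae_grad : ∀ᵐ t : Icc (0 : ℝ) T, MemLp (fun x => v (t, x)) 2 volume ∧
    HasWeakGrad (fun x => u (t, x)) (fun x => v (t, x))

theorem MemLp_two_of_bound {α : Type*} [MeasurableSpace α] {μ : Measure α} [IsFiniteMeasure μ]
    {f : α → ℝ} (hf : AEStronglyMeasurable f μ) {C : ℝ} (h : ∀ x, |f x| ≤ C) : MemLp f 2 μ :=
  MemLp.of_bound hf C (ae_of_all _ h)

theorem lipschitzWith_integral_mul {w : Om → ℝ} (hw : Integrable w) :
    Continuous fun f : C(Icc (-1 : ℝ) 1, ℝ) =>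
      ∫ x : Om, w x * f (inclusion Ioo_subset_Icc_self x) := by
  have hint : ∀ f : C(Icc (-1 : ℝ) 1, ℝ),
      Integrable fun x : Om => w x * f (inclusion Ioo_subset_Icc_self x) := fun f =>
    hw.mul_bdd (c := ‖f‖) ((f.continuous.comp (continuous_inclusion _)).aestronglyMeasurable)
      (ae_of_all _ fun x => f.norm_coe_le_norm _)
  refine (LipschitzWith.of_dist_le_mul (K := (∫ x, |w x|).toNNReal) fun f g => ?_).continuous
  rw [Real.coe_toNNReal _ (integral_nonneg fun x => abs_nonneg _), Real.dist_eq,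
    ← integral_sub (hint f) (hint g), ← integral_mul_const]
  refine (abs_integral_le_integral_abs).trans (integral_mono ((hint f).sub (hint g)).abs
    (hw.abs.mul_const _) fun x => ?_)
  simp only
  rw [← mul_sub, abs_mul]
  exact mul_le_mul_of_nonneg_left (Real.dist_eq _ _ ▸ ContinuousMap.dist_apply_le_dist _) (abs_nonneg _)

/-- The smooth functions with compact support in `Ω`. -/
def testFun : Set (ℝ → ℝ) := {φ | ContDiff ℝ ∞ φ ∧ HasCompactSupport φ ∧ tsupport φ ⊆ Om}

/-- Allows a single null set of times to serve all test functions. Both sides of the weak identity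
are continuous in `(φ, φ')` for the uniform norm, so a family dense for that norm is enough. -/
theorem exists_countable_testFun : ∃ D : Set (ℝ → ℝ), D.Countable ∧ D ⊆ testFun ∧
    ∀ u v : Om → ℝ, Integrable u → Integrable v →
      (∀ φ ∈ D, ∫ x : Om, u x * deriv φ x = - ∫ x : Om, v x * φ x) → HasWeakGrad u v := by
  let J : testFun → C(Icc (-1 : ℝ) 1, ℝ) × C(Icc (-1 : ℝ) 1, ℝ) := fun φ =>
    (⟨fun x => φ.1 x, φ.2.1.continuous.comp continuous_subtype_val⟩,
      ⟨fun x => deriv φ.1 x, (φ.2.1.continuous_deriv (by simp)).comp continuous_subtype_val⟩)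
  obtain ⟨D, hD, hdense⟩ : ∃ D : Set testFun, D.Countable ∧ range J ⊆ closure (J '' D) := by
    have hs : TopologicalSpace.IsSeparable (range J) :=
      TopologicalSpace.IsSeparable.of_separableSpace _
    obtain ⟨c, hc, hcd⟩ := hs
    -- With the topology induced from a second countable space, the test functions themselves
    -- contain a countable dense subset, not merely points of the closure of their image.
    let _ : TopologicalSpace testFun := TopologicalSpace.induced J inferInstance
    have hJ : IsInducing J := ⟨rfl⟩
    have : SecondCountableTopology testFun := hJ.secondCountableTopology
    obtain ⟨D, hD, hDd⟩ := TopologicalSpace.exists_countable_dense testFun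
    refine ⟨D, hD, ?_⟩
    have := hJ.continuous.range_subset_closure_image_dense hDd
    exact this
  refine ⟨(↑) '' D, hD.image _, by rintro _ ⟨φ, _, rfl⟩; exact φ.2, fun u v hu hv h => ?_⟩
  intro φ h1 h2 h3
  have hclosed : IsClosed {p : C(Icc (-1 : ℝ) 1, ℝ) × C(Icc (-1 : ℝ) 1, ℝ) |
      ∫ x : Om, u x * p.2 (inclusion Ioo_subset_Icc_self x) =
        - ∫ x : Om, v x * p.1 (inclusion Ioo_subset_Icc_self x)} :=
    isClosed_eq ((lipschitzWith_integral_mul hu).comp continuous_snd)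
      ((lipschitzWith_integral_mul hv).comp continuous_fst).neg
  have hsub := hclosed.closure_subset_iff.2 (show J '' D ⊆ _ by
    rintro _ ⟨ψ, hψ, rfl⟩
    exact h ψ ⟨ψ, hψ, rfl⟩)
  exact hsub (hdense ⟨⟨φ, h1, h2, h3⟩, rfl⟩)

theorem ae_memLp_slice {v : Icc (0 : ℝ) T × Om → ℝ} (hm : Measurable v) (hv : MemLp v 2 volume) :
    ∀ᵐ t : Icc (0 : ℝ) T, MemLp (fun x => v (t, x)) 2 volume := by
  have h1 : Integrable (fun p => v p ^ 2) (volume.prod volume) := hv.integrable_sq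
  filter_upwards [h1.prod_right_ae] with t ht
  exact (memLp_two_iff_integrable_sq (hm.comp measurable_prodMk_left).aestronglyMeasurable).2 ht

theorem ae_eq_zero_of_integral_smooth_mul {h : Icc (0 : ℝ) T → ℝ} (hh : Integrable h)
    (h0 : ∀ θ : ℝ → ℝ, ContDiff ℝ ∞ θ → ∫ t : Icc (0 : ℝ) T, θ t * h t = 0) :
    ∀ᵐ t, h t = 0 := by
  have hme : MeasurableEmbedding ((↑) : Icc (0 : ℝ) T → ℝ) :=
    MeasurableEmbedding.subtype_coe measurableSet_Icc
  set f : ℝ → ℝ := Function.extend (↑) h 0 with hf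
  have hfc : ∀ t : Icc (0 : ℝ) T, f t = h t := fun t => Subtype.coe_injective.extend_apply h 0 t
  have hi : Integrable f (Measure.map ((↑) : Icc (0 : ℝ) T → ℝ) volume) := by
    rw [hme.integrable_map_iff]
    simpa [Function.comp_def, hfc] using hh
  have := ae_eq_zero_of_integral_contDiff_smul_eq_zero hi.locallyIntegrable (fun θ hθ _ => by
    rw [hme.integral_map]
    simpa [hfc] using h0 θ hθ)
  rw [hme.ae_map_iff] at this
  simpa [hfc] using this

/-- Varying `θ` localizes the identity at almost every time for each fixed `φ`; the countable family
of `exists_countable_testFun` then gives one null set for all `φ`. -/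
theorem hasSpaceGrad_of_test {u v : Icc (0 : ℝ) T × Om → ℝ} (hu : Measurable u)
    (hu1 : ∀ p, |u p| ≤ 1) (hvm : Measurable v) (hv : MemLp v 2 volume)
    (h : ∀ θ : ℝ → ℝ, ContDiff ℝ ∞ θ → ∀ φ ∈ testFun,
      ∫ p : Icc (0 : ℝ) T × Om, u p * (θ p.1 * deriv φ p.2) =
        - ∫ p : Icc (0 : ℝ) T × Om, v p * (θ p.1 * φ p.2)) : HasSpaceGrad u v := by
  refine ⟨hvm, hv, ?_⟩
  obtain ⟨D, hD, hDt, hDw⟩ := exists_countable_testFun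
  have hslice := ae_memLp_slice hvm hv
  have hui : Integrable u (volume.prod volume) :=
    Integrable.of_bound hu.aestronglyMeasurable 1 (ae_of_all _ hu1)
  have hvi : Integrable v (volume.prod volume) := hv.integrable one_le_two
  have hmul : ∀ {w : Icc (0 : ℝ) T × Om → ℝ}, Integrable w (volume.prod volume) → ∀ {F : ℝ × ℝ → ℝ},
      Continuous F → Integrable (fun p => w p * F (p.1, p.2)) (volume.prod volume) := by
    intro w hw F hF
    obtain ⟨C, -, hC⟩ := exists_bound_rect (T := T) (F := F) hF.continuousOn
    refine hw.mul_bdd (c := C) (continuous_rect hF.continuousOn).aestronglyMeasurable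
      (ae_of_all _ fun p => hC _ p.1.2 _ (Ioo_subset_Icc_self p.2.2))
  have hall : ∀ᵐ t : Icc (0 : ℝ) T, ∀ φ ∈ D, ∫ x : Om, u (t, x) * deriv φ x =
      - ∫ x : Om, v (t, x) * φ x := by
    rw [ae_ball_iff hD]
    intro φ hφ
    have hφt := hDt hφ
    have hφc : Continuous φ := hφt.1.continuous
    have hφd : Continuous (deriv φ) := hφt.1.continuous_deriv (by simp)
    have i1 := hmul hui (F := fun p => deriv φ p.2) (by fun_prop)
    have i2 := hmul hvi (F := fun p => φ p.2) (by fun_prop)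
    have key : ∀ᵐ t : Icc (0 : ℝ) T, (∫ x : Om, u (t, x) * deriv φ x) + ∫ x : Om, v (t, x) * φ x
        = 0 := by
      refine ae_eq_zero_of_integral_smooth_mul (i1.integral_prod_left.add i2.integral_prod_left) ?_
      intro θ hθ
      have j1 := hmul hui (F := fun p => θ p.1 * deriv φ p.2)
        (by have := hθ.continuous; fun_prop)
      have j2 := hmul hvi (F := fun p => θ p.1 * φ p.2) (by have := hθ.continuous; fun_prop)
      have e := h θ hθ φ hφt
      rw [Measure.volume_eq_prod, integral_prod _ j1, integral_prod _ j2] at e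
      rw [← sub_eq_zero, sub_neg_eq_add, ← integral_add j1.integral_prod_left j2.integral_prod_left] at e
      refine Eq.trans ?_ e
      congr 1; ext t
      rw [mul_add, ← integral_const_mul, ← integral_const_mul]
      congr 1 <;> · congr 1; ext x; ring
    filter_upwards [key] with t ht
    linarith
  filter_upwards [hslice, hall] with t ht1 ht2
  refine ⟨ht1, hDw _ _ ?_ (ht1.integrable one_le_two) ht2⟩
  exact Integrable.of_bound (hu.comp measurable_prodMk_left).aestronglyMeasurable 1
    (ae_of_all _ fun x => hu1 _)

end

/-! ### The space gradient of a trajectory of finite energy -/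

section

variable {T : ℝ}

theorem integrable_mul_rect {w : Icc (0 : ℝ) T × Om → ℝ} (hw : Integrable w) {F : ℝ × ℝ → ℝ}
    (hF : ContinuousOn F (Icc 0 T ×ˢ Icc (-1 : ℝ) 1)) :
    Integrable fun p => w p * F (p.1, p.2) := by
  obtain ⟨C, -, hC⟩ := exists_bound_rect hF
  exact hw.mul_bdd (c := C) (continuous_rect hF).aestronglyMeasurable
    (ae_of_all _ fun p => hC _ p.1.2 _ (Ioo_subset_Icc_self p.2.2))

theorem memLp_rect {F : ℝ × ℝ → ℝ} (hF : ContinuousOn F (Icc 0 T ×ˢ Icc (-1 : ℝ) 1)) :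
    MemLp (fun p : Icc (0 : ℝ) T × Om => F (p.1, p.2)) 2 volume := by
  obtain ⟨C, -, hC⟩ := exists_bound_rect hF
  exact MemLp_two_of_bound (continuous_rect hF).aestronglyMeasurable
    (fun p => hC _ p.1.2 _ (Ioo_subset_Icc_self p.2.2))

theorem integral_iterated {f : Icc (0 : ℝ) T × Om → ℝ} (hf : Integrable f) :
    ∫ t, ∫ x, f (t, x) = ∫ p, f p := by
  rw [Measure.volume_eq_prod] at hf ⊢
  exact (integral_prod _ hf).symm

theorem abs_chi_le {r : ℝ} (h0 : 0 ≤ r) (h1 : r ≤ 1) : |chi r| ≤ 1 := by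
  rw [chi, abs_of_nonneg (mul_nonneg h0 (by linarith))]
  nlinarith

theorem continuous_chi : Continuous chi := by unfold chi; fun_prop

theorem IsVersion.integrable {π : CadlagPath T MeasSpace} {u : Icc (0 : ℝ) T × Om → ℝ}
    (h : IsVersion π u) : Integrable u :=
  Integrable.of_bound h.measurable.aestronglyMeasurable 1 (ae_of_all _ h.abs_le_one)

theorem IsVersion.integrable_chi {π : CadlagPath T MeasSpace} {u : Icc (0 : ℝ) T × Om → ℝ}
    (h : IsVersion π u) : Integrable fun p => chi (u p) :=
  Integrable.of_bound (continuous_chi.measurable.comp h.measurable).aestronglyMeasurable 1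
    (ae_of_all _ fun p => abs_chi_le (h.nonneg p) (h.le_one p))

theorem energyFun_eq {π : CadlagPath T MeasSpace} {u : Icc (0 : ℝ) T × Om → ℝ}
    (h : IsVersion π u) {m : ℕ} {G : ℝ → ℝ → ℝ} (hG : IsCmn m 2 T G) :
    energyFun π G = 2 * (∫ p : Icc (0 : ℝ) T × Om, u p * dx G p.1 p.2)
      - ∫ p : Icc (0 : ℝ) T × Om, chi (u p) * G p.1 p.2 ^ 2 := by
  have i1 := integrable_mul_rect h.integrable (hG.continuousOn_dx (by norm_num))
  have i2 := integrable_mul_rect h.integrable_chi (F := fun q => G q.1 q.2 ^ 2)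
    (hG.continuousOn.pow 2)
  rw [energyFun, ← integral_iterated i1, ← integral_iterated i2]
  congr 2
  · congr 1; ext t
    apply integral_congr_ae
    filter_upwards [h.density_ae_eq t] with x hx
    rw [hx]
  · ext t
    apply integral_congr_ae
    filter_upwards [h.density_ae_eq t] with x hx
    rw [hx]

/-- The Riesz representation theorem, for a functional dominated by a Hilbert seminorm. -/
theorem exists_inner_eq_of_bound {W E : Type*} [AddCommGroup W] [Module ℝ W] [NormedAddCommGroup E]
    [InnerProductSpace ℝ E] [CompleteSpace E] (ι : W →ₗ[ℝ] E) (l : W →ₗ[ℝ] ℝ) (C : ℝ)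
    (h : ∀ w, |l w| ≤ C * ‖ι w‖) : ∃ v : E, ∀ w, l w = inner ℝ v (ι w) := by
  -- A linear section of `ι` over its range. The map `ι` need not be injective, but the bound forces
  -- `l` to vanish on its kernel, so `l ∘ s` does not depend on the section. Hahn-Banach extends it
  -- to `E`.
  obtain ⟨s, hs⟩ := ι.rangeRestrict.exists_rightInverse_of_surjective ι.range_rangeRestrict
  have hs' : ∀ y, ι (s y) = y := fun y => congrArg Subtype.val (LinearMap.congr_fun hs y)
  let f := (l ∘ₗ s).mkContinuous C fun y => by
    have := h (s y)
    rw [hs'] at this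
    exact this
  obtain ⟨g, hg, -⟩ := _root_.exists_extension_norm_eq _ f
  refine ⟨(InnerProductSpace.toDual ℝ E).symm g, fun w => ?_⟩
  rw [InnerProductSpace.toDual_symm_apply]
  have h1 := hg (ι.rangeRestrict w)
  have h2 : l (s (ι.rangeRestrict w) - w) = 0 := by
    have := h (s (ι.rangeRestrict w) - w)
    rw [map_sub ι, hs'] at this
    simpa using this
  rw [map_sub, sub_eq_zero] at h2
  rw [← h2]
  exact h1.symm

/-- Smooth functions of `(t, x)` supported in a strip `|x| ≤ r < 1`. -/
def smoothStrip : Submodule ℝ (ℝ × ℝ → ℝ) where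
  carrier := {g | ContDiff ℝ ∞ g ∧ ∃ r < 1, ∀ t x, r < |x| → g (t, x) = 0}
  add_mem' := by
    rintro f g ⟨hf, r, hr, hfr⟩ ⟨hg, r', hr', hgr⟩
    refine ⟨hf.add hg, max r r', max_lt hr hr', fun t x hx => ?_⟩
    simp [hfr t x ((le_max_left _ _).trans_lt hx), hgr t x ((le_max_right _ _).trans_lt hx)]
  zero_mem' := ⟨contDiff_const, 0, one_pos, fun _ _ _ => rfl⟩
  smul_mem' := by
    rintro c f ⟨hf, r, hr, hfr⟩
    refine ⟨hf.const_smul c, r, hr, fun t x hx => ?_⟩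
    simp [hfr t x hx]

theorem hasDerivAt_fst_of_contDiff {g : ℝ × ℝ → ℝ} (hg : ContDiff ℝ ∞ g) (t x : ℝ) :
    HasDerivAt (fun s => g (s, x)) (fderiv ℝ g (t, x) (1, 0)) t := by
  have h1 := ((hg.differentiable (by simp)) (t, x)).hasFDerivAt
  exact h1.comp_hasDerivAt t ((hasDerivAt_id t).prodMk (hasDerivAt_const t x))

theorem hasDerivAt_snd_of_contDiff {g : ℝ × ℝ → ℝ} (hg : ContDiff ℝ ∞ g) (t x : ℝ) :
    HasDerivAt (fun y => g (t, y)) (fderiv ℝ g (t, x) (0, 1)) x := by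
  have h1 := ((hg.differentiable (by simp)) (t, x)).hasFDerivAt
  exact h1.comp_hasDerivAt x ((hasDerivAt_const x t).prodMk (hasDerivAt_id x))

theorem contDiff_fderiv_apply {g : ℝ × ℝ → ℝ} (hg : ContDiff ℝ ∞ g) (v : ℝ × ℝ) :
    ContDiff ℝ ∞ fun p => fderiv ℝ g p v :=
  (hg.fderiv_right (by simp)).clm_apply contDiff_const

theorem isCmn_of_contDiff (hT : 0 < T) {g : ℝ × ℝ → ℝ} (hg : ContDiff ℝ ∞ g) :
    IsCmn 1 2 T fun t x => g (t, x) :=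
  isCmn_one_two hT (hasDerivAt_fst_of_contDiff hg) (hasDerivAt_snd_of_contDiff hg)
    (hasDerivAt_snd_of_contDiff (contDiff_fderiv_apply hg (0, 1))) hg.continuous
    (contDiff_fderiv_apply hg _).continuous (contDiff_fderiv_apply hg _).continuous
    (contDiff_fderiv_apply (contDiff_fderiv_apply hg _) _).continuous

theorem hasCompactSupportInOm_of_mem {g : ℝ × ℝ → ℝ} (hg : g ∈ smoothStrip) :
    HasCompactSupportInOm T fun t x => g (t, x) := by
  obtain ⟨-, r, hr, h⟩ := hg
  refine ⟨Icc 0 T ×ˢ Icc (-r) r, isCompact_Icc.prod isCompact_Icc,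
    prod_mono_right fun x hx => ⟨by linarith [hx.1], by linarith [hx.2]⟩, fun t ht x _ hK => ?_⟩
  refine h t x (not_le.1 fun hx => hK ⟨ht, ?_⟩)
  exact abs_le.1 hx

theorem FiniteEnergy.exists_bound {π : CadlagPath T MeasSpace} (h : FiniteEnergy π) :
    ∃ C : ℝ, ∀ G, IsCmn 1 2 T G → HasCompactSupportInOm T G → energyFun π G ≤ C := by
  have h0 : energy π ≠ ⊤ := h.2.ne
  refine ⟨(energy π).toReal, fun G h1 h2 => ?_⟩
  have hle : (energyFun π G : EReal) ≤ energy π := le_iSup₂ (f := fun G _ => (energyFun π G : EReal)) G ⟨h1, h2⟩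
  have hbot : energy π ≠ ⊥ := fun hb => by rw [hb] at hle; simp at hle
  rw [← EReal.coe_toReal h0 hbot] at hle
  exact_mod_cast hle

/-- As `χ ≤ 1`, finite energy gives `2 l(g) - ‖g‖² ≤ C` for `l(g) = ∫ u ∂ₓg`. Scaling `g` turns this
into `|l(g)| ≤ √C ‖g‖`, and the vector representing `l` is minus the gradient. -/
theorem FiniteEnergy.exists_hasSpaceGrad (hT : 0 < T) {π : CadlagPath T MeasSpace}
    (h : FiniteEnergy π) {u : Icc (0 : ℝ) T × Om → ℝ} (hu : IsVersion π u) :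
    ∃ v, HasSpaceGrad u v := by
  obtain ⟨C, hC⟩ := h.exists_bound
  have hmem : ∀ g : smoothStrip, MemLp (fun p : Icc (0 : ℝ) T × Om => g.1 (p.1, p.2)) 2 volume :=
    fun g => memLp_rect g.2.1.continuous.continuousOn
  have hdint : ∀ g : smoothStrip, Integrable fun p : Icc (0 : ℝ) T × Om =>
      u p * fderiv ℝ g.1 (p.1, p.2) (0, 1) := fun g =>
    integrable_mul_rect hu.integrable (F := fun q => fderiv ℝ g.1 q (0, 1))
      (contDiff_fderiv_apply g.2.1 _).continuous.continuousOn
  let ι : smoothStrip →ₗ[ℝ] Lp ℝ 2 (volume : Measure (Icc (0 : ℝ) T × Om)) :=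
    { toFun := fun g => (hmem g).toLp
      map_add' := fun f g => by
        rw [← MemLp.toLp_add]; rfl
      map_smul' := fun c g => by
        rw [RingHom.id_apply, ← MemLp.toLp_const_smul]; rfl }
  have hdiff : ∀ (g : smoothStrip) q, DifferentiableAt ℝ g.1 q := fun g q =>
    g.2.1.differentiable (by simp) q
  let l : smoothStrip →ₗ[ℝ] ℝ :=
    { toFun := fun g => ∫ p : Icc (0 : ℝ) T × Om, u p * fderiv ℝ g.1 (p.1, p.2) (0, 1)
      map_add' := fun f g => by
        rw [← integral_add (hdint f) (hdint g)]
        congr 1; ext p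
        have : fderiv ℝ (f + g).1 (p.1, p.2) = _ := fderiv_add (hdiff f _) (hdiff g _)
        rw [this, _root_.add_apply, mul_add]
      map_smul' := fun c g => by
        rw [RingHom.id_apply, smul_eq_mul, ← integral_const_mul]
        congr 1; ext p
        have : fderiv ℝ (c • g).1 (p.1, p.2) = _ := fderiv_const_smul (hdiff g _) c
        rw [this, _root_.smul_apply, smul_eq_mul]; ring }
  have hnorm : ∀ g, ‖ι g‖ ^ 2 = ∫ p : Icc (0 : ℝ) T × Om, g.1 (p.1, p.2) ^ 2 := by
    intro g
    rw [← real_inner_self_eq_norm_sq, L2.inner_def]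
    apply integral_congr_ae
    filter_upwards [(hmem g).coeFn_toLp] with p hp
    have : (ι g : Icc (0 : ℝ) T × Om → ℝ) p = g.1 (p.1, p.2) := hp
    rw [this]; simp [sq]
  have hbound : ∀ g, 2 * l g - ‖ι g‖ ^ 2 ≤ C := by
    intro g
    refine le_trans ?_ (hC _ (isCmn_of_contDiff hT g.2.1) (hasCompactSupportInOm_of_mem g.2))
    rw [energyFun_eq hu (isCmn_of_contDiff hT g.2.1), hnorm]
    have e1 : ∫ p : Icc (0 : ℝ) T × Om, u p * dx (fun t x => g.1 (t, x)) p.1 p.2 = l g := by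
      change _ = ∫ p : Icc (0 : ℝ) T × Om, u p * fderiv ℝ g.1 (p.1, p.2) (0, 1)
      congr 1; ext p
      rw [dx_eq_of_hasDerivAt (hasDerivAt_snd_of_contDiff g.2.1) _ (Ioo_subset_Icc_self p.2.2)]
    rw [e1]
    refine sub_le_sub_left (integral_mono ?_ (hmem g).integrable_sq fun p => ?_) _
    · exact integrable_mul_rect hu.integrable_chi (F := fun q => g.1 q ^ 2)
        (g.2.1.continuous.pow 2).continuousOn
    · have := (abs_le.1 (abs_chi_le (hu.nonneg p) (hu.le_one p))).2
      exact mul_le_of_le_one_left (sq_nonneg _) this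
  obtain ⟨v, hv⟩ := exists_inner_eq_of_bound ι l (√C) (by
    intro g
    -- The bound for `x • g` is a quadratic polynomial in `x` that is never negative; its
    -- discriminant gives `(l g)² ≤ C ‖ι g‖²`.
    have hquad : ∀ x : ℝ, 0 ≤ ‖ι g‖ ^ 2 * (x * x) + (-(2 * l g)) * x + C := by
      intro x
      have := hbound (x • g)
      rw [map_smul, map_smul, norm_smul, mul_pow, smul_eq_mul, Real.norm_eq_abs, sq_abs] at this
      nlinarith
    have hd := discrim_le_zero hquad
    rw [discrim] at hd
    have hC0 : 0 ≤ C := by simpa using hquad 0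
    rw [← Real.sqrt_sq (norm_nonneg (ι g)), ← Real.sqrt_mul hC0]
    apply Real.abs_le_sqrt
    nlinarith)
  have hvm := (Lp.stronglyMeasurable v).measurable
  refine ⟨fun p => - v p, hasSpaceGrad_of_test hu.measurable hu.abs_le_one hvm.neg
    (Lp.memLp v).neg ?_⟩
  rintro θ hθ φ ⟨hφ, hφc, hφs⟩
  have hg : (fun q : ℝ × ℝ => θ q.1 * φ q.2) ∈ smoothStrip := by
    refine ⟨(hθ.comp contDiff_fst).mul (hφ.comp contDiff_snd), ?_⟩
    rcases (tsupport φ).eq_empty_or_nonempty with he | hne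
    · refine ⟨0, one_pos, fun t x _ => ?_⟩
      have : x ∉ tsupport φ := by simp [he]
      simp [image_eq_zero_of_notMem_tsupport this]
    · obtain ⟨z, hz, hzmax⟩ := hφc.isCompact.exists_isMaxOn hne (continuous_abs (G := ℝ)).continuousOn
      refine ⟨|z|, abs_lt.2 (hφs hz), fun t x hx => ?_⟩
      have : x ∉ tsupport φ := fun h' => absurd (hzmax h') (not_le.2 hx)
      simp [image_eq_zero_of_notMem_tsupport this]
  have e := hv ⟨_, hg⟩
  have e1 : l ⟨_, hg⟩ = ∫ p : Icc (0 : ℝ) T × Om, u p * (θ p.1 * deriv φ p.2) := by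
    change ∫ p : Icc (0 : ℝ) T × Om, u p * fderiv ℝ (fun q : ℝ × ℝ => θ q.1 * φ q.2) (p.1, p.2) (0, 1) = _
    congr 1; ext p
    have h1 := hasDerivAt_snd_of_contDiff hg.1 p.1 p.2
    have h2 := ((hφ.differentiable (by simp)) p.2).hasDerivAt.const_mul (θ p.1)
    rw [h1.unique h2]
  rw [← e1, e, L2.inner_def, ← integral_neg]
  apply integral_congr_ae
  filter_upwards [(hmem ⟨_, hg⟩).coeFn_toLp] with p hp
  have : (ι ⟨_, hg⟩ : Icc (0 : ℝ) T × Om → ℝ) p = θ p.1 * φ p.2 := hp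
  rw [this]; simp [mul_comm]

end

/-! ### Boundary values, and the functionals in terms of `u` and `∇u` -/

section

variable {T : ℝ}

/-- The right boundary value of a function, from its generalized derivative. -/
def rightTrace (u v : Om → ℝ) : ℝ := (∫ x : Om, u x * (1 / 2)) + ∫ x : Om, v x * ((1 + x) / 2)

/-- The left boundary value of a function, from its generalized derivative. -/
def leftTrace (u v : Om → ℝ) : ℝ := (∫ x : Om, u x * (1 / 2)) - ∫ x : Om, v x * ((1 - x) / 2)

/-- `U` is the continuous version of `u`, which has the square-integrable derivative `v`. -/
structure IsContVersion (u v : Om → ℝ) (U : ℝ → ℝ) : Prop where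
  memLp : MemLp v 2 volume
  grad : HasWeakGrad u v
  continuous : Continuous U
  ae_eq : ∀ᵐ x : Om, u x = U x
  parts : ∀ ψ : ℝ → ℝ, ContDiffOn ℝ 1 ψ (Icc (-1) 1) →
    (∫ x : Om, u x * derivWithin ψ (Icc (-1) 1) x) + ∫ x : Om, v x * ψ x =
      U 1 * ψ 1 - U (-1) * ψ (-1)
  modulus : ∀ x ∈ Icc (-1 : ℝ) 1, ∀ y ∈ Icc (-1 : ℝ) 1,
    |U x - U y| ≤ √|x - y| * √(∫ x, v x ^ 2)

namespace IsContVersion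

variable {u v : Om → ℝ} {U : ℝ → ℝ}

theorem parts' (h : IsContVersion u v U) {ψ ψ' : ℝ → ℝ} (hd : ∀ x, HasDerivAt ψ (ψ' x) x)
    (hc : Continuous ψ') :
    (∫ x : Om, u x * ψ' x) + ∫ x : Om, v x * ψ x = U 1 * ψ 1 - U (-1) * ψ (-1) := by
  rw [← h.parts ψ (contDiff_one_of_hasDerivAt hd hc).contDiffOn]
  congr 2; ext x
  rw [derivWithin_Icc_of_mem x.2, (hd x).deriv]

/-- Integration by parts against `(1 + x) / 2`, which is `1` at the right end and `0` at the left.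
It makes the boundary value a linear functional of `(u, ∇u)`, hence measurable in time and
compatible with weak limits. -/
theorem right_eq (h : IsContVersion u v U) : U 1 = rightTrace u v := by
  have := h.parts' (ψ := fun x => (1 + x) / 2) (ψ' := fun _ => 1 / 2)
    (fun x => ((hasDerivAt_id x).const_add 1).div_const 2) continuous_const
  rw [rightTrace, this]; norm_num

theorem left_eq (h : IsContVersion u v U) : U (-1) = leftTrace u v := by
  have := h.parts' (ψ := fun x => (1 - x) / 2) (ψ' := fun _ => -1 / 2)
    (fun x => ((hasDerivAt_id x).const_sub 1).div_const 2) continuous_const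
  have e : ∫ x : Om, u x * (-1 / 2) = - ∫ x : Om, u x * (1 / 2) := by
    rw [← integral_neg]; congr 1; ext x; ring
  rw [e] at this
  rw [leftTrace]; norm_num at this ⊢; linarith

/-- The truncation of `U` to `[c, d]` is continuous and equals `U` almost everywhere, hence
everywhere on `[-1, 1]`. -/
theorem mem_Icc (h : IsContVersion u v U) {c d : ℝ} (hu : ∀ x, u x ∈ Icc c d) {x : ℝ}
    (hx : x ∈ Icc (-1 : ℝ) 1) : U x ∈ Icc c d := by
  have e := eq_of_ae_eq_Om (f := fun x => max c (min d (U x))) (g := U)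
    (by have := h.continuous; fun_prop) h.continuous.continuousOn (by
      filter_upwards [h.ae_eq] with x hx
      rw [← hx, min_eq_right (hu x).2, max_eq_right (hu x).1]) hx
  simp only at e
  have hcd : c ≤ d := (hu ⟨0, by norm_num, by norm_num⟩).1.trans (hu ⟨0, by norm_num, by norm_num⟩).2
  rw [← e]
  exact ⟨le_max_left _ _, max_le hcd (min_le_left _ _)⟩

end IsContVersion

theorem HasSpaceGrad.ae_exists_isContVersion {u v : Icc (0 : ℝ) T × Om → ℝ} (h : HasSpaceGrad u v)
    (hu : Measurable u) (hu1 : ∀ p, |u p| ≤ 1) :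
    ∀ᵐ t : Icc (0 : ℝ) T, ∃ U, IsContVersion (fun x => u (t, x)) (fun x => v (t, x)) U := by
  filter_upwards [h.ae_grad] with t ht
  have hi : Integrable fun x => u (t, x) :=
    Integrable.of_bound (hu.comp measurable_prodMk_left).aestronglyMeasurable 1
      (ae_of_all _ fun x => hu1 _)
  obtain ⟨U, h1, h2, h3, h4⟩ := ht.2.exists_continuous hi ht.1
  exact ⟨U, ht.1, ht.2, h1, h2, h3, h4⟩

/-- The boundary term, as a function of the boundary values. -/
def bdry (al be r l p q : ℝ) : ℝ :=
  r * (1 - be) * (Real.exp (-p) - 1) + be * (1 - r) * (Real.exp p - 1)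
    + l * (1 - al) * (Real.exp (-q) - 1) + al * (1 - l) * (Real.exp q - 1)

theorem boundaryTerm_eq (al be : ℝ) {w u v : Om → ℝ} {U : ℝ → ℝ} (h : IsContVersion u v U)
    (hw : w =ᵐ[volume] u) (f : ℝ → ℝ) :
    boundaryTerm al be w f = bdry al be (rightTrace u v) (leftTrace u v) (f 1) (f (-1)) := by
  have hwU : ∀ᵐ x : Om, w x = U x := by
    filter_upwards [hw, h.ae_eq] with x h1 h2
    rw [h1, h2]
  rw [boundaryTerm, boundaryValue_eq h.continuous hwU, boundaryValue_eq h.continuous hwU, bdry,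
    ← h.right_eq, ← h.left_eq]
  rfl

theorem continuous_diffusivity (a : ℝ) : Continuous (diffusivity a) := by
  unfold diffusivity; fun_prop

theorem continuous_mobility (a : ℝ) : Continuous (mobility a) :=
  continuous_chi.mul (continuous_diffusivity a)

theorem abs_diffusivity_le (a : ℝ) {r : ℝ} (h0 : 0 ≤ r) (h1 : r ≤ 1) :
    |diffusivity a r| ≤ 1 + 2 * |a| := by
  rw [diffusivity]
  refine (abs_add_le _ _).trans ?_
  rw [abs_mul, abs_mul, abs_of_nonneg h0]
  simp only [abs_one, Nat.abs_ofNat]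
  nlinarith [abs_nonneg a]

theorem abs_mobility_le (a : ℝ) {r : ℝ} (h0 : 0 ≤ r) (h1 : r ≤ 1) :
    |mobility a r| ≤ 1 + 2 * |a| := by
  rw [mobility, abs_mul]
  have h2 := abs_diffusivity_le a h0 h1
  have h3 := abs_chi_le h0 h1
  calc _ ≤ 1 * |diffusivity a r| := by gcongr
    _ ≤ _ := by rwa [one_mul]

section Formula

variable {π : CadlagPath T MeasSpace} {u v : Icc (0 : ℝ) T × Om → ℝ}

theorem integrable_diffusivity_mul (hu : IsVersion π u) (hv : HasSpaceGrad u v) (a : ℝ) :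
    Integrable fun p => diffusivity a (u p) * v p := by
  refine (hv.memLp.integrable one_le_two).bdd_mul (c := 1 + 2 * |a|) ?_ ?_
  · exact ((continuous_diffusivity a).measurable.comp hu.measurable).aestronglyMeasurable
  · exact ae_of_all _ fun p => abs_diffusivity_le a (hu.nonneg p) (hu.le_one p)

theorem integrable_mobility (hu : IsVersion π u) (a : ℝ) :
    Integrable fun p => mobility a (u p) :=
  Integrable.of_bound ((continuous_mobility a).measurable.comp hu.measurable).aestronglyMeasurable
    (1 + 2 * |a|) (ae_of_all _ fun p => abs_mobility_le a (hu.nonneg p) (hu.le_one p))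

/-- `Ĵ_H` is defined through the choices in `density`, `weakGrad` and `boundaryValue`, made at each
time separately. Here they are replaced by jointly measurable representatives, so that space-time
integrals can be used. -/
theorem Jhat_eq (al be a : ℝ) (hT : 0 < T) (hu : IsVersion π u) (hv : HasSpaceGrad u v)
    {H : ℝ → ℝ → ℝ} (hH : IsCmn 1 1 T H) :
    Jhat a al be hT H π = L0 hT π H
      + (∫ p : Icc (0 : ℝ) T × Om, diffusivity a (u p) * v p * dx H p.1 p.2)
      - (∫ p : Icc (0 : ℝ) T × Om, mobility a (u p) * dx H p.1 p.2 ^ 2)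
      - ∫ t : Icc (0 : ℝ) T, bdry al be (rightTrace (fun x => u (t, x)) (fun x => v (t, x)))
          (leftTrace (fun x => u (t, x)) (fun x => v (t, x))) (H t 1) (H t (-1)) := by
  have i1 := integrable_mul_rect (integrable_diffusivity_mul hu hv a) (hH.continuousOn_dx le_rfl)
  have i2 := integrable_mul_rect (integrable_mobility hu a) (F := fun q => dx H q.1 q.2 ^ 2)
    ((hH.continuousOn_dx le_rfl).pow 2)
  rw [Jhat, ← integral_iterated i1, ← integral_iterated i2]
  refine congrArg₂ (· - ·) (congrArg₂ (· - ·) (congrArg₂ (· + ·) rfl ?_) ?_) ?_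
  · apply integral_congr_ae
    filter_upwards [hv.ae_grad] with t ht
    apply integral_congr_ae
    have hd := hu.density_ae_eq t
    filter_upwards [hd, weakGrad_ae_eq ht.1 (ht.2.congr hd.symm (ae_eq_refl _))] with x h1 h2
    rw [h1, h2]
  · congr 1; ext t
    apply integral_congr_ae
    filter_upwards [hu.density_ae_eq t] with x hx
    rw [hx]
  · apply integral_congr_ae
    filter_upwards [hv.ae_exists_isContVersion hu.measurable hu.abs_le_one] with t ⟨U, hU⟩
    rw [boundaryTerm_eq al be hU (hu.density_ae_eq t)]

theorem integrable_dt (hu : IsVersion π u) {H : ℝ → ℝ → ℝ} {n : ℕ} (hH : IsCmn 1 n T H) :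
    Integrable fun p : Icc (0 : ℝ) T × Om => u p * dt T H p.1 p.2 :=
  integrable_mul_rect hu.integrable (hH.continuousOn_dt le_rfl)

theorem L0_eq (hT : 0 < T) (hu : IsVersion π u) {H : ℝ → ℝ → ℝ} {n : ℕ} (hH : IsCmn 1 n T H) :
    L0 hT π H = pairing (π (endTime hT)) (H T) - pairing (π (startTime hT)) (H 0)
      - ∫ p : Icc (0 : ℝ) T × Om, u p * dt T H p.1 p.2 := by
  rw [L0, ← integral_iterated (integrable_dt hu hH)]
  congr 2; ext t
  rw [hu.pairing_eq]

/-- Time integrals of the boundary values become space-time integrals of `u` and `v` against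
continuous kernels, which is the form in which the boundary term passes to weak limits. -/
theorem integral_trace (hu : Integrable u) (hv : Integrable v) {α : ℝ → ℝ}
    (hα : ContinuousOn α (Icc 0 T)) :
    Integrable (fun t : Icc (0 : ℝ) T =>
        rightTrace (fun x => u (t, x)) (fun x => v (t, x)) * α t) ∧
    Integrable (fun t : Icc (0 : ℝ) T =>
        leftTrace (fun x => u (t, x)) (fun x => v (t, x)) * α t) ∧
    ∫ t : Icc (0 : ℝ) T, rightTrace (fun x => u (t, x)) (fun x => v (t, x)) * α t =
      (∫ p : Icc (0 : ℝ) T × Om, u p * (1 / 2 * α p.1)) +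
        (∫ p : Icc (0 : ℝ) T × Om, v p * ((1 + p.2) / 2 * α p.1)) ∧
    ∫ t : Icc (0 : ℝ) T, leftTrace (fun x => u (t, x)) (fun x => v (t, x)) * α t =
      (∫ p : Icc (0 : ℝ) T × Om, u p * (1 / 2 * α p.1)) -
        (∫ p : Icc (0 : ℝ) T × Om, v p * ((1 - p.2) / 2 * α p.1)) := by
  have hα' : ContinuousOn (fun q : ℝ × ℝ => α q.1) (Icc 0 T ×ˢ Icc (-1 : ℝ) 1) :=
    hα.comp continuousOn_fst fun q hq => hq.1
  have j1 : Integrable (fun p : Icc (0 : ℝ) T × Om => u p * (1 / 2 * α p.1)) :=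
    integrable_mul_rect hu (F := fun q => 1 / 2 * α q.1) (hα'.const_mul (1 / 2))
  have j2 : Integrable (fun p : Icc (0 : ℝ) T × Om => v p * ((1 + p.2) / 2 * α p.1)) :=
    integrable_mul_rect hv (F := fun q => (1 + q.2) / 2 * α q.1)
      ((show Continuous fun q : ℝ × ℝ => (1 + q.2) / 2 by fun_prop).continuousOn.mul hα')
  have j3 : Integrable (fun p : Icc (0 : ℝ) T × Om => v p * ((1 - p.2) / 2 * α p.1)) :=
    integrable_mul_rect hv (F := fun q => (1 - q.2) / 2 * α q.1)
      ((show Continuous fun q : ℝ × ℝ => (1 - q.2) / 2 by fun_prop).continuousOn.mul hα')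
  have eR : ∀ t : Icc (0 : ℝ) T, rightTrace (fun x => u (t, x)) (fun x => v (t, x)) * α t =
      (∫ x : Om, u (t, x) * (1 / 2 * α t)) + ∫ x : Om, v (t, x) * ((1 + x) / 2 * α t) := by
    intro t
    rw [rightTrace, add_mul, ← integral_mul_const, ← integral_mul_const]
    simp only [mul_assoc]
  have eL : ∀ t : Icc (0 : ℝ) T, leftTrace (fun x => u (t, x)) (fun x => v (t, x)) * α t =
      (∫ x : Om, u (t, x) * (1 / 2 * α t)) - ∫ x : Om, v (t, x) * ((1 - x) / 2 * α t) := by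
    intro t
    rw [leftTrace, sub_mul, ← integral_mul_const, ← integral_mul_const]
    simp only [mul_assoc]
  have k1 : Integrable fun t : Icc (0 : ℝ) T => ∫ x : Om, u (t, x) * (1 / 2 * α t) :=
    j1.integral_prod_left
  have k2 : Integrable fun t : Icc (0 : ℝ) T => ∫ x : Om, v (t, x) * ((1 + x) / 2 * α t) :=
    j2.integral_prod_left
  have k3 : Integrable fun t : Icc (0 : ℝ) T => ∫ x : Om, v (t, x) * ((1 - x) / 2 * α t) :=
    j3.integral_prod_left
  simp only [eR, eL]
  refine ⟨k1.add k2, k1.sub k3, ?_, ?_⟩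
  · rw [← integral_iterated j1, ← integral_iterated j2, ← integral_add k1 k2]
  · rw [← integral_iterated j1, ← integral_iterated j3, ← integral_sub k1 k3]

theorem integral_mul_dx_eq (hu : IsVersion π u) (hv : HasSpaceGrad u v) {m n : ℕ} (hn : 1 ≤ n)
    {G : ℝ → ℝ → ℝ} (hG : IsCmn m n T G) (hG0 : HasCompactSupportInOm T G) :
    ∫ p : Icc (0 : ℝ) T × Om, u p * dx G p.1 p.2 =
      - ∫ p : Icc (0 : ℝ) T × Om, v p * G p.1 p.2 := by
  have i1 := integrable_mul_rect hu.integrable (hG.continuousOn_dx hn)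
  have i2 := integrable_mul_rect (hv.memLp.integrable one_le_two) hG.continuousOn
  rw [← integral_iterated i1, ← integral_iterated i2, ← integral_neg]
  apply integral_congr_ae
  filter_upwards [hv.ae_exists_isContVersion hu.measurable hu.abs_le_one] with t ⟨U, hU⟩
  have h1 := hU.parts (G t) (hG.contDiffOn_slice hn t.2)
  obtain ⟨K, -, hK, h0⟩ := hG0
  rw [h0 t t.2 1 (by norm_num) (fun h => by simpa using (hK h).2.2),
    h0 t t.2 (-1) (by norm_num) (fun h => by simpa using (hK h).2.1)] at h1
  have : ∫ x : Om, u (t, x) * dx G t x = ∫ x : Om, u (t, x) * derivWithin (G t) (Icc (-1) 1) x := rfl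
  rw [this]
  linarith

end Formula

/-! ### The rate functional and the functionals `J_H` -/

theorem rate_nonneg (a al be : ℝ) (hT : 0 < T) (π : CadlagPath T MeasSpace) :
    0 ≤ rate a al be hT π := by
  have h0 : IsCmn 1 1 T fun _ _ => 0 :=
    isCmn_one_one hT (Gt := fun _ _ => 0) (Gx := fun _ _ => 0) (fun _ _ => hasDerivAt_const _ _)
      (fun _ _ => hasDerivAt_const _ _) continuous_const continuous_const continuous_const
  refine le_trans ?_ (le_iSup₂ (f := fun H _ => J a al be hT H π) (fun _ _ => (0 : ℝ)) h0)
  rw [J]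
  split_ifs with h
  · have : Jhat a al be hT (fun _ _ => 0) π = 0 := by
      have e1 : dx (fun _ _ => (0 : ℝ)) = fun _ _ => 0 := by
        ext t x; simp [dx]
      have e2 : dt T (fun _ _ => (0 : ℝ)) = fun _ _ => 0 := by
        ext t x; simp [dt]
      simp [Jhat, L0, pairing, boundaryTerm, e1, e2]
    rw [this]; simp
  · exact le_top

theorem rate_le_iff {a al be : ℝ} {hT : 0 < T} {π : CadlagPath T MeasSpace} {q : ℝ} :
    rate a al be hT π ≤ q ↔ FiniteEnergy π ∧ ∀ H, IsCmn 1 1 T H → Jhat a al be hT H π ≤ q := by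
  constructor
  · intro h
    have hJ : ∀ H, IsCmn 1 1 T H → J a al be hT H π ≤ q := fun H hH =>
      (le_iSup₂ (f := fun H _ => J a al be hT H π) H hH).trans h
    have hF : FiniteEnergy π := by
      by_contra hF
      have h0 : IsCmn 1 1 T fun _ _ => 0 :=
        isCmn_one_one hT (Gt := fun _ _ => 0) (Gx := fun _ _ => 0)
          (fun _ _ => hasDerivAt_const _ _) (fun _ _ => hasDerivAt_const _ _)
          continuous_const continuous_const continuous_const
      have := hJ _ h0
      rw [J, if_neg hF] at this
      exact absurd this (by simp)
    refine ⟨hF, fun H hH => ?_⟩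
    have := hJ H hH
    rw [J, if_pos hF] at this
    exact_mod_cast this
  · rintro ⟨hF, h⟩
    refine iSup₂_le fun H hH => ?_
    rw [J, if_pos hF]
    exact_mod_cast h H hH

end

/-! ### Weighted time increments -/

section

variable {T : ℝ}

theorem continuous_integral_bounded {φ : Om → ℝ} (hφ : Continuous φ) {C : ℝ} (hC : ∀ x, |φ x| ≤ C) :
    Continuous fun μ : MeasSpace => ∫ x, φ x ∂(μ.1 : Measure Om) := by
  let f : BoundedContinuousFunction Om ℝ := BoundedContinuousFunction.ofNormedAddCommGroup φ hφ C hC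
  have : Continuous fun μ : FiniteMeasure Om => ∫ x, f x ∂(μ : Measure Om) :=
    continuous_iff_continuousAt.2 fun μ =>
      (FiniteMeasure.tendsto_iff_forall_integral_tendsto.1 tendsto_id) f
  exact this.comp continuous_subtype_val

theorem abs_exp_sub_one_le (x : ℝ) : |Real.exp x - 1| ≤ |x| * Real.exp |x| := by
  rcases le_total 0 x with h | h
  · rw [abs_of_nonneg h, abs_of_nonneg (by linarith [Real.add_one_le_exp x])]
    have h1 := Real.add_one_le_exp (-x)
    have h2 : Real.exp (-x) * Real.exp x = 1 := by rw [← Real.exp_add]; simp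
    nlinarith [Real.exp_pos x]
  · rw [abs_of_nonpos h, abs_of_nonpos (by linarith [Real.exp_le_one_iff.2 h])]
    have h1 := Real.add_one_le_exp x
    have h2 : 1 ≤ Real.exp (-x) := Real.one_le_exp (by linarith)
    nlinarith

theorem abs_bdry_le {al be r l p q K : ℝ} (hal : al ∈ Icc (0 : ℝ) 1) (hbe : be ∈ Icc (0 : ℝ) 1)
    (hr : r ∈ Icc (0 : ℝ) 1) (hl : l ∈ Icc (0 : ℝ) 1) (h1 : |Real.exp (-p) - 1| ≤ K)
    (h2 : |Real.exp p - 1| ≤ K) (h3 : |Real.exp (-q) - 1| ≤ K) (h4 : |Real.exp q - 1| ≤ K) :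
    |bdry al be r l p q| ≤ 4 * K := by
  have key : ∀ {c d z : ℝ}, c ∈ Icc (0 : ℝ) 1 → d ∈ Icc (0 : ℝ) 1 → |z| ≤ K → |c * d * z| ≤ K := by
    intro c d z hc hd hz
    rw [abs_mul, abs_of_nonneg (mul_nonneg hc.1 hd.1)]
    calc c * d * |z| ≤ 1 * |z| := by
          gcongr; exact mul_le_one₀ hc.2 hd.1 hd.2
      _ ≤ K := by rwa [one_mul]
  have hs : ∀ {c : ℝ}, c ∈ Icc (0 : ℝ) 1 → 1 - c ∈ Icc (0 : ℝ) 1 := fun hc =>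
    ⟨by linarith [hc.2], by linarith [hc.1]⟩
  rw [bdry]
  have k1 := key hr (hs hbe) h1
  have k2 := key hbe (hs hr) h2
  have k3 := key hl (hs hal) h3
  have k4 := key hal (hs hl) h4
  refine (abs_add_le _ _).trans ?_
  have := abs_add_three (r * (1 - be) * (Real.exp (-p) - 1)) (be * (1 - r) * (Real.exp p - 1))
    (l * (1 - al) * (Real.exp (-q) - 1))
  linarith

theorem HasSpaceGrad.ae_trace_mem {π : CadlagPath T MeasSpace} {u v : Icc (0 : ℝ) T × Om → ℝ}
    (hu : IsVersion π u) (hv : HasSpaceGrad u v) : ∀ᵐ t : Icc (0 : ℝ) T,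
      rightTrace (fun x => u (t, x)) (fun x => v (t, x)) ∈ Icc (0 : ℝ) 1 ∧
      leftTrace (fun x => u (t, x)) (fun x => v (t, x)) ∈ Icc (0 : ℝ) 1 := by
  filter_upwards [hv.ae_exists_isContVersion hu.measurable hu.abs_le_one] with t ⟨U, hU⟩
  rw [← hU.right_eq, ← hU.left_eq]
  have h := fun x => (⟨hu.nonneg (t, x), hu.le_one (t, x)⟩ : u (t, x) ∈ Icc (0 : ℝ) 1)
  exact ⟨hU.mem_Icc h (by norm_num), hU.mem_Icc h (by norm_num)⟩

theorem integral_time_prod (θ : ℝ → ℝ) :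
    ∫ p : Icc (0 : ℝ) T × Om, θ p.1 = 2 * ∫ t : Icc (0 : ℝ) T, θ t := by
  have := integral_prod_mul (μ := (volume : Measure (Icc (0 : ℝ) T))) (ν := (volume : Measure Om))
    (fun t => θ t) (fun _ => (1 : ℝ))
  simp only [mul_one, integral_const, smul_eq_mul, volume_real_Om] at this
  rw [mul_comm, ← this]; rfl

/-- The test function is `H = l θ(t) φ(x)`: the linear part of `Ĵ_H` is `l` times the weighted
increment, and the other terms move to the right-hand side. Since `0 ≤ θ ≤ 1`, one has `θ² ≤ θ`, so
all of them are controlled by `∫ θ`: the drift by Cauchy-Schwarz, the boundary term by `|exp y - 1|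
≤ |y| exp |y|`. -/
theorem mul_increment_le {a al be q : ℝ} {hT : 0 < T} (hal : al ∈ Icc (0 : ℝ) 1)
    (hbe : be ∈ Icc (0 : ℝ) 1) {π : CadlagPath T MeasSpace} {u v : Icc (0 : ℝ) T × Om → ℝ}
    (hu : IsVersion π u) (hv : HasSpaceGrad u v)
    (hJ : ∀ H, IsCmn 1 1 T H → Jhat a al be hT H π ≤ q) {φ φ' : ℝ → ℝ} {M : ℝ}
    (hφ : ∀ x, HasDerivAt φ (φ' x) x) (hφ' : Continuous φ')
    (hM : ∀ x ∈ Icc (-1 : ℝ) 1, |φ x| ≤ M) (hM' : ∀ x ∈ Icc (-1 : ℝ) 1, |φ' x| ≤ M)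
    {θ θ' : ℝ → ℝ} (hθ : ∀ t, HasDerivAt θ (θ' t) t) (hθ' : Continuous θ')
    (hθ01 : ∀ t, θ t ∈ Icc (0 : ℝ) 1) (l : ℝ) :
    l * (θ T * pairing (π (endTime hT)) φ - θ 0 * pairing (π (startTime hT)) φ
      - ∫ t : Icc (0 : ℝ) T, θ' t * pairing (π t) φ) ≤
    q + |l| * ((1 + 2 * |a|) * M * (√(∫ p, v p ^ 2) * √(2 * ∫ t : Icc (0 : ℝ) T, θ t)))
      + l ^ 2 * ((1 + 2 * |a|) * M ^ 2 * (2 * ∫ t : Icc (0 : ℝ) T, θ t))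
      + 4 * (|l| * M * Real.exp (|l| * M)) * ∫ t : Icc (0 : ℝ) T, θ t := by
  have hM0 : 0 ≤ M := (abs_nonneg _).trans (hM 0 (by norm_num))
  have hφc : Continuous φ := continuous_iff_continuousAt.2 fun x => (hφ x).continuousAt
  have hθc : Continuous θ := continuous_iff_continuousAt.2 fun x => (hθ x).continuousAt
  have htH : ∀ t x, HasDerivAt (fun s => l * (θ s * φ x)) (l * (θ' t * φ x)) t := fun t x =>
    ((hθ t).mul_const (φ x)).const_mul l
  have hxH : ∀ t x, HasDerivAt (fun y => l * (θ t * φ y)) (l * (θ t * φ' x)) x := fun t x =>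
    ((hφ x).const_mul (θ t)).const_mul l
  have hH : IsCmn 1 1 T fun t x => l * (θ t * φ x) :=
    isCmn_one_one hT htH hxH (by fun_prop) (by fun_prop) (by fun_prop)
  have hJH := hJ _ hH
  rw [Jhat_eq al be a hT hu hv hH] at hJH
  set c := 1 + 2 * |a| with hc
  have hc0 : 0 ≤ c := by positivity
  have hdx : ∀ p : Icc (0 : ℝ) T × Om, dx (fun t x => l * (θ t * φ x)) p.1 p.2 =
      l * (θ p.1 * φ' p.2) := fun p =>
    dx_eq_of_hasDerivAt hxH _ (Ioo_subset_Icc_self p.2.2)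
  simp only [hdx] at hJH
  have hθi : Integrable fun t : Icc (0 : ℝ) T => θ t :=
    Integrable.of_bound (hθc.comp continuous_subtype_val).aestronglyMeasurable 1
      (ae_of_all _ fun t => abs_le.2 ⟨by linarith [(hθ01 t).1], (hθ01 t).2⟩)
  have hθp : ∫ p : Icc (0 : ℝ) T × Om, θ p.1 ^ 2 ≤ 2 * ∫ t : Icc (0 : ℝ) T, θ t := by
    rw [← integral_time_prod]
    have hb : ∀ p : Icc (0 : ℝ) T × Om, |θ p.1| ≤ 1 := fun p =>
      abs_le.2 ⟨by linarith [(hθ01 p.1).1], (hθ01 p.1).2⟩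
    have hm : MemLp (fun p : Icc (0 : ℝ) T × Om => θ p.1) 2 volume :=
      MemLp_two_of_bound (C := 1) (by fun_prop : Continuous _).aestronglyMeasurable hb
    refine integral_mono hm.integrable_sq (hm.integrable one_le_two) fun p => ?_
    have := hθ01 p.1
    simp only
    nlinarith [this.1, this.2]
  -- the linear term
  have t0 : L0 hT π (fun t x => l * (θ t * φ x)) =
      l * (θ T * pairing (π (endTime hT)) φ - θ 0 * pairing (π (startTime hT)) φ
      - ∫ t : Icc (0 : ℝ) T, θ' t * pairing (π t) φ) := by
    have e : ∀ (μ : MeasSpace) (c d : ℝ) , pairing μ (fun x => c * (d * φ x)) = c * (d * pairing μ φ) := by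
      intro μ c d
      simp only [pairing]
      rw [← integral_const_mul d, ← integral_const_mul c]
    rw [L0, e, e, mul_sub, mul_sub, ← integral_const_mul]
    congr 2; ext t
    rw [← e]
    congr 1; ext x
    exact dt_eq_of_hasDerivAt hT htH t.2 x
  -- the drift term
  have t1 : |∫ p : Icc (0 : ℝ) T × Om, diffusivity a (u p) * v p * (l * (θ p.1 * φ' p.2))| ≤
      |l| * (c * M * (√(∫ p, v p ^ 2) * √(2 * ∫ t : Icc (0 : ℝ) T, θ t))) := by
    have hmem : MemLp (fun p : Icc (0 : ℝ) T × Om => diffusivity a (u p) * (l * (θ p.1 * φ' p.2))) 2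
        volume := by
      refine MemLp_two_of_bound (C := c * (|l| * (1 * M))) ?_ fun p => ?_
      · exact ((continuous_diffusivity a).measurable.comp hu.measurable).aestronglyMeasurable.mul
          (by fun_prop : Continuous _).aestronglyMeasurable
      · rw [abs_mul, abs_mul l, abs_mul (θ _)]
        gcongr
        · exact abs_diffusivity_le a (hu.nonneg p) (hu.le_one p)
        · exact abs_le.2 ⟨by linarith [(hθ01 p.1).1], (hθ01 p.1).2⟩
        · exact hM' _ (Ioo_subset_Icc_self p.2.2)
    have h1 := abs_integral_mul_le hv.memLp hmem
    have e : ∫ p : Icc (0 : ℝ) T × Om, diffusivity a (u p) * v p * (l * (θ p.1 * φ' p.2)) =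
        ∫ p : Icc (0 : ℝ) T × Om, v p * (diffusivity a (u p) * (l * (θ p.1 * φ' p.2))) := by
      congr 1; ext p; ring
    rw [e]
    refine h1.trans ?_
    have h2 : √(∫ p : Icc (0 : ℝ) T × Om, (diffusivity a (u p) * (l * (θ p.1 * φ' p.2))) ^ 2) ≤
        |l| * (c * M) * √(2 * ∫ t : Icc (0 : ℝ) T, θ t) := by
      rw [← Real.sqrt_sq (show 0 ≤ |l| * (c * M) by positivity), ← Real.sqrt_mul (sq_nonneg _)]
      apply Real.sqrt_le_sqrt
      refine le_trans ?_ (mul_le_mul_of_nonneg_left hθp (sq_nonneg _))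
      rw [← integral_const_mul]
      have hb : ∀ p : Icc (0 : ℝ) T × Om, |θ p.1| ≤ 1 := fun p =>
        abs_le.2 ⟨by linarith [(hθ01 p.1).1], (hθ01 p.1).2⟩
      have hm : MemLp (fun p : Icc (0 : ℝ) T × Om => θ p.1) 2 volume :=
        MemLp_two_of_bound (C := 1) (by fun_prop : Continuous _).aestronglyMeasurable hb
      refine integral_mono hmem.integrable_sq (hm.integrable_sq.const_mul _) fun p => ?_
      simp only
      rw [← mul_pow, ← sq_abs]
      rw [← sq_abs (|l| * (c * M) * θ p.1)]
      refine pow_le_pow_left₀ (abs_nonneg _) ?_ 2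
      have k1 := abs_diffusivity_le a (hu.nonneg p) (hu.le_one p)
      have k2 := hM' _ (Ioo_subset_Icc_self p.2.2)
      rw [abs_mul, abs_mul l, abs_mul (θ _), abs_mul, abs_mul |l|, abs_abs, abs_mul, abs_of_nonneg hc0, abs_of_nonneg hM0]
      calc _ ≤ c * (|l| * (|θ p.1| * M)) := by gcongr
        _ = _ := by ring
    calc _ ≤ √(∫ p, v p ^ 2) * (|l| * (c * M) * √(2 * ∫ t : Icc (0 : ℝ) T, θ t)) := by gcongr
      _ = _ := by ring
  -- the mobility term
  have t2 : ∫ p : Icc (0 : ℝ) T × Om, mobility a (u p) * (l * (θ p.1 * φ' p.2)) ^ 2 ≤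
      l ^ 2 * (c * M ^ 2 * (2 * ∫ t : Icc (0 : ℝ) T, θ t)) := by
    rw [← integral_time_prod, ← integral_const_mul, ← integral_const_mul]
    have hb : ∀ p : Icc (0 : ℝ) T × Om, |θ p.1| ≤ 1 := fun p =>
      abs_le.2 ⟨by linarith [(hθ01 p.1).1], (hθ01 p.1).2⟩
    have hm : MemLp (fun p : Icc (0 : ℝ) T × Om => θ p.1) 2 volume :=
      MemLp_two_of_bound (C := 1) (by fun_prop : Continuous _).aestronglyMeasurable hb
    refine integral_mono ?_ (((hm.integrable one_le_two).const_mul _).const_mul _) fun p => ?_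
    · exact integrable_mul_rect (integrable_mobility hu a)
        (F := fun q => (l * (θ q.1 * φ' q.2)) ^ 2) (by fun_prop : Continuous _).continuousOn
    · simp only
      have k1 := (abs_le.1 (abs_mobility_le a (hu.nonneg p) (hu.le_one p))).2
      have k2 := hM' _ (Ioo_subset_Icc_self p.2.2)
      have k3 : φ' p.2 ^ 2 ≤ M ^ 2 := by rw [← sq_abs]; gcongr
      have k4 : θ p.1 ^ 2 ≤ θ p.1 := by nlinarith [(hθ01 p.1).1, (hθ01 p.1).2]
      calc _ = l ^ 2 * (mobility a (u p) * (θ p.1 ^ 2 * φ' p.2 ^ 2)) := by ring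
        _ ≤ l ^ 2 * (c * (θ p.1 * M ^ 2)) := by
            gcongr
            exact (hθ01 p.1).1
        _ = _ := by ring
  -- the boundary term
  have t3 : |∫ t : Icc (0 : ℝ) T, bdry al be (rightTrace (fun x => u (t, x)) (fun x => v (t, x)))
          (leftTrace (fun x => u (t, x)) (fun x => v (t, x))) (l * (θ t * φ 1)) (l * (θ t * φ (-1)))| ≤
      4 * (|l| * M * Real.exp (|l| * M)) * ∫ t : Icc (0 : ℝ) T, θ t := by
    rw [← integral_const_mul, ← Real.norm_eq_abs]
    refine norm_integral_le_of_norm_le (hθi.const_mul _) ?_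
    filter_upwards [hv.ae_trace_mem hu] with t ht
    have hex : ∀ y : ℝ, |y| ≤ θ t * (|l| * M) →
        |Real.exp y - 1| ≤ |l| * M * Real.exp (|l| * M) * θ t := by
      intro y hy
      refine (abs_exp_sub_one_le y).trans ?_
      have : |y| ≤ |l| * M := hy.trans (mul_le_of_le_one_left (by positivity) (hθ01 t).2)
      calc |y| * Real.exp |y| ≤ (θ t * (|l| * M)) * Real.exp (|l| * M) := by
            gcongr
            exact mul_nonneg (hθ01 t).1 (by positivity)
        _ = _ := by ring
    have hy : ∀ x ∈ Icc (-1 : ℝ) 1, |l * (θ t * φ x)| ≤ θ t * (|l| * M) := by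
      intro x hx
      rw [abs_mul, abs_mul, abs_of_nonneg (hθ01 t).1]
      have := hM x hx
      calc _ ≤ |l| * (θ t * M) := by
            have := (hθ01 t).1
            gcongr
        _ = _ := by ring
    have h1 := hy 1 (by norm_num)
    have h2 := hy (-1) (by norm_num)
    refine (abs_bdry_le hal hbe ht.1 ht.2 (hex _ (by rwa [abs_neg])) (hex _ h1)
      (hex _ (by rwa [abs_neg])) (hex _ h2)).trans_eq ?_
    ring
  rw [t0] at hJH
  have t1' := (abs_le.1 t1).1
  have t3' := (abs_le.1 t3).2
  linarith

end

/-! ### Time increments of trajectories in a level set -/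

section

variable {T : ℝ}

theorem deriv_smoothTransition_eq_zero {x : ℝ} (hx : x < 0 ∨ 1 < x) :
    deriv Real.smoothTransition x = 0 := by
  rcases hx with hx | hx
  · have : Real.smoothTransition =ᶠ[𝓝 x] fun _ => 0 := by
      filter_upwards [Iio_mem_nhds hx] with y hy
      exact Real.smoothTransition.zero_of_nonpos (le_of_lt hy)
    rw [this.deriv_eq, deriv_const]
  · have : Real.smoothTransition =ᶠ[𝓝 x] fun _ => 1 := by
      filter_upwards [Ioi_mem_nhds hx] with y hy
      exact Real.smoothTransition.one_of_one_le (le_of_lt hy)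
    rw [this.deriv_eq, deriv_const]

theorem hasDerivAt_smoothTransition_ramp (n : ℕ) (c t : ℝ) :
    HasDerivAt (fun s => Real.smoothTransition (((n : ℝ) + 1) * (s - c)))
      (deriv Real.smoothTransition (((n : ℝ) + 1) * (t - c)) * ((n : ℝ) + 1)) t := by
  have h1 : HasDerivAt Real.smoothTransition _ (((n : ℝ) + 1) * (t - c)) :=
    ((Real.smoothTransition.contDiff (n := 1)).differentiable (by simp) _).hasDerivAt
  have h2 : HasDerivAt (fun s => ((n : ℝ) + 1) * (s - c)) ((n : ℝ) + 1) t := by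
    simpa using ((hasDerivAt_id t).sub_const c).const_mul ((n : ℝ) + 1)
  exact h1.comp t h2

theorem continuous_deriv_smoothTransition : Continuous (deriv Real.smoothTransition) :=
  (Real.smoothTransition.contDiff (n := 1)).continuous_deriv le_rfl

/-- The weak time increment over the ramp at `c` converges to the increment between `c` and `T`. -/
theorem tendsto_ramp_increment (hT : 0 < T) {g : Icc (0 : ℝ) T → ℝ}
    (hg : ∀ t, ContinuousWithinAt g (Ici t) t) {C : ℝ} (hC : ∀ t, |g t| ≤ C) (c : Icc (0 : ℝ) T) :
    Tendsto (fun n : ℕ => Real.smoothTransition (((n : ℝ) + 1) * (T - c)) * g (endTime hT)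
      - Real.smoothTransition (((n : ℝ) + 1) * (0 - c)) * g (startTime hT)
      - ∫ t : Icc (0 : ℝ) T,
          deriv Real.smoothTransition (((n : ℝ) + 1) * (t - c)) * ((n : ℝ) + 1) * g t)
      atTop (𝓝 (g (endTime hT) - g c)) := by
  have hgm := measurable_of_rightContinuous hg
  have hgi : Integrable g :=
    Integrable.of_bound hgm.aestronglyMeasurable C (ae_of_all _ hC)
  set D := deriv Real.smoothTransition with hD
  have hDc : Continuous D := continuous_deriv_smoothTransition
  have hD0 : ∀ x, 0 ≤ D x := fun x => Real.smoothTransition.monotone.deriv_nonneg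
  have hzero : ∀ n : ℕ, Real.smoothTransition (((n : ℝ) + 1) * (0 - c)) = 0 := fun n =>
    Real.smoothTransition.zero_of_nonpos
      (mul_nonpos_of_nonneg_of_nonpos (by positivity) (by linarith [c.2.1]))
  have hDi : ∀ n : ℕ, ∫ t : Icc (0 : ℝ) T, D (((n : ℝ) + 1) * (t - c)) * ((n : ℝ) + 1) =
      Real.smoothTransition (((n : ℝ) + 1) * (T - c)) := by
    intro n
    rw [integral_Tm hT.le fun t => D (((n : ℝ) + 1) * (t - c)) * ((n : ℝ) + 1),
      intervalIntegral.integral_eq_sub_of_hasDerivAt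
        (fun t _ => hasDerivAt_smoothTransition_ramp n c t), hzero, sub_zero]
    exact (Continuous.intervalIntegrable (by fun_prop) _ _)
  have hbd : ∀ n : ℕ, ∃ K, ∀ t : Icc (0 : ℝ) T,
      |D (((n : ℝ) + 1) * (t - c)) * ((n : ℝ) + 1)| ≤ K := by
    intro n
    obtain ⟨K, hK⟩ := isCompact_Icc.exists_bound_of_continuousOn (s := Icc 0 T)
      (f := fun t : ℝ => D (((n : ℝ) + 1) * (t - c)) * ((n : ℝ) + 1)) (by fun_prop : Continuous _).continuousOn
    exact ⟨K, fun t => hK t t.2⟩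
  have hi1 : ∀ n : ℕ, Integrable fun t : Icc (0 : ℝ) T =>
      D (((n : ℝ) + 1) * (t - c)) * ((n : ℝ) + 1) := by
    intro n
    obtain ⟨K, hK⟩ := hbd n
    exact Integrable.of_bound (by fun_prop : Continuous _).aestronglyMeasurable K (ae_of_all _ hK)
  have hi2 : ∀ n : ℕ, Integrable fun t : Icc (0 : ℝ) T =>
      D (((n : ℝ) + 1) * (t - c)) * ((n : ℝ) + 1) * g t := by
    intro n
    obtain ⟨K, hK⟩ := hbd n
    exact hgi.bdd_mul (c := K) (by fun_prop : Continuous _).aestronglyMeasurable (ae_of_all _ hK)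
  -- The derivative of the ramp has integral equal to the value of the ramp at `T`, so `g t` may be
  -- replaced by `g t - g c`. That derivative lives on `[c, c + 1 / (n + 1)]`, where
  -- right-continuity makes the difference small.
  have hsplit : ∀ n : ℕ, Real.smoothTransition (((n : ℝ) + 1) * (T - c)) * g (endTime hT)
      - Real.smoothTransition (((n : ℝ) + 1) * (0 - c)) * g (startTime hT)
      - ∫ t : Icc (0 : ℝ) T, D (((n : ℝ) + 1) * (t - c)) * ((n : ℝ) + 1) * g t =
      Real.smoothTransition (((n : ℝ) + 1) * (T - c)) * (g (endTime hT) - g c)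
      - ∫ t : Icc (0 : ℝ) T, D (((n : ℝ) + 1) * (t - c)) * ((n : ℝ) + 1) * (g t - g c) := by
    intro n
    simp only [mul_sub (D _ * _)]
    rw [integral_sub (hi2 n) ((hi1 n).mul_const _), integral_mul_const, hDi, hzero]
    ring
  simp only [hsplit]
  have hA : Tendsto (fun n : ℕ => Real.smoothTransition (((n : ℝ) + 1) * (T - c)) *
      (g (endTime hT) - g c)) atTop (𝓝 (g (endTime hT) - g c)) := by
    -- For `c = T` the ramp vanishes at `T`, but so does the increment.
    rcases c.2.2.eq_or_lt with h | h
    · have : c = endTime hT := Subtype.ext h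
      rw [this]; simp
    · refine tendsto_const_nhds.congr' ?_
      have h1 : Tendsto (fun n : ℕ => ((n : ℝ) + 1) * (T - c)) atTop atTop :=
        (tendsto_natCast_atTop_atTop.atTop_add tendsto_const_nhds).atTop_mul_const (by linarith)
      filter_upwards [h1.eventually_ge_atTop 1] with n hn
      rw [Real.smoothTransition.one_of_one_le hn, one_mul]
  have hB : Tendsto (fun n : ℕ => ∫ t : Icc (0 : ℝ) T,
      D (((n : ℝ) + 1) * (t - c)) * ((n : ℝ) + 1) * (g t - g c)) atTop (𝓝 0) := by
    rw [Metric.tendsto_atTop]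
    intro ε hε
    have hgc := Metric.continuousWithinAt_iff.1 (hg c) (ε / 2) (half_pos hε)
    obtain ⟨δ, hδ, hgδ⟩ := hgc
    obtain ⟨N, hN⟩ := exists_nat_gt (1 / δ)
    refine ⟨N, fun n hn => ?_⟩
    have hnδ : 1 < ((n : ℝ) + 1) * δ := by
      rw [div_lt_iff₀ hδ] at hN
      have : (N : ℝ) ≤ n := by exact_mod_cast hn
      nlinarith
    rw [Real.dist_eq, sub_zero, ← Real.norm_eq_abs]
    have hle : ‖∫ t : Icc (0 : ℝ) T, D (((n : ℝ) + 1) * (t - c)) * ((n : ℝ) + 1) * (g t - g c)‖ ≤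
        ∫ t : Icc (0 : ℝ) T, D (((n : ℝ) + 1) * (t - c)) * ((n : ℝ) + 1) * (ε / 2) := by
      refine norm_integral_le_of_norm_le ((hi1 n).mul_const _) (ae_of_all _ fun t => ?_)
      have hpos : 0 ≤ D (((n : ℝ) + 1) * (t - c)) * ((n : ℝ) + 1) :=
        mul_nonneg (hD0 _) (by positivity)
      rw [norm_mul, Real.norm_of_nonneg hpos]
      rcases lt_or_ge (t : ℝ) c with h | h
      · have : D (((n : ℝ) + 1) * (t - c)) = 0 := deriv_smoothTransition_eq_zero
          (Or.inl (mul_neg_of_pos_of_neg (by positivity) (by linarith)))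
        rw [this]; simp
      rcases lt_or_ge (1 : ℝ) (((n : ℝ) + 1) * (t - c)) with h' | h'
      · have : D (((n : ℝ) + 1) * (t - c)) = 0 := deriv_smoothTransition_eq_zero (Or.inr h')
        rw [this]; simp
      · refine mul_le_mul_of_nonneg_left ?_ hpos
        have hd : dist t c < δ := by
          rw [Subtype.dist_eq, Real.dist_eq, abs_of_nonneg (by linarith)]
          have hn1 : (0 : ℝ) < (n : ℝ) + 1 := by positivity
          exact lt_of_mul_lt_mul_left (h'.trans_lt hnδ) hn1.le
        exact (hgδ (show t ∈ Ici c from h) hd).le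
    rw [integral_mul_const, hDi] at hle
    have := Real.smoothTransition.le_one (((n : ℝ) + 1) * (T - c))
    have h2 : Real.smoothTransition (((n : ℝ) + 1) * (T - c)) * (ε / 2) ≤ 1 * (ε / 2) := by gcongr
    linarith
  simpa using hA.sub hB

/-- The weight `θ` is the difference of two smooth ramps starting at `s` and at `t`, an
approximation of the indicator of `[s, t]`. The parameter `l` stays free: large `l` makes `q / l`
small, after which small `t - s` makes the rest small. -/
theorem abs_increment_le {a al be q : ℝ} {hT : 0 < T} (hal : al ∈ Icc (0 : ℝ) 1)
    (hbe : be ∈ Icc (0 : ℝ) 1) {π : CadlagPath T MeasSpace} {u v : Icc (0 : ℝ) T × Om → ℝ}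
    (hu : IsVersion π u) (hv : HasSpaceGrad u v)
    (hJ : ∀ H, IsCmn 1 1 T H → Jhat a al be hT H π ≤ q) {φ φ' : ℝ → ℝ} {M : ℝ}
    (hφ : ∀ x, HasDerivAt φ (φ' x) x) (hφ' : Continuous φ')
    (hM : ∀ x ∈ Icc (-1 : ℝ) 1, |φ x| ≤ M) (hM' : ∀ x ∈ Icc (-1 : ℝ) 1, |φ' x| ≤ M)
    {l : ℝ} (hl : 0 < l) {s t : Icc (0 : ℝ) T} (hst : s ≤ t) :
    |pairing (π t) φ - pairing (π s) φ| ≤ q / l +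
      ((1 + 2 * |a|) * M * (√(∫ p, v p ^ 2) * √(2 * ((t : ℝ) - s)))
      + l * ((1 + 2 * |a|) * M ^ 2 * (2 * ((t : ℝ) - s)))
      + 4 * (M * Real.exp (l * M)) * ((t : ℝ) - s)) := by
  have hM0 : 0 ≤ M := (abs_nonneg _).trans (hM 0 (by norm_num))
  have hφc : Continuous φ := continuous_iff_continuousAt.2 fun x => (hφ x).continuousAt
  set g : Icc (0 : ℝ) T → ℝ := fun t => pairing (π t) φ with hg
  have hgr : ∀ t, ContinuousWithinAt g (Ici t) t := fun t =>
    (continuous_integral_bounded (φ := fun x : Om => φ x) (by fun_prop)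
      (fun x => hM _ (Ioo_subset_Icc_self x.2))).continuousAt.comp_continuousWithinAt
        (π.right_continuous t)
  have hgb : ∀ t, |g t| ≤ 2 * M := by
    intro t
    have : |∫ x : Om, u (t, x) * φ x| ≤ ∫ x : Om, M := by
      rw [← Real.norm_eq_abs]
      refine norm_integral_le_of_norm_le (integrable_const _) (ae_of_all _ fun x => ?_)
      rw [norm_mul, Real.norm_eq_abs, Real.norm_eq_abs]
      calc _ ≤ 1 * M := by
            gcongr
            · exact hu.abs_le_one _
            · exact hM _ (Ioo_subset_Icc_self x.2)
        _ = M := one_mul _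
    rw [integral_const, volume_real_Om, smul_eq_mul] at this
    simp only [hg, hu.pairing_eq]
    exact this
  set R : ℕ → ℝ → ℝ → ℝ := fun n c r => Real.smoothTransition (((n : ℝ) + 1) * (r - c)) with hR
  set R' : ℕ → ℝ → ℝ → ℝ := fun n c r =>
    deriv Real.smoothTransition (((n : ℝ) + 1) * (r - c)) * ((n : ℝ) + 1) with hR'
  have hR'c : ∀ n c, Continuous (R' n c) := fun n c => by
    have := continuous_deriv_smoothTransition
    simp only [hR']; fun_prop
  set θ : ℕ → ℝ → ℝ := fun n r => R n s r - R n t r with hθ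
  have hθd : ∀ n r, HasDerivAt (θ n) (R' n s r - R' n t r) r := fun n r =>
    (hasDerivAt_smoothTransition_ramp n s r).sub (hasDerivAt_smoothTransition_ramp n t r)
  have hθ01 : ∀ n r, θ n r ∈ Icc (0 : ℝ) 1 := by
    intro n r
    have h1 := Real.smoothTransition.le_one (((n : ℝ) + 1) * (r - s))
    have h2 := Real.smoothTransition.nonneg (((n : ℝ) + 1) * (r - t))
    have h3 : R n t r ≤ R n s r := by
      apply Real.smoothTransition.monotone
      have : (s : ℝ) ≤ t := hst
      gcongr
    simp only [hθ, hR] at *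
    constructor <;> linarith
  have hθm : ∀ n : ℕ, ∫ r : Icc (0 : ℝ) T, θ n r ≤ (t : ℝ) - s + 1 / ((n : ℝ) + 1) := by
    intro n
    have hn : (0 : ℝ) < (n : ℝ) + 1 := by positivity
    have hle : ∀ r : ℝ, θ n r ≤ (Icc (s : ℝ) (t + 1 / ((n : ℝ) + 1))).indicator 1 r := by
      intro r
      by_cases hr : r ∈ Icc (s : ℝ) (t + 1 / ((n : ℝ) + 1))
      · rw [indicator_of_mem hr]; exact (hθ01 n r).2
      · rw [indicator_of_notMem hr]
        rw [mem_Icc, not_and_or, not_le, not_le] at hr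
        have hst' : (s : ℝ) ≤ t := hst
        rcases hr with hr | hr
        · have h1 : R n s r = 0 := Real.smoothTransition.zero_of_nonpos (by nlinarith)
          have h2 : R n t r = 0 := Real.smoothTransition.zero_of_nonpos (by nlinarith)
          simp [hθ, h1, h2]
        · have h0 : 1 ≤ ((n : ℝ) + 1) * (r - t) := by
            have : 1 / ((n : ℝ) + 1) ≤ r - t := by linarith
            rw [div_le_iff₀ hn] at this; linarith
          have h1 : R n s r = 1 := Real.smoothTransition.one_of_one_le (by nlinarith)
          have h2 : R n t r = 1 := Real.smoothTransition.one_of_one_le h0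
          simp [hθ, h1, h2]
    have hθc : Continuous (θ n) := continuous_iff_continuousAt.2 fun x => (hθd n x).continuousAt
    rw [integral_coe measurableSet_Icc (θ n)]
    calc ∫ r in Icc 0 T, θ n r ≤ ∫ r in Icc 0 T, (Icc (s : ℝ) (t + 1 / ((n : ℝ) + 1))).indicator 1 r := by
          refine integral_mono (hθc.integrableOn_Icc) ?_ hle
          exact (integrable_const (1 : ℝ)).indicator measurableSet_Icc
      _ ≤ _ := by
          rw [integral_indicator_one measurableSet_Icc, Measure.real]
          have hst' : (s : ℝ) ≤ t := hst
          have h1n : (0 : ℝ) ≤ 1 / ((n : ℝ) + 1) := by positivity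
          refine ENNReal.toReal_le_of_le_ofReal (by linarith) ?_
          rw [show (t : ℝ) - s + 1 / ((n : ℝ) + 1) = t + 1 / ((n : ℝ) + 1) - s by ring, ← Real.volume_Icc]
          exact Measure.restrict_apply_le _ _
  have hlim : Tendsto (fun n => θ n T * g (endTime hT) - θ n 0 * g (startTime hT)
      - ∫ r : Icc (0 : ℝ) T, (R' n s r - R' n t r) * g r) atTop (𝓝 (g t - g s)) := by
    have h1 := (tendsto_ramp_increment hT hgr hgb s).sub (tendsto_ramp_increment hT hgr hgb t)
    rw [show g (endTime hT) - g s - (g (endTime hT) - g t) = g t - g s by ring] at h1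
    refine h1.congr fun n => ?_
    have hi : ∀ c : ℝ, Integrable fun r : Icc (0 : ℝ) T => R' n c r * g r := by
      intro c
      obtain ⟨K, hK⟩ := isCompact_Icc.exists_bound_of_continuousOn (s := Icc 0 T)
        (hR'c n c).continuousOn
      exact (Integrable.of_bound (measurable_of_rightContinuous hgr).aestronglyMeasurable (2 * M)
        (ae_of_all _ hgb)).bdd_mul (c := K)
          ((hR'c n c).comp continuous_subtype_val).aestronglyMeasurable (ae_of_all _ fun r => hK r r.2)
    have e : ∫ r : Icc (0 : ℝ) T, (R' n s r - R' n t r) * g r =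
        (∫ r : Icc (0 : ℝ) T, R' n s r * g r) - ∫ r : Icc (0 : ℝ) T, R' n t r * g r := by
      rw [← integral_sub (hi s) (hi t)]
      congr 1; ext r; ring
    rw [e]
    simp only [hθ, hR, hR']
    ring
  set B : ℝ → ℝ := fun m => (1 + 2 * |a|) * M * (√(∫ p, v p ^ 2) * √(2 * m))
      + l * ((1 + 2 * |a|) * M ^ 2 * (2 * m)) + 4 * (M * Real.exp (l * M)) * m with hB
  have hBmono : Monotone B := by
    intro x y hxy
    simp only [hB]
    gcongr
  have hBc : Continuous B := by simp only [hB]; fun_prop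
  have hBlim : Tendsto (fun n : ℕ => q / l + B ((t : ℝ) - s + 1 / ((n : ℝ) + 1))) atTop
      (𝓝 (q / l + B ((t : ℝ) - s))) := by
    refine tendsto_const_nhds.add ((hBc.tendsto _).comp ?_)
    simpa using tendsto_const_nhds.add (tendsto_one_div_add_atTop_nhds_zero_nat (𝕜 := ℝ))
  -- The two signs `e = ±1` of the multiplier give the two inequalities in the absolute value.
  have hmain : ∀ n, ∀ e : ℝ, |e| = 1 → e * (θ n T * g (endTime hT) - θ n 0 * g (startTime hT)
      - ∫ r : Icc (0 : ℝ) T, (R' n s r - R' n t r) * g r) ≤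
        q / l + B ((t : ℝ) - s + 1 / ((n : ℝ) + 1)) := by
    intro n e he
    have h := mul_increment_le hal hbe hu hv hJ hφ hφ' hM hM' (hθd n)
      ((hR'c n s).sub (hR'c n t)) (hθ01 n) (e * l)
    have he2 : e ^ 2 = 1 := by rw [← sq_abs, he, one_pow]
    rw [abs_mul, he, one_mul, abs_of_pos hl, mul_pow, he2, one_mul] at h
    refine le_trans ?_ (add_le_add_right (hBmono (hθm n)) _)
    rw [← mul_le_mul_iff_right₀ hl, mul_add, mul_div_cancel₀ _ hl.ne']
    simp only [hB]
    refine (le_of_eq ?_).trans (h.trans (le_of_eq ?_))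
    · simp only [hg]; ring
    · ring
  rw [abs_le]
  constructor
  · have := le_of_tendsto_of_tendsto' (hlim.const_mul (-1)) hBlim fun n => hmain n (-1) (by simp)
    linarith
  · have := le_of_tendsto_of_tendsto' (hlim.const_mul 1) hBlim fun n => hmain n 1 (by simp)
    linarith

end

/-! ### Equicontinuity and continuity of trajectories -/

section

variable {T : ℝ}

theorem exists_contDiff_integral_abs_sub_le {f : Om → ℝ} (hf : Integrable f) {ε : ℝ} (hε : 0 < ε) :
    ∃ φ : ℝ → ℝ, ContDiff ℝ 1 φ ∧ ∫ x : Om, |f x - φ x| ≤ ε := by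
  have hm : MemLp (extZero f) 1 volume := memLp_one_iff_integrable.2 (integrable_extZero hf)
  obtain ⟨g, hgc, hg, hfg⟩ := hm.exist_eLpNorm_sub_le ENNReal.one_ne_top le_rfl hε
  refine ⟨g, hg.of_le (by simp), ?_⟩
  have hgi : Integrable g := hg.continuous.integrable_of_hasCompactSupport hgc
  have hi : Integrable (extZero f - g) := (integrable_extZero hf).sub hgi
  have h1 : ∫ x, ‖(extZero f - g) x‖ ≤ ε := by
    rw [integral_norm_eq_lintegral_enorm hi.aestronglyMeasurable, ← eLpNorm_one_eq_lintegral_enorm]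
    exact ENNReal.toReal_le_of_le_ofReal hε.le hfg
  have h2 := integral_coe measurableSet_Ioo (s := Om) (fun x => |extZero f x - g x|)
  simp only [extZero_coe] at h2
  rw [h2]
  exact (setIntegral_le_integral hi.norm (ae_of_all _ fun x => norm_nonneg _)).trans h1

theorem integrable_of_continuous_bounded {f : Om → ℝ} (hf : Continuous f) {C : ℝ}
    (hC : ∀ x, |f x| ≤ C) : Integrable f :=
  Integrable.of_bound hf.aestronglyMeasurable C (ae_of_all _ hC)

theorem IsVersion.abs_integral_sub_le {π : CadlagPath T MeasSpace} {u : Icc (0 : ℝ) T × Om → ℝ}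
    (hu : IsVersion π u) (t : Icc (0 : ℝ) T) {f g : Om → ℝ} (hf : Integrable f)
    (hg : Integrable g) :
    |∫ x, f x ∂((π t).1 : Measure Om) - ∫ x, g x ∂((π t).1 : Measure Om)| ≤
      ∫ x : Om, |f x - g x| := by
  have hi : ∀ {f : Om → ℝ}, Integrable f → Integrable fun x => u (t, x) * f x := fun hf =>
    hf.bdd_mul (c := 1) (hu.measurable_slice t).aestronglyMeasurable
      (ae_of_all _ fun x => hu.abs_le_one _)
  rw [hu.integral_eq, hu.integral_eq, ← integral_sub (hi hf) (hi hg), ← Real.norm_eq_abs]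
  refine norm_integral_le_of_norm_le (hf.sub hg).abs (ae_of_all _ fun x => ?_)
  rw [← mul_sub, norm_mul, Real.norm_eq_abs]
  exact mul_le_of_le_one_left (norm_nonneg _) (hu.abs_le_one _)

/-- Trajectories with bounded gradient on which all the functionals `Ĵ_H` are bounded by `q` are
weakly equicontinuous. -/
theorem exists_equicontinuity {a al be q V : ℝ} {hT : 0 < T} (hal : al ∈ Icc (0 : ℝ) 1)
    (hbe : be ∈ Icc (0 : ℝ) 1) {f : Om → ℝ} (hf : Integrable f) {ε : ℝ} (hε : 0 < ε) :
    ∃ δ > 0, ∀ (π : CadlagPath T MeasSpace) (u v : Icc (0 : ℝ) T × Om → ℝ), IsVersion π u →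
      HasSpaceGrad u v → ∫ p, v p ^ 2 ≤ V → (∀ H, IsCmn 1 1 T H → Jhat a al be hT H π ≤ q) →
      ∀ s t : Icc (0 : ℝ) T, |(t : ℝ) - s| < δ →
      |∫ x, f x ∂((π t).1 : Measure Om) - ∫ x, f x ∂((π s).1 : Measure Om)| ≤ ε := by
  -- Densities are at most `1`, so an `L¹` error in the observable is an error of the same size in
  -- its integral, uniformly in time and in the trajectory. This error `ε / 4` is paid at both
  -- times.
  obtain ⟨φ, hφ, hfφ⟩ := exists_contDiff_integral_abs_sub_le hf (show 0 < ε / 4 by positivity)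
  have hφd := fun x => ((hφ.differentiable (by simp)) x).hasDerivAt
  have hφ' : Continuous (deriv φ) := hφ.continuous_deriv le_rfl
  obtain ⟨M₁, hM₁⟩ := isCompact_Icc.exists_bound_of_continuousOn (s := Icc (-1 : ℝ) 1)
    hφ.continuous.continuousOn
  obtain ⟨M₂, hM₂⟩ := isCompact_Icc.exists_bound_of_continuousOn (s := Icc (-1 : ℝ) 1)
    hφ'.continuousOn
  set M := max M₁ M₂ with hM
  have hM0 : 0 ≤ M := ((norm_nonneg _).trans (hM₁ 0 (by norm_num))).trans (le_max_left _ _)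
  -- This choice gives `q / l ≤ ε / 4`; afterwards `δ` makes the remaining terms less than `ε / 4`.
  set l : ℝ := 4 * (|q| + 1) / ε with hl
  have hl0 : 0 < l := by positivity
  have hql : q / l ≤ ε / 4 := by
    rw [div_le_iff₀ hl0, hl]
    have : ε / 4 * (4 * (|q| + 1) / ε) = |q| + 1 := by field_simp
    rw [this]
    linarith [le_abs_self q]
  set B : ℝ → ℝ := fun m => (1 + 2 * |a|) * M * (√V * √(2 * m))
      + l * ((1 + 2 * |a|) * M ^ 2 * (2 * m)) + 4 * (M * Real.exp (l * M)) * m with hB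
  have hBc : Continuous B := by simp only [hB]; fun_prop
  have hB0 : B 0 = 0 := by simp [hB]
  obtain ⟨δ, hδ, hBδ⟩ := Metric.continuous_iff.1 hBc 0 (ε / 4) (by positivity)
  have hφi : Integrable fun x : Om => φ x := integrable_of_continuous_bounded
    (hφ.continuous.comp continuous_subtype_val) fun x => hM₁ _ (Ioo_subset_Icc_self x.2)
  refine ⟨δ, hδ, fun π u v hu hv hV hJ => ?_⟩
  have key : ∀ s t : Icc (0 : ℝ) T, s ≤ t → |(t : ℝ) - s| < δ →
      |∫ x, f x ∂((π t).1 : Measure Om) - ∫ x, f x ∂((π s).1 : Measure Om)| ≤ ε := by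
    intro s t hst hd
    have h1 := abs_increment_le hal hbe hu hv hJ hφd hφ'
      (fun x hx => (hM₁ x hx).trans (le_max_left _ _))
      (fun x hx => (hM₂ x hx).trans (le_max_right _ _)) hl0 hst
    have h2 : (1 + 2 * |a|) * M * (√(∫ p, v p ^ 2) * √(2 * ((t : ℝ) - s)))
      + l * ((1 + 2 * |a|) * M ^ 2 * (2 * ((t : ℝ) - s)))
      + 4 * (M * Real.exp (l * M)) * ((t : ℝ) - s) ≤ B ((t : ℝ) - s) := by
      simp only [hB]
      gcongr
    have h3 := hBδ ((t : ℝ) - s) (by simpa using hd)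
    rw [hB0, Real.dist_eq, sub_zero] at h3
    have h3' := (abs_lt.1 h3).2
    have h4 := (hu.abs_integral_sub_le t hf hφi).trans hfφ
    have h5 := (hu.abs_integral_sub_le s hf hφi).trans hfφ
    have h6 : |∫ x : Om, φ x ∂((π t).1 : Measure Om) - ∫ x : Om, φ x ∂((π s).1 : Measure Om)| ≤
        ε / 2 := by
      refine h1.trans ?_
      linarith
    rw [abs_le] at h4 h5 h6 ⊢
    constructor <;> linarith [h4.1, h4.2, h5.1, h5.2, h6.1, h6.2]
  intro s t hd
  rcases le_total s t with h | h
  · exact key s t h hd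
  · rw [abs_sub_comm]
    exact key t s h (by rwa [abs_sub_comm])

theorem continuous_of_forall_integral {X : Type*} [TopologicalSpace X] {F : X → MeasSpace}
    (h : ∀ f : BoundedContinuousFunction Om ℝ, Continuous fun t => ∫ x, f x ∂((F t).1 : Measure Om)) :
    Continuous F := by
  refine continuous_iff_continuousAt.2 fun t => tendsto_subtype_rng.2 ?_
  exact FiniteMeasure.tendsto_iff_forall_integral_tendsto.2 fun f => (h f).continuousAt

/-- Equicontinuity is applied with the gradient norm of this one trajectory. Continuity must be
known before the uniform gradient bound, since the test functions that prove that bound require it.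
-/
theorem continuous_path {a al be q : ℝ} {hT : 0 < T} (hal : al ∈ Icc (0 : ℝ) 1)
    (hbe : be ∈ Icc (0 : ℝ) 1) {π : CadlagPath T MeasSpace} {u v : Icc (0 : ℝ) T × Om → ℝ}
    (hu : IsVersion π u) (hv : HasSpaceGrad u v)
    (hJ : ∀ H, IsCmn 1 1 T H → Jhat a al be hT H π ≤ q) : Continuous π.toFun := by
  refine continuous_of_forall_integral fun f => Metric.continuous_iff.2 fun s ε hε => ?_
  have hf : Integrable f := integrable_of_continuous_bounded f.continuous f.norm_coe_le_norm
  obtain ⟨δ, hδ, h⟩ := exists_equicontinuity (V := ∫ p, v p ^ 2) (q := q) (a := a) (hT := hT) hal hbe hf (half_pos hε)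
  refine ⟨δ, hδ, fun t ht => ?_⟩
  rw [Real.dist_eq]
  exact (h π u v hu hv le_rfl hJ s t ht).trans_lt (half_lt_self hε)

end

section

/-! ### Reflected mollifiers -/

/-- An even mollifier `ρ` supported in `[-δ, δ]`. -/
structure IsMollifier (ρ : ℝ → ℝ) (δ : ℝ) : Prop where
  pos : 0 < δ
  le_half : δ ≤ 1 / 2
  contDiff : ContDiff ℝ ∞ ρ
  even : ∀ x, ρ (-x) = ρ x
  nonneg : ∀ x, 0 ≤ ρ x
  eq_zero : ∀ x, δ ≤ |x| → ρ x = 0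
  integral_eq : ∫ x, ρ x = 1

/-- The mollifiers `ρ_n`. -/
def moll (n : ℕ) : ℝ → ℝ :=
  (⟨1 / (2 * ((n : ℝ) + 2)), 1 / ((n : ℝ) + 2), by positivity, by
    apply one_div_lt_one_div_of_lt (by positivity)
    have : (0 : ℝ) ≤ n := n.cast_nonneg
    linarith⟩ : ContDiffBump (0 : ℝ)).normed volume

theorem isMollifier_moll (n : ℕ) : IsMollifier (moll n) (1 / ((n : ℝ) + 2)) where
  pos := by positivity
  le_half := by
    apply one_div_le_one_div_of_le (by norm_num)
    have : (0 : ℝ) ≤ n := n.cast_nonneg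
    linarith
  contDiff := ContDiffBump.contDiff_normed _
  even := fun x => ContDiffBump.normed_neg _ x
  nonneg := fun x => ContDiffBump.nonneg_normed _ x
  eq_zero := fun x hx => by
    have h : x ∉ Function.support (moll n) := by
      rw [moll, ContDiffBump.support_normed_eq]
      simpa using hx
    simpa using h
  integral_eq := ContDiffBump.integral_normed _

/-- The kernel of the mollification of the even reflection of a function. -/
def refl (ρ : ℝ → ℝ) (x y : ℝ) : ℝ := ρ (x - y) + ρ (x + y - 2) + ρ (x + y + 2)

/-- The kernel of the mollification of the odd reflection of a function. -/
def oddRefl (ρ : ℝ → ℝ) (x y : ℝ) : ℝ := ρ (x - y) - ρ (x + y - 2) - ρ (x + y + 2)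

namespace IsMollifier

variable {ρ : ℝ → ℝ} {δ : ℝ}

theorem continuous (h : IsMollifier ρ δ) : Continuous ρ := h.contDiff.continuous

theorem continuous_deriv (h : IsMollifier ρ δ) : Continuous (deriv ρ) :=
  h.contDiff.continuous_deriv (by simp)

theorem hasDerivAt (h : IsMollifier ρ δ) (x : ℝ) : HasDerivAt ρ (deriv ρ x) x :=
  (h.contDiff.differentiable (by simp) x).hasDerivAt

theorem hasCompactSupport (h : IsMollifier ρ δ) : HasCompactSupport ρ := by
  refine HasCompactSupport.intro (isCompact_Icc (a := -δ) (b := δ)) fun x hx => h.eq_zero x ?_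
  by_contra hlt
  exact hx (abs_le.1 (not_le.1 hlt).le)

theorem exists_bound (h : IsMollifier ρ δ) : ∃ C, 0 ≤ C ∧ (∀ x, |ρ x| ≤ C) ∧ ∀ x, |deriv ρ x| ≤ C := by
  obtain ⟨C, hC⟩ := h.continuous.bounded_above_of_compact_support h.hasCompactSupport
  obtain ⟨D, hD⟩ := h.continuous_deriv.bounded_above_of_compact_support h.hasCompactSupport.deriv
  exact ⟨max C D, ((norm_nonneg _).trans (hC 0)).trans (le_max_left _ _),
    fun x => (hC x).trans (le_max_left _ _), fun x => (hD x).trans (le_max_right _ _)⟩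

theorem eq_zero_iff (h : IsMollifier ρ δ) {x : ℝ} (hx : δ ≤ x ∨ x ≤ -δ) : ρ x = 0 := by
  apply h.eq_zero
  rcases hx with hx | hx
  · exact hx.trans (le_abs_self _)
  · exact (le_neg.1 hx |>.trans_eq rfl).trans (neg_le_abs _)

theorem refl_symm (h : IsMollifier ρ δ) (x y : ℝ) : refl ρ x y = refl ρ y x := by
  have : ρ (x - y) = ρ (y - x) := by rw [← h.even, neg_sub]
  rw [refl, refl, this, add_comm x y]

theorem refl_nonneg (h : IsMollifier ρ δ) (x y : ℝ) : 0 ≤ refl ρ x y :=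
  add_nonneg (add_nonneg (h.nonneg _) (h.nonneg _)) (h.nonneg _)

theorem abs_oddRefl_le (h : IsMollifier ρ δ) (x y : ℝ) : |oddRefl ρ x y| ≤ refl ρ x y := by
  have h1 := h.nonneg (x - y)
  have h2 := h.nonneg (x + y - 2)
  have h3 := h.nonneg (x + y + 2)
  rw [oddRefl, refl, abs_le]
  constructor <;> linarith

theorem refl_eq_zero (h : IsMollifier ρ δ) {x y : ℝ} (hx : x ∈ Icc (-1 : ℝ) 1)
    (hy : y ∈ Icc (-1 : ℝ) 1) (hxy : δ ≤ |x - y|) : refl ρ x y = 0 := by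
  obtain ⟨hx1, hx2⟩ := hx
  obtain ⟨hy1, hy2⟩ := hy
  rw [refl, h.eq_zero _ hxy]
  have hxy' := le_abs.1 hxy
  rw [h.eq_zero_iff, h.eq_zero_iff]
  · simp
  · left; rcases hxy' with h' | h' <;> linarith
  · right; rcases hxy' with h' | h' <;> linarith

theorem oddRefl_eq_refl (h : IsMollifier ρ δ) {x y : ℝ} (hx : |x| ≤ 1 - δ)
    (hy : y ∈ Icc (-1 : ℝ) 1) : oddRefl ρ x y = refl ρ x y := by
  obtain ⟨hx1, hx2⟩ := abs_le.1 hx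
  obtain ⟨hy1, hy2⟩ := hy
  have := h.pos
  rw [refl, oddRefl, h.eq_zero_iff (x := x + y - 2) (Or.inr (by linarith)),
    h.eq_zero_iff (x := x + y + 2) (Or.inl (by linarith))]
  ring

/-- At the reflecting end point the direct and the reflected terms cancel, and the third lies
outside the support. Integration by parts against this kernel therefore leaves no boundary term. -/
theorem oddRefl_one (h : IsMollifier ρ δ) {x : ℝ} (hx : x ∈ Icc (-1 : ℝ) 1) :
    oddRefl ρ x 1 = 0 := by
  have := h.le_half
  rw [oddRefl, h.eq_zero_iff (x := x + 1 + 2) (Or.inl (by linarith [hx.1]))]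
  rw [show x + 1 - 2 = x - 1 by ring]; ring

theorem oddRefl_neg_one (h : IsMollifier ρ δ) {x : ℝ} (hx : x ∈ Icc (-1 : ℝ) 1) :
    oddRefl ρ x (-1) = 0 := by
  have := h.le_half
  rw [oddRefl, h.eq_zero_iff (x := x + -1 - 2) (Or.inr (by linarith [hx.2]))]
  rw [show x + -1 + 2 = x - -1 by ring]; ring

theorem continuous_refl (h : IsMollifier ρ δ) : Continuous fun p : ℝ × ℝ => refl ρ p.1 p.2 := by
  have := h.continuous
  unfold refl; fun_prop

theorem continuous_oddRefl (h : IsMollifier ρ δ) :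
    Continuous fun p : ℝ × ℝ => oddRefl ρ p.1 p.2 := by
  have := h.continuous
  unfold oddRefl; fun_prop

theorem continuous_refl_deriv (h : IsMollifier ρ δ) :
    Continuous fun p : ℝ × ℝ => refl (deriv ρ) p.1 p.2 := by
  have := h.continuous_deriv
  unfold refl; fun_prop

theorem hasDerivAt_refl (h : IsMollifier ρ δ) (x y : ℝ) :
    HasDerivAt (fun z => refl ρ z y) (refl (deriv ρ) x y) x := by
  have h1 : HasDerivAt (fun z => ρ (z - y)) (deriv ρ (x - y)) x := by
    simpa [Function.comp_def] using (h.hasDerivAt (x - y)).comp x ((hasDerivAt_id x).sub_const y)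
  have h2 : HasDerivAt (fun z => ρ (z + y - 2)) (deriv ρ (x + y - 2)) x := by
    simpa [Function.comp_def] using (h.hasDerivAt (x + y - 2)).comp x (((hasDerivAt_id x).add_const y).sub_const 2)
  have h3 : HasDerivAt (fun z => ρ (z + y + 2)) (deriv ρ (x + y + 2)) x := by
    simpa [Function.comp_def] using (h.hasDerivAt (x + y + 2)).comp x (((hasDerivAt_id x).add_const y).add_const 2)
  exact (h1.add h2).add h3

/-- The `x` derivative of the even kernel is minus the `y` derivative of the odd one. This is why
differentiating an even mollification of `u` produces an odd mollification of `∇u`. -/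
theorem hasDerivAt_oddRefl (h : IsMollifier ρ δ) (x y : ℝ) :
    HasDerivAt (fun z => oddRefl ρ x z) (-refl (deriv ρ) x y) y := by
  have h1 : HasDerivAt (fun z => ρ (x - z)) (-deriv ρ (x - y)) y := by
    simpa [Function.comp_def] using (h.hasDerivAt (x - y)).comp y ((hasDerivAt_id y).const_sub x)
  have h2 : HasDerivAt (fun z => ρ (x + z - 2)) (deriv ρ (x + y - 2)) y := by
    simpa [Function.comp_def] using (h.hasDerivAt (x + y - 2)).comp y (((hasDerivAt_id y).const_add x).sub_const 2)
  have h3 : HasDerivAt (fun z => ρ (x + z + 2)) (deriv ρ (x + y + 2)) y := by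
    simpa [Function.comp_def] using (h.hasDerivAt (x + y + 2)).comp y (((hasDerivAt_id y).const_add x).add_const 2)
  have e : -refl (deriv ρ) x y =
      -deriv ρ (x - y) - deriv ρ (x + y - 2) - deriv ρ (x + y + 2) := by
    simp only [refl]; ring
  rw [e]
  exact (h1.sub h2).sub h3

theorem exists_refl_bound (h : IsMollifier ρ δ) : ∃ C, 0 ≤ C ∧ (∀ x y, |refl ρ x y| ≤ C) ∧
    (∀ x y, |oddRefl ρ x y| ≤ C) ∧ ∀ x y, |refl (deriv ρ) x y| ≤ C := by
  obtain ⟨C, hC, h1, h2⟩ := h.exists_bound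
  have h3 : ∀ {f : ℝ → ℝ}, (∀ x, |f x| ≤ C) → ∀ x y, |refl f x y| ≤ 3 * C := by
    intro f hf x y
    rw [refl]
    refine (abs_add_three _ _ _).trans ?_
    linarith [hf (x - y), hf (x + y - 2), hf (x + y + 2)]
  refine ⟨3 * C, by positivity, h3 h1, fun x y => ?_, h3 h2⟩
  exact (h.abs_oddRefl_le x y).trans ((le_abs_self _).trans (h3 h1 x y))

/-- After changes of variables the three terms are integrals of `ρ` over `[x - 1, x + 1]`, `[x - 3,
x - 1]` and `[x + 1, x + 3]`, which tile `[x - 3, x + 3]`. -/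
theorem integral_refl_eq (h : IsMollifier ρ δ) (x : ℝ) :
    ∫ y : Om, refl ρ x y = ∫ y in (x - 3)..(x + 3), ρ y := by
  have hi : ∀ p q : ℝ, IntervalIntegrable ρ volume p q := fun p q => h.continuous.intervalIntegrable p q
  rw [integral_Om fun y => refl ρ x y]
  simp only [refl]
  have c1 : Continuous fun y => ρ (x - y) := by have := h.continuous; fun_prop
  have c2 : Continuous fun y => ρ (x + y - 2) := by have := h.continuous; fun_prop
  have c3 : Continuous fun y => ρ (x + y + 2) := by have := h.continuous; fun_prop
  have c12 : Continuous fun y => ρ (x - y) + ρ (x + y - 2) := c1.add c2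
  rw [intervalIntegral.integral_add (c12.intervalIntegrable _ _) (c3.intervalIntegrable _ _),
    intervalIntegral.integral_add (c1.intervalIntegrable _ _) (c2.intervalIntegrable _ _)]
  have e1 : ∫ y in (-1 : ℝ)..1, ρ (x - y) = ∫ y in (x - 1)..(x + 1), ρ y := by
    rw [intervalIntegral.integral_comp_sub_left]; norm_num
  have e2 : ∫ y in (-1 : ℝ)..1, ρ (x + y - 2) = ∫ y in (x - 3)..(x - 1), ρ y := by
    have : ∀ y, x + y - 2 = (x - 2) + y := fun y => by ring
    simp only [this]
    rw [intervalIntegral.integral_comp_add_left]; congr 1 <;> ring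
  have e3 : ∫ y in (-1 : ℝ)..1, ρ (x + y + 2) = ∫ y in (x + 1)..(x + 3), ρ y := by
    have : ∀ y, x + y + 2 = (x + 2) + y := fun y => by ring
    simp only [this]
    rw [intervalIntegral.integral_comp_add_left]; congr 1 <;> ring
  rw [e1, e2, e3, add_comm (∫ y in (x - 1)..(x + 1), ρ y),
    intervalIntegral.integral_add_adjacent_intervals (hi _ _) (hi _ _),
    intervalIntegral.integral_add_adjacent_intervals (hi _ _) (hi _ _)]

theorem integral_refl_le (h : IsMollifier ρ δ) (x : ℝ) : ∫ y : Om, refl ρ x y ≤ 1 := by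
  rw [h.integral_refl_eq, intervalIntegral.integral_of_le (by linarith), ← h.integral_eq]
  exact setIntegral_le_integral (h.continuous.integrable_of_hasCompactSupport h.hasCompactSupport)
    (ae_of_all _ h.nonneg)

theorem integral_refl (h : IsMollifier ρ δ) {x : ℝ} (hx : x ∈ Icc (-1 : ℝ) 1) :
    ∫ y : Om, refl ρ x y = 1 := by
  rw [h.integral_refl_eq, intervalIntegral.integral_of_le (by linarith), ← h.integral_eq]
  apply setIntegral_eq_integral_of_forall_compl_eq_zero
  intro y hy
  have := h.le_half
  rw [mem_Ioc, not_and_or, not_lt, not_le] at hy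
  apply h.eq_zero_iff
  rcases hy with hy | hy
  · right; linarith [hx.2]
  · left; linarith [hx.1]

end IsMollifier

/-- The integral operator with kernel `k`. -/
def integralOp (k : ℝ → ℝ → ℝ) (f : Om → ℝ) (x : ℝ) : ℝ := ∫ y : Om, k x y * f y

section Operators

variable {ρ : ℝ → ℝ} {δ : ℝ}

theorem integrable_kernel_mul {k : ℝ → ℝ → ℝ} (hk : Continuous fun p : ℝ × ℝ => k p.1 p.2)
    {C : ℝ} (hC : ∀ x y, |k x y| ≤ C) {f : Om → ℝ} (hf : Integrable f) (x : ℝ) :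
    Integrable fun y : Om => k x y * f y :=
  hf.bdd_mul (c := C) (hk.comp (by fun_prop : Continuous fun y : Om => (x, (y : ℝ)))).aestronglyMeasurable
    (ae_of_all _ fun y => hC x y)

theorem continuous_integralOp {k : ℝ → ℝ → ℝ} (hk : Continuous fun p : ℝ × ℝ => k p.1 p.2)
    {C : ℝ} (hC : ∀ x y, |k x y| ≤ C) {f : Om → ℝ} (hf : Integrable f) :
    Continuous (integralOp k f) := by
  refine continuous_of_dominated (bound := fun y => C * |f y|)
    (fun x => (integrable_kernel_mul hk hC hf x).aestronglyMeasurable)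
    (fun x => ae_of_all _ fun y => ?_) (hf.abs.const_mul C) (ae_of_all _ fun y => ?_)
  · rw [norm_mul, Real.norm_eq_abs, Real.norm_eq_abs]
    exact mul_le_mul_of_nonneg_right (hC x y) (abs_nonneg _)
  · exact (hk.comp (by fun_prop : Continuous fun x : ℝ => (x, (y : ℝ)))).mul continuous_const

theorem hasDerivAt_integralOp (h : IsMollifier ρ δ) {f : Om → ℝ} (hf : Integrable f) (x : ℝ) :
    HasDerivAt (integralOp (refl ρ) f) (integralOp (refl (deriv ρ)) f x) x := by
  obtain ⟨C, -, h1, -, h2⟩ := h.exists_refl_bound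
  have i1 := integrable_kernel_mul h.continuous_refl h1 hf
  have i2 := integrable_kernel_mul h.continuous_refl_deriv h2 hf
  refine (hasDerivAt_integral_of_dominated_loc_of_deriv_le (bound := fun y => C * |f y|)
    (F := fun x y => refl ρ x y * f y) (F' := fun x y => refl (deriv ρ) x y * f y)
    (Metric.ball_mem_nhds x one_pos) (Eventually.of_forall fun x => (i1 x).aestronglyMeasurable)
    (i1 x) (i2 x).aestronglyMeasurable (ae_of_all _ fun y z _ => ?_) (hf.abs.const_mul C)
    (ae_of_all _ fun y z _ => (h.hasDerivAt_refl z y).mul_const (f y))).2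
  rw [norm_mul, Real.norm_eq_abs, Real.norm_eq_abs]
  exact mul_le_mul_of_nonneg_right (h2 z y) (abs_nonneg _)

theorem integralOp_refl_mem (h : IsMollifier ρ δ) {f : Om → ℝ} (hf : Integrable f)
    (h01 : ∀ y, f y ∈ Icc (0 : ℝ) 1) (x : ℝ) : integralOp (refl ρ) f x ∈ Icc (0 : ℝ) 1 := by
  obtain ⟨C, -, h1, -, h2⟩ := h.exists_refl_bound
  refine ⟨integral_nonneg fun y => mul_nonneg (h.refl_nonneg _ _) (h01 y).1, ?_⟩
  refine (integral_mono (integrable_kernel_mul h.continuous_refl h1 hf x)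
    (g := fun y : Om => refl ρ x y) ?_ fun y => ?_).trans (h.integral_refl_le x)
  · simpa using integrable_kernel_mul h.continuous_refl h1 (integrable_const (1 : ℝ)) x
  · exact mul_le_of_le_one_right (h.refl_nonneg _ _) (h01 y).2

theorem abs_integralOp_sub_le (h : IsMollifier ρ δ) {f : Om → ℝ} (hf : Integrable f)
    {x : ℝ} (hx : x ∈ Icc (-1 : ℝ) 1) {c ε : ℝ} (hε : ∀ᵐ y : Om, |x - y| < δ → |f y - c| ≤ ε) :
    |integralOp (refl ρ) f x - c| ≤ ε := by
  obtain ⟨C, -, h1, -, h2⟩ := h.exists_refl_bound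
  have i1 : Integrable fun y : Om => refl ρ x y := by
    simpa using integrable_kernel_mul h.continuous_refl h1 (integrable_const (1 : ℝ)) x
  have e : integralOp (refl ρ) f x - c = ∫ y : Om, refl ρ x y * (f y - c) := by
    simp only [mul_sub]
    rw [integral_sub (integrable_kernel_mul h.continuous_refl h1 hf x) (i1.mul_const c),
      integral_mul_const, h.integral_refl hx, one_mul]; rfl
  rw [e, ← Real.norm_eq_abs]
  refine (norm_integral_le_of_norm_le (i1.mul_const ε) ?_).trans_eq ?_
  · filter_upwards [hε] with y hy
    rw [norm_mul, Real.norm_of_nonneg (h.refl_nonneg _ _)]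
    rcases lt_or_ge |x - y| δ with hd | hd
    · exact mul_le_mul_of_nonneg_left (hy hd) (h.refl_nonneg _ _)
    · rw [h.refl_eq_zero hx (Ioo_subset_Icc_self y.2) hd]; simp
  · rw [integral_mul_const, h.integral_refl hx, one_mul]

/-- The odd mollification is a contraction of `L²`. -/
theorem integral_sq_integralOp_oddRefl_le (h : IsMollifier ρ δ) {g : Om → ℝ} (hg : MemLp g 2 volume) :
    MemLp (fun x : Om => integralOp (oddRefl ρ) g x) 2 volume ∧
    ∫ x : Om, integralOp (oddRefl ρ) g x ^ 2 ≤ ∫ x, g x ^ 2 := by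
  obtain ⟨C, hC0, h1, h1', h2⟩ := h.exists_refl_bound
  have hgi : Integrable g := hg.integrable one_le_two
  have hcont := continuous_integralOp h.continuous_oddRefl h1' hgi
  have hbd : ∀ x, |integralOp (oddRefl ρ) g x| ≤ C * ∫ y, |g y| := by
    intro x
    rw [← Real.norm_eq_abs, ← integral_const_mul]
    refine norm_integral_le_of_norm_le (hgi.abs.const_mul C) (ae_of_all _ fun y => ?_)
    rw [norm_mul, Real.norm_eq_abs, Real.norm_eq_abs]
    exact mul_le_mul_of_nonneg_right (h1' x y) (abs_nonneg _)
  have hmem : MemLp (fun x : Om => integralOp (oddRefl ρ) g x) 2 volume :=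
    MemLp_two_of_bound (hcont.comp continuous_subtype_val).aestronglyMeasurable fun x => hbd x
  refine ⟨hmem, ?_⟩
  have ik := integrable_kernel_mul h.continuous_refl h1 hg.integrable_sq
  have ik1 : ∀ x, Integrable fun y : Om => refl ρ x y := fun x => by
    simpa using integrable_kernel_mul h.continuous_refl h1 (integrable_const (1 : ℝ)) x
  have ia := integrable_kernel_mul h.continuous_refl h1 hgi.abs
  -- Jensen's inequality for a kernel of mass at most `1`, obtained by expanding `∫ k (|g| - m)² ≥
  -- 0`. Integration in `x`, Fubini and the symmetry of the even kernel then conclude.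
  have hpt : ∀ x, integralOp (oddRefl ρ) g x ^ 2 ≤ ∫ y : Om, refl ρ x y * g y ^ 2 := by
    intro x
    set m := ∫ y : Om, refl ρ x y * |g y| with hm
    have hm1 : |integralOp (oddRefl ρ) g x| ≤ m := by
      rw [← Real.norm_eq_abs]
      refine norm_integral_le_of_norm_le (ia x) (ae_of_all _ fun y => ?_)
      rw [norm_mul, Real.norm_eq_abs, Real.norm_eq_abs]
      exact mul_le_mul_of_nonneg_right (h.abs_oddRefl_le x y) (abs_nonneg _)
    have h0 : 0 ≤ ∫ y : Om, refl ρ x y * (|g y| - m) ^ 2 :=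
      integral_nonneg fun y => mul_nonneg (h.refl_nonneg _ _) (sq_nonneg _)
    have e : ∫ y : Om, refl ρ x y * (|g y| - m) ^ 2 =
        (∫ y : Om, refl ρ x y * g y ^ 2) - 2 * m * m + m ^ 2 * ∫ y : Om, refl ρ x y := by
      have : ∀ y : Om, refl ρ x y * (|g y| - m) ^ 2 =
          refl ρ x y * g y ^ 2 - 2 * m * (refl ρ x y * |g y|) + m ^ 2 * refl ρ x y := by
        intro y; rw [← sq_abs (g y)]; ring
      simp only [this]
      have i12 : Integrable fun y : Om => refl ρ x y * g y ^ 2 - 2 * m * (refl ρ x y * |g y|) :=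
        (ik x).sub ((ia x).const_mul _)
      rw [integral_add i12 ((ik1 x).const_mul _),
        integral_sub (ik x) ((ia x).const_mul _), integral_const_mul, integral_const_mul]
    rw [e] at h0
    have := h.integral_refl_le x
    have hm2 : integralOp (oddRefl ρ) g x ^ 2 ≤ m ^ 2 := by
      rw [← sq_abs]; gcongr
    nlinarith [sq_nonneg m]
  have iprod : Integrable (fun p : Om × Om => refl ρ p.1 p.2 * g p.2 ^ 2) (volume.prod volume) := by
    have : Integrable (fun p : Om × Om => g p.2 ^ 2) (volume.prod volume) := hg.integrable_sq.comp_snd _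
    exact this.bdd_mul (c := C) (h.continuous_refl.comp (by fun_prop :
      Continuous fun p : Om × Om => ((p.1 : ℝ), (p.2 : ℝ)))).aestronglyMeasurable
      (ae_of_all _ fun p => h1 _ _)
  calc ∫ x : Om, integralOp (oddRefl ρ) g x ^ 2 ≤ ∫ x : Om, ∫ y : Om, refl ρ x y * g y ^ 2 :=
        integral_mono hmem.integrable_sq iprod.integral_prod_left fun x => hpt x
    _ = ∫ y : Om, ∫ x : Om, refl ρ x y * g y ^ 2 := integral_integral_swap iprod
    _ = ∫ y : Om, g y ^ 2 := by
        congr 1; ext y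
        rw [integral_mul_const]
        have : ∫ x : Om, refl ρ x y = 1 := by
          rw [← h.integral_refl (Ioo_subset_Icc_self y.2)]
          congr 1; ext x; exact h.refl_symm _ _
        rw [this, one_mul]

end Operators

end

/-! ### Strong convergence of the odd mollifications -/

section

theorem tendsto_inv_nat_add_two : Tendsto (fun n : ℕ => 1 / ((n : ℝ) + 2)) atTop (𝓝 0) := by
  have h := tendsto_one_div_add_atTop_nhds_zero_nat (𝕜 := ℝ)
  have h2 := (tendsto_add_atTop_iff_nat 1).2 h
  refine h2.congr fun n => ?_
  push_cast; ring

theorem integralOp_sub {k : ℝ → ℝ → ℝ} (hk : Continuous fun p : ℝ × ℝ => k p.1 p.2)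
    {C : ℝ} (hC : ∀ x y, |k x y| ≤ C) {f g : Om → ℝ} (hf : Integrable f) (hg : Integrable g)
    (x : ℝ) : integralOp k (fun y => f y - g y) x = integralOp k f x - integralOp k g x := by
  simp only [integralOp, mul_sub]
  exact integral_sub (integrable_kernel_mul hk hC hf x) (integrable_kernel_mul hk hC hg x)

/-- The odd mollification vanishes at the end points, so convergence cannot be uniform in general.
At an interior `x` the odd and even kernels coincide as soon as `1 / (n + 2) ≤ 1 - |x|`, which gives
pointwise convergence; dominated convergence does the rest. -/
theorem tendsto_oddRefl_of_continuous {h : ℝ → ℝ} (hc : Continuous h) :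
    Tendsto (fun n => ∫ x : Om, (integralOp (oddRefl (moll n)) (fun y => h y) x - h x) ^ 2)
      atTop (𝓝 0) := by
  obtain ⟨C, hC⟩ := isCompact_Icc.exists_bound_of_continuousOn (s := Icc (-1 : ℝ) 1) hc.continuousOn
  have hC' : ∀ y : Om, |h y| ≤ C := fun y => hC y (Ioo_subset_Icc_self y.2)
  have hi : Integrable fun y : Om => h y :=
    integrable_of_continuous_bounded (hc.comp continuous_subtype_val) hC'
  have hcont : ∀ n, Continuous (integralOp (oddRefl (moll n)) fun y => h y) := fun n => by
    obtain ⟨K, -, -, h1, -⟩ := (isMollifier_moll n).exists_refl_bound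
    exact continuous_integralOp (isMollifier_moll n).continuous_oddRefl h1 hi
  have hbd : ∀ n, ∀ x : Om, |integralOp (oddRefl (moll n)) (fun y => h y) x| ≤ C := by
    intro n x
    have hm := isMollifier_moll n
    obtain ⟨K, -, h1, -, -⟩ := hm.exists_refl_bound
    have i1 : Integrable fun y : Om => refl (moll n) x y := by
      simpa using integrable_kernel_mul hm.continuous_refl h1 (integrable_const (1 : ℝ)) x
    rw [← Real.norm_eq_abs]
    refine (norm_integral_le_of_norm_le (i1.mul_const C) (ae_of_all _ fun y => ?_)).trans_eq ?_
    · rw [norm_mul, Real.norm_eq_abs, Real.norm_eq_abs]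
      exact mul_le_mul (hm.abs_oddRefl_le x y) (hC' y) (abs_nonneg _) (hm.refl_nonneg _ _)
    · rw [integral_mul_const, hm.integral_refl (Ioo_subset_Icc_self x.2), one_mul]
  have hpt : ∀ x : Om, Tendsto (fun n => integralOp (oddRefl (moll n)) (fun y => h y) x) atTop
      (𝓝 (h x)) := by
    intro x
    rw [Metric.tendsto_atTop]
    intro ε hε
    obtain ⟨η, hη, hηh⟩ := Metric.continuous_iff.1 hc x (ε / 2) (half_pos hε)
    have hx1 : 0 < 1 - |(x : ℝ)| := by
      have := abs_lt.2 x.2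
      linarith
    have hev := tendsto_inv_nat_add_two.eventually_lt_const (lt_min hη hx1)
    obtain ⟨N, hN⟩ := eventually_atTop.1 hev
    refine ⟨N, fun n hn => ?_⟩
    have hm := isMollifier_moll n
    have hlt := lt_min_iff.1 (hN n hn)
    have e : integralOp (oddRefl (moll n)) (fun y => h y) x =
        integralOp (refl (moll n)) (fun y => h y) x := by
      simp only [integralOp]
      congr 1; ext y
      rw [hm.oddRefl_eq_refl (by linarith [hlt.2]) (Ioo_subset_Icc_self y.2)]
    rw [e, Real.dist_eq]
    refine (abs_integralOp_sub_le hm hi (Ioo_subset_Icc_self x.2) (ε := ε / 2)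
      (ae_of_all _ fun y hy => ?_)).trans_lt (half_lt_self hε)
    have := hηh y (by rw [Real.dist_eq, abs_sub_comm]; exact hy.trans hlt.1)
    exact this.le
  have := tendsto_integral_of_dominated_convergence (μ := (volume : Measure Om))
    (F := fun n (x : Om) => (integralOp (oddRefl (moll n)) (fun y => h y) x - h x) ^ 2)
    (f := fun _ => 0) (fun _ => (2 * C) ^ 2)
    (fun n => ((((hcont n).sub hc).pow 2).comp continuous_subtype_val).aestronglyMeasurable)
    (integrable_const _) (fun n => ae_of_all _ fun x => by
      rw [Real.norm_of_nonneg (sq_nonneg _), ← sq_abs]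
      have := (abs_sub _ _).trans (add_le_add (hbd n x) (hC' x))
      gcongr
      linarith)
    (ae_of_all _ fun x => by
      have := ((hpt x).sub_const (h x)).pow 2
      simpa using this)
  simpa using this

theorem add_add_sq_le (x y z : ℝ) : (x + y + z) ^ 2 ≤ 3 * (x ^ 2 + y ^ 2 + z ^ 2) := by
  nlinarith [sq_nonneg (x - y), sq_nonneg (y - z), sq_nonneg (x - z)]

theorem integral_add_add_sq_le {α : Type*} [MeasurableSpace α] {μ : Measure α} {f g h : α → ℝ}
    (hf : MemLp f 2 μ) (hg : MemLp g 2 μ) (hh : MemLp h 2 μ) :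
    ∫ x, (f x + g x + h x) ^ 2 ∂μ ≤
      3 * ((∫ x, f x ^ 2 ∂μ) + (∫ x, g x ^ 2 ∂μ) + ∫ x, h x ^ 2 ∂μ) := by
  have i12 : Integrable (fun x => f x ^ 2 + g x ^ 2) μ := hf.integrable_sq.add hg.integrable_sq
  rw [← integral_add hf.integrable_sq hg.integrable_sq, ← integral_add i12 hh.integrable_sq,
    ← integral_const_mul]
  exact integral_mono ((hf.add hg).add hh).integrable_sq ((i12.add hh.integrable_sq).const_mul 3)
    fun x => add_add_sq_le _ _ _

/-- The odd mollifications converge strongly to the identity in `L²`. -/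
theorem tendsto_oddRefl {g : Om → ℝ} (hg : MemLp g 2 volume) :
    Tendsto (fun n => ∫ x : Om, (integralOp (oddRefl (moll n)) g x - g x) ^ 2) atTop (𝓝 0) := by
  rw [Metric.tendsto_atTop]
  intro ε hε
  have hgL : MemLp (extZero g) 2 volume := by
    have h1 : MemLp (extZero g) 2 (volume.restrict Om) := by
      rw [← volume_coe_map measurableSet_Ioo,
        (MeasurableEmbedding.subtype_coe measurableSet_Ioo).memLp_map_measure_iff]
      simpa [Function.comp_def] using hg
    have e : Om.indicator (extZero g) = extZero g := by
      funext x
      by_cases hx : x ∈ Om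
      · simp [hx]
      · rw [indicator_of_notMem hx, extZero, dif_neg hx]
    rw [← e]
    exact (memLp_indicator_iff_restrict measurableSet_Ioo).2 h1
  -- The difference is split into three terms at the cost of a factor `3`, and each term is given a
  -- squared norm of at most `ε / 9`, one of them strictly less.
  obtain ⟨h, hhc, hh, hgh⟩ := hgL.exist_eLpNorm_sub_le (by norm_num) (by norm_num)
    (show 0 < √(ε / 9) by positivity)
  have hhi : MemLp h 2 volume := hh.continuous.memLp_of_hasCompactSupport hhc
  have hd : MemLp (extZero g - h) 2 volume := hgL.sub hhi
  have hO : ∫ x : Om, (g x - h x) ^ 2 ≤ ε / 9 := by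
    have e1 := integral_coe measurableSet_Ioo (s := Om) (fun x => (extZero g x - h x) ^ 2)
    simp only [extZero_coe] at e1
    rw [e1]
    refine (setIntegral_le_integral hd.integrable_sq (ae_of_all _ fun x => sq_nonneg _)).trans ?_
    have e2 : ∫ x, (extZero g - h) x ^ 2 = (eLpNorm (extZero g - h) 2 volume).toReal ^ 2 := by
      rw [← Lp.norm_toLp _ hd, ← real_inner_self_eq_norm_sq, L2.inner_def]
      apply integral_congr_ae
      filter_upwards [hd.coeFn_toLp] with x hx
      rw [hx]; simp [sq]
    have e3 : (eLpNorm (extZero g - h) 2 volume).toReal ≤ √(ε / 9) :=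
      ENNReal.toReal_le_of_le_ofReal (by positivity) hgh
    change ∫ x, (extZero g - h) x ^ 2 ≤ _
    rw [e2, ← Real.sq_sqrt (show 0 ≤ ε / 9 by positivity)]
    gcongr
  obtain ⟨C, hC⟩ := isCompact_Icc.exists_bound_of_continuousOn (s := Icc (-1 : ℝ) 1)
    hh.continuous.continuousOn
  have hhO : MemLp (fun x : Om => h x) 2 volume := MemLp_two_of_bound
    (hh.continuous.comp continuous_subtype_val).aestronglyMeasurable
    fun x => hC x (Ioo_subset_Icc_self x.2)
  obtain ⟨N, hN⟩ := Metric.tendsto_atTop.1 (tendsto_oddRefl_of_continuous hh.continuous) (ε / 9)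
    (by positivity)
  refine ⟨N, fun n hn => ?_⟩
  have h1 := hN n hn
  rw [Real.dist_eq, sub_zero, abs_of_nonneg (integral_nonneg fun x => sq_nonneg _)] at h1 ⊢
  have hm := isMollifier_moll n
  obtain ⟨K, -, -, hK, -⟩ := hm.exists_refl_bound
  obtain ⟨m1, c1⟩ := integral_sq_integralOp_oddRefl_le hm (hg.sub hhO)
  obtain ⟨m2, -⟩ := integral_sq_integralOp_oddRefl_le hm hhO
  have key := integral_add_add_sq_le m1 (m2.sub hhO) (hhO.sub hg)
  set hO' : Om → ℝ := fun x => h x with hO'_def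
  have e : ∀ x : Om, integralOp (oddRefl (moll n)) g x - g x =
      integralOp (oddRefl (moll n)) (g - hO') x +
        ((fun x : Om => integralOp (oddRefl (moll n)) hO' x) - hO') x + (hO' - g) x := by
    intro x
    have := integralOp_sub hm.continuous_oddRefl hK (hg.integrable one_le_two)
      (hhO.integrable one_le_two) x
    simp only [Pi.sub_apply]
    change _ = integralOp (oddRefl (moll n)) (fun y => g y - hO' y) x + _ + _
    rw [this]; ring
  simp only [e]
  refine key.trans_lt ?_
  have h3 : ∫ x : Om, (hO' - g) x ^ 2 ≤ ε / 9 := by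
    refine le_trans (le_of_eq ?_) hO
    congr 1; ext x; simp only [Pi.sub_apply, hO'_def]; ring
  have h4 : ∫ x : Om, (g - hO') x ^ 2 ≤ ε / 9 := hO
  have h5 : ∫ x : Om, ((fun x : Om => integralOp (oddRefl (moll n)) hO' x) - hO') x ^ 2
      < ε / 9 := h1
  linarith

/-! ### The regularized entropy -/

/-- The regularized entropy. -/
def ent (κ w : ℝ) : ℝ := ((w + κ) * Real.log (w + κ) + (1 - w + κ) * Real.log (1 - w + κ)) / 2

/-- The derivative of the regularized entropy. -/
def ent' (κ w : ℝ) : ℝ := (Real.log (w + κ) - Real.log (1 - w + κ)) / 2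

/-- The second derivative of the regularized entropy. -/
def ent'' (κ w : ℝ) : ℝ := ((w + κ)⁻¹ + (1 - w + κ)⁻¹) / 2

section Entropy

variable {κ w z : ℝ}

theorem hasDerivAt_ent' (hκ : 0 < κ) (hw : w ∈ Icc (0 : ℝ) 1) :
    HasDerivAt (ent' κ) (ent'' κ w) w := by
  have h1 : HasDerivAt (fun w => w + κ) 1 w := (hasDerivAt_id w).add_const κ
  have h2 : HasDerivAt (fun w => 1 - w + κ) (-1) w := ((hasDerivAt_id w).const_sub 1).add_const κ
  have p1 : w + κ ≠ 0 := by linarith [hw.1]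
  have p2 : 1 - w + κ ≠ 0 := by linarith [hw.2]
  have := ((h1.log p1).sub (h2.log p2)).div_const 2
  have e : ent'' κ w = (1 / (w + κ) - -1 / (1 - w + κ)) / 2 := by
    rw [ent'', one_div, neg_div, sub_neg_eq_add, one_div]
  rw [e]; exact this

theorem abs_log_le (hκ : 0 < κ) (hκ1 : κ ≤ 1) (h1 : κ ≤ z) (h2 : z ≤ 2) : |Real.log z| ≤ κ⁻¹ := by
  have hz : 0 < z := hκ.trans_le h1
  have hinv : 1 ≤ κ⁻¹ := (one_le_inv₀ hκ).2 hκ1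
  have hzi : z⁻¹ ≤ κ⁻¹ := inv_anti₀ hκ h1
  rw [abs_le]
  constructor
  · linarith [Real.one_sub_inv_le_log_of_pos hz]
  · linarith [Real.log_le_sub_one_of_pos hz]

theorem abs_ent'_le (hκ : 0 < κ) (hκ1 : κ ≤ 1) (hw : w ∈ Icc (0 : ℝ) 1) : |ent' κ w| ≤ κ⁻¹ := by
  have h1 := abs_log_le hκ hκ1 (z := w + κ) (by linarith [hw.1]) (by linarith [hw.2])
  have h2 := abs_log_le hκ hκ1 (z := 1 - w + κ) (by linarith [hw.2]) (by linarith [hw.1])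
  rw [ent', abs_div, abs_two, div_le_iff₀ two_pos]
  exact (abs_sub _ _).trans (by linarith)

theorem ent''_nonneg (hκ : 0 < κ) (hw : w ∈ Icc (0 : ℝ) 1) : 0 ≤ ent'' κ w := by
  have p1 : 0 < w + κ := by linarith [hw.1]
  have p2 : 0 < 1 - w + κ := by linarith [hw.2]
  rw [ent'']; positivity

theorem ent''_le (hκ : 0 < κ) (hw : w ∈ Icc (0 : ℝ) 1) : ent'' κ w ≤ κ⁻¹ := by
  have p1 : (w + κ)⁻¹ ≤ κ⁻¹ := inv_anti₀ hκ (by linarith [hw.1])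
  have p2 : (1 - w + κ)⁻¹ ≤ κ⁻¹ := inv_anti₀ hκ (by linarith [hw.2])
  rw [ent'']; linarith

theorem abs_log_sub_le (hκ : 0 < κ) (hz : κ ≤ z) (hw : κ ≤ w) :
    |Real.log z - Real.log w| ≤ κ⁻¹ * |z - w| := by
  have key : ∀ {z w : ℝ}, κ ≤ z → κ ≤ w → Real.log z - Real.log w ≤ κ⁻¹ * |z - w| := by
    intro z w hz hw
    have hz0 := hκ.trans_le hz
    have hw0 := hκ.trans_le hw
    rw [← Real.log_div hz0.ne' hw0.ne']
    have h1 := Real.log_le_sub_one_of_pos (div_pos hz0 hw0)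
    have h2 : z / w - 1 = w⁻¹ * (z - w) := by field_simp
    rw [h2] at h1
    have h3 : w⁻¹ ≤ κ⁻¹ := inv_anti₀ hκ hw
    calc _ ≤ w⁻¹ * (z - w) := h1
      _ ≤ w⁻¹ * |z - w| := by gcongr; exact le_abs_self _
      _ ≤ _ := by gcongr
  rw [abs_le]
  have h1 := key hz hw
  have h2 := key hw hz
  rw [abs_sub_comm] at h2
  constructor <;> linarith

theorem abs_ent'_sub_le (hκ : 0 < κ) (hw : w ∈ Icc (0 : ℝ) 1) (hz : z ∈ Icc (0 : ℝ) 1) :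
    |ent' κ w - ent' κ z| ≤ κ⁻¹ * |w - z| := by
  have h1 := abs_log_sub_le hκ (z := w + κ) (w := z + κ) (by linarith [hw.1]) (by linarith [hz.1])
  have h2 := abs_log_sub_le hκ (z := 1 - w + κ) (w := 1 - z + κ) (by linarith [hw.2])
    (by linarith [hz.2])
  have e1 : w + κ - (z + κ) = w - z := by ring
  have e2 : |1 - w + κ - (1 - z + κ)| = |w - z| := by
    rw [show 1 - w + κ - (1 - z + κ) = -(w - z) by ring, abs_neg]
  rw [e1] at h1; rw [e2] at h2
  rw [ent', ent', ← sub_div, abs_div, abs_two, div_le_iff₀ two_pos]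
  calc _ = |(Real.log (w + κ) - Real.log (z + κ)) - (Real.log (1 - w + κ) - Real.log (1 - z + κ))| := by
        congr 1; ring
    _ ≤ _ := (abs_sub _ _).trans (by linarith)

theorem abs_inv_sub_le (hκ : 0 < κ) (hz : κ ≤ z) (hw : κ ≤ w) :
    |z⁻¹ - w⁻¹| ≤ (κ⁻¹) ^ 2 * |z - w| := by
  have hz0 := hκ.trans_le hz
  have hw0 := hκ.trans_le hw
  have e : z⁻¹ - w⁻¹ = z⁻¹ * w⁻¹ * (w - z) := by field_simp
  have h3 : w⁻¹ ≤ κ⁻¹ := inv_anti₀ hκ hw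
  have h4 : z⁻¹ ≤ κ⁻¹ := inv_anti₀ hκ hz
  rw [e, abs_mul, abs_of_pos (by positivity), abs_sub_comm, sq]
  gcongr

theorem abs_ent''_sub_le (hκ : 0 < κ) (hw : w ∈ Icc (0 : ℝ) 1) (hz : z ∈ Icc (0 : ℝ) 1) :
    |ent'' κ w - ent'' κ z| ≤ (κ⁻¹) ^ 2 * |w - z| := by
  have h1 := abs_inv_sub_le hκ (z := w + κ) (w := z + κ) (by linarith [hw.1]) (by linarith [hz.1])
  have h2 := abs_inv_sub_le hκ (z := 1 - w + κ) (w := 1 - z + κ) (by linarith [hw.2])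
    (by linarith [hz.2])
  have e1 : w + κ - (z + κ) = w - z := by ring
  have e2 : |1 - w + κ - (1 - z + κ)| = |w - z| := by
    rw [show 1 - w + κ - (1 - z + κ) = -(w - z) by ring, abs_neg]
  rw [e1] at h1; rw [e2] at h2
  rw [ent'', ent'', ← sub_div, abs_div, abs_two, div_le_iff₀ two_pos]
  calc _ = |((w + κ)⁻¹ - (z + κ)⁻¹) + ((1 - w + κ)⁻¹ - (1 - z + κ)⁻¹)| := by
        congr 1; ring
    _ ≤ _ := (abs_add_le _ _).trans (by linarith)

/-- Convexity of `x log x`: its graph lies above the tangent at `z`. -/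
theorem mul_log_tangent (hw : 0 < w) (hz : 0 < z) :
    z * Real.log z + (Real.log z + 1) * (w - z) ≤ w * Real.log w := by
  have h1 := Real.one_sub_inv_le_log_of_pos (div_pos hw hz)
  rw [Real.log_div hw.ne' hz.ne', inv_div] at h1
  have h2 := mul_le_mul_of_nonneg_left h1 hw.le
  have e : w * (1 - z / w) = w - z := by field_simp
  rw [e] at h2
  linarith

/-- The Fenchel inequality. -/
theorem mul_ent'_le (hκ : 0 < κ) (hw : w ∈ Icc (0 : ℝ) 1) (hz : z ∈ Icc (0 : ℝ) 1) :
    w * ent' κ z ≤ ent κ w + (z * ent' κ z - ent κ z) := by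
  have h1 := mul_log_tangent (w := w + κ) (z := z + κ) (by linarith [hw.1]) (by linarith [hz.1])
  have h2 := mul_log_tangent (w := 1 - w + κ) (z := 1 - z + κ) (by linarith [hw.2]) (by linarith [hz.2])
  simp only [ent, ent']
  linarith

theorem abs_ent_le (hκ : 0 < κ) (hκ1 : κ ≤ 1) (hw : w ∈ Icc (0 : ℝ) 1) : |ent κ w| ≤ 2 := by
  have key : ∀ {a : ℝ}, 0 < a → a ≤ 2 → |a * Real.log a| ≤ 2 := by
    intro a h0 h2
    have h3 := mul_le_mul_of_nonneg_left (Real.log_le_sub_one_of_pos h0) h0.le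
    have h4 := mul_le_mul_of_nonneg_left (Real.one_sub_inv_le_log_of_pos h0) h0.le
    rw [mul_sub, mul_inv_cancel₀ h0.ne'] at h4
    rw [abs_le]
    constructor <;> nlinarith
  have h1 := key (a := w + κ) (by linarith [hw.1]) (by linarith [hw.2])
  have h2 := key (a := 1 - w + κ) (by linarith [hw.2]) (by linarith [hw.1])
  rw [ent, abs_div, abs_two, div_le_iff₀ two_pos]
  exact (abs_add_le _ _).trans (by linarith)

theorem continuousOn_ent (hκ : 0 < κ) : ContinuousOn (ent κ) (Icc 0 1) := by
  unfold ent
  refine ContinuousOn.div_const (ContinuousOn.add ?_ ?_) _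
  · refine ContinuousOn.mul (by fun_prop) (ContinuousOn.log (by fun_prop) fun x hx => ?_)
    linarith [hx.1]
  · refine ContinuousOn.mul (by fun_prop) (ContinuousOn.log (by fun_prop) fun x hx => ?_)
    linarith [hx.2]

theorem continuousOn_ent' (hκ : 0 < κ) : ContinuousOn (ent' κ) (Icc 0 1) := fun _ hw =>
  (hasDerivAt_ent' hκ hw).continuousAt.continuousWithinAt

theorem continuousOn_ent'' (hκ : 0 < κ) : ContinuousOn (ent'' κ) (Icc 0 1) := by
  unfold ent''
  refine ContinuousOn.div_const (ContinuousOn.add ?_ ?_) _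
  · refine ContinuousOn.inv₀ (by fun_prop) fun x hx => ?_
    linarith [hx.1]
  · refine ContinuousOn.inv₀ (by fun_prop) fun x hx => ?_
    linarith [hx.2]

end Entropy

end

section

/-! ### Strong convergence in `L²` and products -/

theorem tendsto_integral_mul_of_sq {α : Type*} [MeasurableSpace α] {μ : Measure α} {f g : α → ℝ}
    {k : ℕ → α → ℝ} (hf : MemLp f 2 μ) (hg : MemLp g 2 μ) (hk : ∀ n, MemLp (k n) 2 μ)
    (h : Tendsto (fun n => ∫ x, (k n x - g x) ^ 2 ∂μ) atTop (𝓝 0)) :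
    Tendsto (fun n => ∫ x, f x * k n x ∂μ) atTop (𝓝 (∫ x, f x * g x ∂μ)) := by
  rw [tendsto_iff_norm_sub_tendsto_zero]
  have h2 : Tendsto (fun n => √(∫ x, f x ^ 2 ∂μ) * √(∫ x, (k n x - g x) ^ 2 ∂μ)) atTop (𝓝 0) := by
    simpa using h.sqrt.const_mul (√(∫ x, f x ^ 2 ∂μ))
  refine squeeze_zero (fun n => norm_nonneg _) (fun n => ?_) h2
  have i1 : Integrable (fun x => f x * k n x) μ := hf.integrable_mul (hk n)
  have i2 : Integrable (fun x => f x * g x) μ := hf.integrable_mul hg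
  rw [← integral_sub i1 i2, Real.norm_eq_abs]
  simp only [← mul_sub]
  exact abs_integral_mul_le hf ((hk n).sub hg)

theorem tendsto_integral_mul_sq_of_sq {α : Type*} [MeasurableSpace α] {μ : Measure α}
    [IsFiniteMeasure μ] {w g : α → ℝ} {C : ℝ} {k : ℕ → α → ℝ} (hw : AEStronglyMeasurable w μ)
    (hC : ∀ x, |w x| ≤ C) (hg : MemLp g 2 μ) (hk : ∀ n, MemLp (k n) 2 μ)
    (h : Tendsto (fun n => ∫ x, (k n x - g x) ^ 2 ∂μ) atTop (𝓝 0)) :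
    Tendsto (fun n => ∫ x, w x * k n x ^ 2 ∂μ) atTop (𝓝 (∫ x, w x * g x ^ 2 ∂μ)) := by
  have hw' : ∀ᵐ x ∂μ, ‖w x‖ ≤ C := ae_of_all _ hC
  have hwg : MemLp (fun x => w x * g x) 2 μ := by
    refine (hg.const_mul C).mono (hw.mul hg.1) (ae_of_all _ fun x => ?_)
    rw [norm_mul, norm_mul, Real.norm_eq_abs C]
    exact mul_le_mul_of_nonneg_right ((hC x).trans (le_abs_self _)) (norm_nonneg _)
  have t1 := tendsto_integral_mul_of_sq hwg hg hk h
  have t2 : Tendsto (fun n => ∫ x, w x * (k n x - g x) ^ 2 ∂μ) atTop (𝓝 0) := by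
    rw [tendsto_zero_iff_norm_tendsto_zero]
    refine squeeze_zero (fun n => norm_nonneg _) (fun n => ?_)
      (by simpa using h.const_mul C : Tendsto (fun n => C * ∫ x, (k n x - g x) ^ 2 ∂μ) atTop (𝓝 0))
    rw [← integral_const_mul]
    refine norm_integral_le_of_norm_le (((hk n).sub hg).integrable_sq.const_mul C)
      (ae_of_all _ fun x => ?_)
    rw [norm_mul, Real.norm_eq_abs, Real.norm_of_nonneg (sq_nonneg _)]
    exact mul_le_mul_of_nonneg_right (hC x) (sq_nonneg _)
  have t3 := (t2.add (t1.const_mul 2)).sub_const (∫ x, w x * g x * g x ∂μ)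
  have e0 : ∫ x, w x * g x * g x ∂μ = ∫ x, w x * g x ^ 2 ∂μ := by
    congr 1; ext x; ring
  rw [e0] at t3
  have e1 : (0 : ℝ) + 2 * (∫ x, w x * g x ^ 2 ∂μ) - (∫ x, w x * g x ^ 2 ∂μ) =
    ∫ x, w x * g x ^ 2 ∂μ := by ring
  rw [e1] at t3
  refine t3.congr fun n => ?_
  have i1 : Integrable (fun x => w x * (k n x - g x) ^ 2) μ :=
    ((hk n).sub hg).integrable_sq.bdd_mul hw hw'
  have i2 : Integrable (fun x => 2 * (w x * g x * k n x)) μ := (hwg.integrable_mul (hk n)).const_mul 2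
  have i3 : Integrable (fun x => w x * g x ^ 2) μ := hg.integrable_sq.bdd_mul hw hw'
  have i12 : Integrable (fun x => w x * (k n x - g x) ^ 2 + 2 * (w x * g x * k n x)) μ := i1.add i2
  rw [← integral_const_mul, ← integral_add i1 i2, ← integral_sub i12 i3]
  congr 1; ext x; ring

/-! ### The regularized derivative of the entropy, as a test function -/

/-- The mollification of the derivative of the regularized entropy of the mollification of `u`. -/
def entTest (κ : ℝ) (ρ : ℝ → ℝ) (u : Om → ℝ) (x : ℝ) : ℝ :=
  integralOp (refl ρ) (fun y => ent' κ (integralOp (refl ρ) u y)) x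

/-- The space derivative of `entTest κ ρ u`. -/
def entTestGrad (κ : ℝ) (ρ : ℝ → ℝ) (u : Om → ℝ) (x : ℝ) : ℝ :=
  integralOp (refl (deriv ρ)) (fun y => ent' κ (integralOp (refl ρ) u y)) x

section EntTest

variable {κ δ : ℝ} {ρ : ℝ → ℝ} {u v : Om → ℝ} {U : ℝ → ℝ}

theorem continuous_integralOp_refl (hm : IsMollifier ρ δ) (hi : Integrable u) :
    Continuous (integralOp (refl ρ) u) := by
  obtain ⟨C, -, h1, -, -⟩ := hm.exists_refl_bound
  exact continuous_integralOp hm.continuous_refl h1 hi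

theorem continuous_ent'_integralOp (hκ : 0 < κ) (hm : IsMollifier ρ δ) (hi : Integrable u)
    (h01 : ∀ y, u y ∈ Icc (0 : ℝ) 1) :
    Continuous fun x => ent' κ (integralOp (refl ρ) u x) :=
  (continuousOn_ent' hκ).comp_continuous (continuous_integralOp_refl hm hi)
    (integralOp_refl_mem hm hi h01)

theorem integrable_ent'_integralOp (hκ : 0 < κ) (hκ1 : κ ≤ 1) (hm : IsMollifier ρ δ)
    (hi : Integrable u) (h01 : ∀ y, u y ∈ Icc (0 : ℝ) 1) :
    Integrable fun x : Om => ent' κ (integralOp (refl ρ) u x) :=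
  integrable_of_continuous_bounded
    ((continuous_ent'_integralOp hκ hm hi h01).comp continuous_subtype_val)
    fun x => abs_ent'_le hκ hκ1 (integralOp_refl_mem hm hi h01 x)

theorem hasDerivAt_entTest (hκ : 0 < κ) (hκ1 : κ ≤ 1) (hm : IsMollifier ρ δ) (hi : Integrable u)
    (h01 : ∀ y, u y ∈ Icc (0 : ℝ) 1) (x : ℝ) :
    HasDerivAt (entTest κ ρ u) (entTestGrad κ ρ u x) x :=
  hasDerivAt_integralOp hm (integrable_ent'_integralOp hκ hκ1 hm hi h01) x

theorem abs_entTest_le (hκ : 0 < κ) (hκ1 : κ ≤ 1) (hm : IsMollifier ρ δ) (hi : Integrable u)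
    (h01 : ∀ y, u y ∈ Icc (0 : ℝ) 1) {x : ℝ} (hx : x ∈ Icc (-1 : ℝ) 1) :
    |entTest κ ρ u x| ≤ κ⁻¹ := by
  have := abs_integralOp_sub_le hm (integrable_ent'_integralOp hκ hκ1 hm hi h01) hx (c := 0)
    (ε := κ⁻¹) (ae_of_all _ fun y _ => by
      rw [sub_zero]; exact abs_ent'_le hκ hκ1 (integralOp_refl_mem hm hi h01 y))
  rwa [sub_zero] at this

/-- Integration by parts against `y ↦ oddRefl ρ x y`, which vanishes at both end points. The
left-hand side is the derivative of the even mollification of `u`. -/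
theorem IsContVersion.integralOp_refl_deriv (h : IsContVersion u v U) (hm : IsMollifier ρ δ) {x : ℝ}
    (hx : x ∈ Icc (-1 : ℝ) 1) :
    integralOp (refl (deriv ρ)) u x = integralOp (oddRefl ρ) v x := by
  have hc : Continuous fun y => -refl (deriv ρ) x y :=
    (hm.continuous_refl_deriv.comp (by fun_prop : Continuous fun y : ℝ => (x, y))).neg
  have := h.parts' (fun y => hm.hasDerivAt_oddRefl x y) hc
  rw [hm.oddRefl_one hx, hm.oddRefl_neg_one hx] at this
  have e : ∫ y : Om, u y * -refl (deriv ρ) x y = - integralOp (refl (deriv ρ)) u x := by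
    rw [integralOp, ← integral_neg]; congr 1; ext y; ring
  have e2 : ∫ y : Om, v y * oddRefl ρ x y = integralOp (oddRefl ρ) v x := by
    rw [integralOp]; congr 1; ext y; ring
  rw [e, e2] at this
  linarith

/-- The same integration by parts is applied to the smooth function `ent' κ` of the mollified
density, whose derivative comes from the chain rule. In this form the gradient of the test function
is bounded in `L²` by `κ⁻¹` times the norm of `v`, uniformly in the mollifier. -/
theorem entTestGrad_eq (hκ : 0 < κ) (hm : IsMollifier ρ δ) (hi : Integrable u)
    (h01 : ∀ y, u y ∈ Icc (0 : ℝ) 1) (hU : IsContVersion u v U) {x : ℝ} (hx : x ∈ Icc (-1 : ℝ) 1) :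
    entTestGrad κ ρ u x = integralOp (oddRefl ρ)
      (fun y => ent'' κ (integralOp (refl ρ) u y) * integralOp (oddRefl ρ) v y) x := by
  have hg : ∀ y, HasDerivAt (fun y => ent' κ (integralOp (refl ρ) u y))
      (ent'' κ (integralOp (refl ρ) u y) * integralOp (refl (deriv ρ)) u y) y := fun y =>
    (hasDerivAt_ent' hκ (integralOp_refl_mem hm hi h01 y)).comp y (hasDerivAt_integralOp hm hi y)
  obtain ⟨C, -, -, -, h2⟩ := hm.exists_refl_bound
  have hc1 : Continuous fun y => ent'' κ (integralOp (refl ρ) u y) * integralOp (refl (deriv ρ)) u y :=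
    ((continuousOn_ent'' hκ).comp_continuous (continuous_integralOp_refl hm hi)
      (integralOp_refl_mem hm hi h01)).mul (continuous_integralOp hm.continuous_refl_deriv h2 hi)
  have hc2 : Continuous fun y => -refl (deriv ρ) x y :=
    (hm.continuous_refl_deriv.comp (by fun_prop : Continuous fun y : ℝ => (x, y))).neg
  have key := intervalIntegral.integral_mul_deriv_eq_deriv_mul (a := -1) (b := 1)
    (fun y _ => hg y) (fun y _ => hm.hasDerivAt_oddRefl x y) (hc1.intervalIntegrable _ _)
    (hc2.intervalIntegrable _ _)
  rw [hm.oddRefl_one hx, hm.oddRefl_neg_one hx, ← integral_Om, ← integral_Om] at key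
  have e : ∫ y : Om, ent' κ (integralOp (refl ρ) u y) * -refl (deriv ρ) x y =
      - entTestGrad κ ρ u x := by
    rw [entTestGrad, integralOp, ← integral_neg]; congr 1; ext y; ring
  rw [e] at key
  have e2 : entTestGrad κ ρ u x = ∫ y : Om, ent'' κ (integralOp (refl ρ) u y) *
      integralOp (refl (deriv ρ)) u y * oddRefl ρ x y := by linarith
  rw [e2, integralOp]
  congr 1; ext y
  rw [hU.integralOp_refl_deriv hm (Ioo_subset_Icc_self y.2)]; ring

theorem IsContVersion.abs_sub_le (hU : IsContVersion u v U) {x y : ℝ}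
    (hx : x ∈ Icc (-1 : ℝ) 1) (hy : y ∈ Icc (-1 : ℝ) 1) (hxy : |x - y| ≤ δ) :
    |U x - U y| ≤ √δ * √(∫ x, v x ^ 2) :=
  (hU.modulus x hx y hy).trans (mul_le_mul_of_nonneg_right (Real.sqrt_le_sqrt hxy)
    (Real.sqrt_nonneg _))

theorem abs_integralOp_refl_sub_le (hm : IsMollifier ρ δ) (hi : Integrable u)
    (hU : IsContVersion u v U) {x : ℝ} (hx : x ∈ Icc (-1 : ℝ) 1) :
    |integralOp (refl ρ) u x - U x| ≤ √δ * √(∫ x, v x ^ 2) := by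
  refine abs_integralOp_sub_le hm hi hx ?_
  filter_upwards [hU.ae_eq] with y hy hxy
  rw [hy]
  exact hU.abs_sub_le (Ioo_subset_Icc_self y.2) hx (by rw [abs_sub_comm]; exact hxy.le)

/-- Two errors, each at most `√δ` times the norm of `v` by Hölder continuity: one from the inner
mollification, one from moving a point by less than `δ` in the outer one. -/
theorem abs_entTest_sub_le (hκ : 0 < κ) (hκ1 : κ ≤ 1) (hm : IsMollifier ρ δ) (hi : Integrable u)
    (h01 : ∀ y, u y ∈ Icc (0 : ℝ) 1) (hU : IsContVersion u v U) {x : ℝ} (hx : x ∈ Icc (-1 : ℝ) 1) :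
    |entTest κ ρ u x - ent' κ (U x)| ≤ κ⁻¹ * (2 * (√δ * √(∫ x, v x ^ 2))) := by
  refine abs_integralOp_sub_le hm (integrable_ent'_integralOp hκ hκ1 hm hi h01) hx
    (ae_of_all _ fun y hxy => ?_)
  refine (abs_ent'_sub_le hκ (integralOp_refl_mem hm hi h01 y) (hU.mem_Icc h01 hx)).trans ?_
  have h1 := abs_integralOp_refl_sub_le hm hi hU (Ioo_subset_Icc_self y.2)
  have h2 := hU.abs_sub_le (δ := δ) (Ioo_subset_Icc_self y.2) hx (by rw [abs_sub_comm]; exact hxy.le)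
  have h3 := abs_sub_le (integralOp (refl ρ) u y) (U y) (U x)
  have : 0 < κ⁻¹ := inv_pos.2 hκ
  gcongr
  linarith

theorem memLp_bdd_mul {α : Type*} [MeasurableSpace α] {μ : Measure α} {w g : α → ℝ} {C : ℝ}
    (hw : AEStronglyMeasurable w μ) (hC : ∀ᵐ x ∂μ, |w x| ≤ C) (hg : MemLp g 2 μ) :
    MemLp (fun x => w x * g x) 2 μ ∧ ∫ x, (w x * g x) ^ 2 ∂μ ≤ C ^ 2 * ∫ x, g x ^ 2 ∂μ := by
  have h1 : MemLp (fun x => w x * g x) 2 μ := by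
    refine (hg.const_mul C).mono (hw.mul hg.1) ?_
    filter_upwards [hC] with x hx
    rw [norm_mul, norm_mul, Real.norm_eq_abs C]
    exact mul_le_mul_of_nonneg_right (hx.trans (le_abs_self _)) (norm_nonneg _)
  refine ⟨h1, ?_⟩
  rw [← integral_const_mul]
  refine integral_mono_ae h1.integrable_sq (hg.integrable_sq.const_mul _) ?_
  filter_upwards [hC] with x hx
  rw [mul_pow, ← sq_abs (w x)]
  gcongr

theorem memLp_ent''_mul_oddRefl (hκ : 0 < κ) (hm : IsMollifier ρ δ) (hi : Integrable u)
    (h01 : ∀ y, u y ∈ Icc (0 : ℝ) 1) (hU : IsContVersion u v U) :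
    MemLp (fun y : Om => ent'' κ (integralOp (refl ρ) u y) * integralOp (oddRefl ρ) v y) 2 volume ∧
    ∫ y : Om, (ent'' κ (integralOp (refl ρ) u y) * integralOp (oddRefl ρ) v y) ^ 2 ≤
      (κ⁻¹) ^ 2 * ∫ y, v y ^ 2 := by
  obtain ⟨m1, c1⟩ := integral_sq_integralOp_oddRefl_le hm hU.memLp
  obtain ⟨m2, c2⟩ := memLp_bdd_mul (w := fun y : Om => ent'' κ (integralOp (refl ρ) u y)) (C := κ⁻¹)
    (((continuousOn_ent'' hκ).comp_continuous (continuous_integralOp_refl hm hi)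
      (integralOp_refl_mem hm hi h01)).comp continuous_subtype_val).aestronglyMeasurable
    (ae_of_all _ fun y => by
      have hy := integralOp_refl_mem hm hi h01 y
      rw [abs_of_nonneg (ent''_nonneg hκ hy)]
      exact ent''_le hκ hy) m1
  exact ⟨m2, c2.trans (by gcongr)⟩

theorem memLp_entTestGrad (hκ : 0 < κ) (hm : IsMollifier ρ δ) (hi : Integrable u)
    (h01 : ∀ y, u y ∈ Icc (0 : ℝ) 1) (hU : IsContVersion u v U) :
    MemLp (fun x : Om => entTestGrad κ ρ u x) 2 volume ∧
    ∫ x : Om, entTestGrad κ ρ u x ^ 2 ≤ (κ⁻¹) ^ 2 * ∫ x, v x ^ 2 := by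
  obtain ⟨m1, c1⟩ := memLp_ent''_mul_oddRefl hκ hm hi h01 hU
  obtain ⟨m2, c2⟩ := integral_sq_integralOp_oddRefl_le hm m1
  have e : (fun x : Om => entTestGrad κ ρ u x) = fun x : Om => integralOp (oddRefl ρ)
      (fun y => ent'' κ (integralOp (refl ρ) u y) * integralOp (oddRefl ρ) v y) x := by
    ext x; exact entTestGrad_eq hκ hm hi h01 hU (Ioo_subset_Icc_self x.2)
  have e' : ∀ x : Om, entTestGrad κ ρ u x = integralOp (oddRefl ρ)
      (fun y => ent'' κ (integralOp (refl ρ) u y) * integralOp (oddRefl ρ) v y) x := congrFun e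
  simp only [e']
  exact ⟨m2, c2.trans c1⟩

theorem memLp_ent''_mul (hκ : 0 < κ) (h01 : ∀ y, u y ∈ Icc (0 : ℝ) 1) (hU : IsContVersion u v U) :
    MemLp (fun y : Om => ent'' κ (U y) * v y) 2 volume :=
  (memLp_bdd_mul (w := fun y : Om => ent'' κ (U y)) (C := κ⁻¹)
    (((continuousOn_ent'' hκ).comp_continuous (hU.continuous.comp continuous_subtype_val)
      fun y : Om => hU.mem_Icc h01 (Ioo_subset_Icc_self y.2))).aestronglyMeasurable
    (ae_of_all _ fun y => by
      have hy := hU.mem_Icc h01 (Ioo_subset_Icc_self y.2)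
      rw [abs_of_nonneg (ent''_nonneg hκ hy)]
      exact ent''_le hκ hy) hU.memLp).1

/-- The outer mollification acts on `g1 = ent''(W) · (odd mollification of v)`, with `W` the
mollified density, and the target is `g2 = ent''(U) v`. Contraction handles `g1 - g2`, which is
split again into the error on `v` and the error on `ent''`; the mollification error of `g2` is kept
as it is. The constants `9 = 3 · 3` and `3` come from `integral_add_add_sq_le` with a zero third
term. -/
theorem integral_sq_entTestGrad_sub_le (hκ : 0 < κ) (hm : IsMollifier ρ δ) (hi : Integrable u)
    (h01 : ∀ y, u y ∈ Icc (0 : ℝ) 1) (hU : IsContVersion u v U) :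
    ∫ x : Om, (entTestGrad κ ρ u x - ent'' κ (U x) * v x) ^ 2 ≤
      9 * ((κ⁻¹) ^ 2 * (∫ x : Om, (integralOp (oddRefl ρ) v x - v x) ^ 2) +
        ((κ⁻¹) ^ 2 * (√δ * √(∫ x, v x ^ 2))) ^ 2 * ∫ x, v x ^ 2) +
      3 * ∫ x : Om, (integralOp (oddRefl ρ) (fun y => ent'' κ (U y) * v y) x -
        ent'' κ (U x) * v x) ^ 2 := by
  obtain ⟨C, -, -, hC, -⟩ := hm.exists_refl_bound
  have m0 := (integral_sq_integralOp_oddRefl_le hm hU.memLp).1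
  have m1 := (memLp_ent''_mul_oddRefl hκ hm hi h01 hU).1
  have m2 := memLp_ent''_mul hκ h01 hU
  have hz : MemLp (fun _ : Om => (0 : ℝ)) 2 volume := MemLp.zero'
  obtain ⟨m3, c3⟩ := integral_sq_integralOp_oddRefl_le hm (m1.sub m2)
  obtain ⟨m4, -⟩ := integral_sq_integralOp_oddRefl_le hm m2
  have key := integral_add_add_sq_le m3 (m4.sub m2) hz
  have hWc := (((continuousOn_ent'' hκ).comp_continuous (continuous_integralOp_refl hm hi)
      (integralOp_refl_mem hm hi h01)).comp (continuous_subtype_val (p := (· ∈ Om)))).aestronglyMeasurable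
      (μ := (volume : Measure Om))
  have hUc := (((continuousOn_ent'' hκ).comp_continuous (hU.continuous.comp continuous_subtype_val)
      fun y : Om => hU.mem_Icc h01 (Ioo_subset_Icc_self y.2))).aestronglyMeasurable
      (μ := (volume : Measure Om))
  obtain ⟨m5, c5⟩ := memLp_bdd_mul (w := fun y : Om => ent'' κ (integralOp (refl ρ) u y)) (C := κ⁻¹)
    (g := fun y : Om => integralOp (oddRefl ρ) v y - v y)
    hWc (ae_of_all _ fun y => by
      have hy := integralOp_refl_mem hm hi h01 y
      rw [abs_of_nonneg (ent''_nonneg hκ hy)]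
      exact ent''_le hκ hy) (m0.sub hU.memLp)
  obtain ⟨m6, c6⟩ := memLp_bdd_mul
    (w := fun y : Om => ent'' κ (integralOp (refl ρ) u y) - ent'' κ (U y))
    (C := (κ⁻¹) ^ 2 * (√δ * √(∫ x, v x ^ 2)))
    (hWc.sub hUc) (ae_of_all _ fun y => by
      have hy := integralOp_refl_mem hm hi h01 y
      have hy' := hU.mem_Icc h01 (Ioo_subset_Icc_self y.2)
      refine (abs_ent''_sub_le hκ hy hy').trans ?_
      gcongr
      exact abs_integralOp_refl_sub_le hm hi hU (Ioo_subset_Icc_self y.2)) hU.memLp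
  have key2 := integral_add_add_sq_le m5 m6 hz
  set g1 : Om → ℝ := fun y => ent'' κ (integralOp (refl ρ) u y) * integralOp (oddRefl ρ) v y with hg1
  set g2 : Om → ℝ := fun y => ent'' κ (U y) * v y with hg2
  have e1 : ∀ x : Om, entTestGrad κ ρ u x - ent'' κ (U x) * v x =
      integralOp (oddRefl ρ) (g1 - g2) x + ((fun x : Om => integralOp (oddRefl ρ) g2 x) - g2) x + 0 := by
    intro x
    rw [entTestGrad_eq hκ hm hi h01 hU (Ioo_subset_Icc_self x.2)]
    have := integralOp_sub hm.continuous_oddRefl hC (m1.integrable one_le_two)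
      (m2.integrable one_le_two) x
    change _ = integralOp (oddRefl ρ) (fun y => g1 y - g2 y) x + (integralOp (oddRefl ρ) g2 x - g2 x) + 0
    rw [this]; ring
  have e2 : ∀ y : Om, (g1 - g2) y = ent'' κ (integralOp (refl ρ) u y) *
      (integralOp (oddRefl ρ) v y - v y) +
      (ent'' κ (integralOp (refl ρ) u y) - ent'' κ (U y)) * v y + 0 := by
    intro y; simp only [Pi.sub_apply, hg1, hg2]; ring
  have e3 : ∫ y : Om, (g1 - g2) y ^ 2 = ∫ y : Om, (ent'' κ (integralOp (refl ρ) u y) *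
      (integralOp (oddRefl ρ) v y - v y) +
      (ent'' κ (integralOp (refl ρ) u y) - ent'' κ (U y)) * v y + 0) ^ 2 := by
    congr 1; ext y; rw [e2]
  have e4 : ∫ x : Om, ((fun x : Om => integralOp (oddRefl ρ) g2 x) - g2) x ^ 2 =
    ∫ x : Om, (integralOp (oddRefl ρ) g2 x - ent'' κ (U x) * v x) ^ 2 := rfl
  simp only [e1]
  rw [e3] at c3
  rw [e4] at key
  simp only [ne_eq, OfNat.ofNat_ne_zero, not_false_eq_true, zero_pow, integral_zero] at key key2
  linarith

end EntTest

end

/-! ### The limit of the functional at a fixed time -/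

section

/-- The part of the functional `Ĵ_H` which is not linear in the trajectory, at a given time. -/
def sliceFun (a al be : ℝ) (u v : Om → ℝ) (h k : ℝ → ℝ) : ℝ :=
  (∫ x : Om, diffusivity a (u x) * v x * k x) - (∫ x : Om, mobility a (u x) * k x ^ 2)
    - bdry al be (rightTrace u v) (leftTrace u v) (h 1) (h (-1))

theorem continuous_bdry (al be r l : ℝ) : Continuous fun p : ℝ × ℝ => bdry al be r l p.1 p.2 := by
  unfold bdry; fun_prop

section Slice

variable {a al be κ : ℝ} {u v : Om → ℝ} {U : ℝ → ℝ}

theorem tendsto_entTestGrad (hκ : 0 < κ) (hi : Integrable u) (h01 : ∀ y, u y ∈ Icc (0 : ℝ) 1)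
    (hU : IsContVersion u v U) :
    Tendsto (fun n => ∫ x : Om, (entTestGrad κ (moll n) u x - ent'' κ (U x) * v x) ^ 2) atTop
      (𝓝 0) := by
  have t1 := (tendsto_oddRefl hU.memLp).const_mul ((κ⁻¹) ^ 2)
  have t2 := (((tendsto_inv_nat_add_two.sqrt.mul_const (√(∫ x, v x ^ 2))).const_mul
    ((κ⁻¹) ^ 2)).pow 2).mul_const (∫ x, v x ^ 2)
  have t3 := (tendsto_oddRefl (memLp_ent''_mul hκ h01 hU)).const_mul 3
  have t := ((t1.add t2).const_mul 9).add t3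
  simp only [Real.sqrt_zero, zero_mul, mul_zero, ne_eq, OfNat.ofNat_ne_zero, not_false_eq_true,
    zero_pow, add_zero] at t
  exact squeeze_zero (fun n => integral_nonneg fun x => sq_nonneg _)
    (fun n => integral_sq_entTestGrad_sub_le hκ (isMollifier_moll n) hi h01 hU) t

theorem memLp_test (hκ : 0 < κ) (hi : Integrable u) (h01 : ∀ y, u y ∈ Icc (0 : ℝ) 1)
    (hU : IsContVersion u v U) {n : ℕ} {k : ℝ → ℝ} (hkc : Continuous k) (hk : ∀ x ∈ Icc (-1 : ℝ) 1,
      |k x - entTestGrad κ (moll n) u x| ≤ 1 / ((n : ℝ) + 1)) :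
    MemLp (fun x : Om => k x) 2 volume ∧ MemLp (fun x : Om => k x - entTestGrad κ (moll n) u x) 2 volume := by
  have m1 := (memLp_entTestGrad hκ (isMollifier_moll n) hi h01 hU).1
  have m2 : MemLp (fun x : Om => k x - entTestGrad κ (moll n) u x) 2 volume :=
    MemLp_two_of_bound ((hkc.comp continuous_subtype_val).aestronglyMeasurable.sub m1.1)
      fun x => hk x (Ioo_subset_Icc_self x.2)
  have m3 := m2.add m1
  refine ⟨?_, m2⟩
  convert m3 using 1
  ext x; simp

theorem integral_sq_test_sub_le {n : ℕ} {k : ℝ → ℝ} (hk : ∀ x ∈ Icc (-1 : ℝ) 1,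
      |k x - entTestGrad κ (moll n) u x| ≤ 1 / ((n : ℝ) + 1)) :
    ∫ x : Om, (k x - entTestGrad κ (moll n) u x) ^ 2 ≤ 2 * (1 / ((n : ℝ) + 1)) ^ 2 := by
  have := norm_integral_le_of_norm_le_const (μ := (volume : Measure Om))
    (f := fun x : Om => (k x - entTestGrad κ (moll n) u x) ^ 2) (C := (1 / ((n : ℝ) + 1)) ^ 2)
    (ae_of_all _ fun x => by
      rw [Real.norm_of_nonneg (sq_nonneg _), ← sq_abs]
      have := hk x (Ioo_subset_Icc_self x.2)
      gcongr)
  rw [volume_real_Om, mul_comm] at this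
  exact (le_abs_self _).trans this

/-- The values of `h n` converge at every point of `[-1, 1]`, in particular at the end points, and
`k n` converges strongly in `L²`, as the quadratic mobility term requires. The tolerance `1 / (n +
1)` leaves room for the averaging in time. -/
theorem tendsto_sliceFun (hκ : 0 < κ) (hκ1 : κ ≤ 1) (hi : Integrable u)
    (h01 : ∀ y, u y ∈ Icc (0 : ℝ) 1) (hU : IsContVersion u v U) {h k : ℕ → ℝ → ℝ}
    (hh : ∀ n, ∀ x ∈ Icc (-1 : ℝ) 1, |h n x - entTest κ (moll n) u x| ≤ 1 / ((n : ℝ) + 1))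
    (hkc : ∀ n, Continuous (k n))
    (hk : ∀ n, ∀ x ∈ Icc (-1 : ℝ) 1, |k n x - entTestGrad κ (moll n) u x| ≤ 1 / ((n : ℝ) + 1)) :
    Tendsto (fun n => sliceFun a al be u v (h n) (k n)) atTop
      (𝓝 ((∫ x, diffusivity a (u x) * v x * (ent'' κ (u x) * v x))
        - (∫ x, mobility a (u x) * (ent'' κ (u x) * v x) ^ 2)
        - bdry al be (rightTrace u v) (leftTrace u v) (ent' κ (rightTrace u v))
          (ent' κ (leftTrace u v)))) := by
  have hU1 : ∀ x ∈ Icc (-1 : ℝ) 1, Tendsto (fun n => h n x) atTop (𝓝 (ent' κ (U x))) := by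
    intro x hx
    have t1 : Tendsto (fun n : ℕ => κ⁻¹ * (2 * (√(1 / ((n : ℝ) + 2)) * √(∫ x, v x ^ 2)))) atTop (𝓝 0) := by
      simpa using ((tendsto_inv_nat_add_two.sqrt.mul_const (√(∫ x, v x ^ 2))).const_mul 2).const_mul κ⁻¹
    have t2 := (tendsto_one_div_add_atTop_nhds_zero_nat (𝕜 := ℝ)).add t1
    rw [add_zero] at t2
    rw [tendsto_iff_norm_sub_tendsto_zero]
    refine squeeze_zero (fun n => norm_nonneg _) (fun n => ?_) t2
    exact (abs_sub_le _ _ _).trans (add_le_add (hh n x hx)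
      (abs_entTest_sub_le hκ hκ1 (isMollifier_moll n) hi h01 hU hx))
  have m2 := memLp_ent''_mul hκ h01 hU
  have hsq : Tendsto (fun n => ∫ x : Om, (k n x - ent'' κ (U x) * v x) ^ 2) atTop (𝓝 0) := by
    have t1 := (tendsto_entTestGrad hκ hi h01 hU)
    have t2 := ((((tendsto_one_div_add_atTop_nhds_zero_nat (𝕜 := ℝ)).pow 2).const_mul 2).add t1).const_mul 3
    simp only [ne_eq, OfNat.ofNat_ne_zero, not_false_eq_true,
    zero_pow, add_zero, mul_zero] at t2
    refine squeeze_zero (fun n => integral_nonneg fun x => sq_nonneg _) (fun n => ?_) t2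
    obtain ⟨mk, mk'⟩ := memLp_test hκ hi h01 hU (hkc n) (hk n)
    have m1 := (memLp_entTestGrad hκ (isMollifier_moll n) hi h01 hU).1
    have key := integral_add_add_sq_le mk' (m1.sub m2) (MemLp.zero' : MemLp (fun _ : Om => (0 : ℝ)) 2 volume)
    have e : ∫ x : Om, (k n x - ent'' κ (U x) * v x) ^ 2 =
      ∫ x : Om, (k n x - entTestGrad κ (moll n) u x + ((fun x : Om => entTestGrad κ (moll n) u x) -
        fun y : Om => ent'' κ (U y) * v y) x + 0) ^ 2 := by
      congr 1; ext x; simp only [Pi.sub_apply]; ring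
    have e' : ∫ x : Om, ((fun x : Om => entTestGrad κ (moll n) u x) -
        fun y : Om => ent'' κ (U y) * v y) x ^ 2 =
        ∫ x : Om, (entTestGrad κ (moll n) u x - ent'' κ (U x) * v x) ^ 2 := rfl
    rw [e]
    refine key.trans ?_
    rw [e']
    simp only [ne_eq, OfNat.ofNat_ne_zero, not_false_eq_true, zero_pow, integral_zero, add_zero]
    have := integral_sq_test_sub_le (hk n)
    linarith
  have hDm : AEStronglyMeasurable (fun x => diffusivity a (u x)) :=
    (continuous_diffusivity a).comp_aestronglyMeasurable hi.1
  have hSm : AEStronglyMeasurable (fun x => mobility a (u x)) :=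
    (continuous_mobility a).comp_aestronglyMeasurable hi.1
  have mD := (memLp_bdd_mul hDm (ae_of_all _ fun x => abs_diffusivity_le a (h01 x).1 (h01 x).2) hU.memLp).1
  have r1 := tendsto_integral_mul_of_sq mD m2 (fun n => (memLp_test hκ hi h01 hU (hkc n) (hk n)).1) hsq
  have r2 := tendsto_integral_mul_sq_of_sq hSm (fun x => abs_mobility_le a (h01 x).1 (h01 x).2) m2
    (fun n => (memLp_test hκ hi h01 hU (hkc n) (hk n)).1) hsq
  have r3 := ((continuous_bdry al be (U 1) (U (-1))).tendsto (ent' κ (U 1), ent' κ (U (-1)))).comp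
    ((hU1 1 (by norm_num)).prodMk_nhds (hU1 (-1) (by norm_num)))
  rw [hU.right_eq, hU.left_eq] at r3
  have e1 : ∫ x, diffusivity a (u x) * v x * (ent'' κ (u x) * v x) =
      ∫ x : Om, diffusivity a (u x) * v x * (ent'' κ (U x) * v x) := by
    apply integral_congr_ae
    filter_upwards [hU.ae_eq] with x hx
    rw [hx]
  have e2 : ∫ x, mobility a (u x) * (ent'' κ (u x) * v x) ^ 2 =
      ∫ x : Om, mobility a (u x) * (ent'' κ (U x) * v x) ^ 2 := by
    apply integral_congr_ae
    filter_upwards [hU.ae_eq] with x hx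
    rw [hx]
  rw [e1, e2]
  exact (r1.sub r2).sub r3

theorem abs_exp_sub_one_le_of_abs_le {x K : ℝ} (h : |x| ≤ K) : |Real.exp x - 1| ≤ Real.exp K := by
  have h1 := Real.exp_le_exp.2 (abs_le.1 h).2
  have h2 := Real.exp_pos x
  have h3 : 1 ≤ Real.exp K := Real.one_le_exp ((abs_nonneg _).trans h)
  rw [abs_le]; constructor <;> linarith

/-- A bound independent of `n` and affine in `∫ v²`: the dominating function for the integration in
time. -/
theorem abs_sliceFun_le (hal : al ∈ Icc (0 : ℝ) 1) (hbe : be ∈ Icc (0 : ℝ) 1)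
    (hκ : 0 < κ) (hκ1 : κ ≤ 1) (hi : Integrable u)
    (h01 : ∀ y, u y ∈ Icc (0 : ℝ) 1) (hU : IsContVersion u v U) {n : ℕ} {h k : ℝ → ℝ}
    (hh : ∀ x ∈ Icc (-1 : ℝ) 1, |h x - entTest κ (moll n) u x| ≤ 1 / ((n : ℝ) + 1))
    (hkc : Continuous k)
    (hk : ∀ x ∈ Icc (-1 : ℝ) 1, |k x - entTestGrad κ (moll n) u x| ≤ 1 / ((n : ℝ) + 1)) :
    |sliceFun a al be u v h k| ≤ (1 + 2 * |a|) * ((∫ x, v x ^ 2) +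
      2 * (6 + 3 * ((κ⁻¹) ^ 2 * ∫ x, v x ^ 2))) + 4 * Real.exp (κ⁻¹ + 1) := by
  set c := 1 + 2 * |a| with hc
  have hc0 : 0 ≤ c := by positivity
  obtain ⟨mk, mk'⟩ := memLp_test hκ hi h01 hU hkc hk
  obtain ⟨m1, c1⟩ := (memLp_entTestGrad hκ (isMollifier_moll n) hi h01 hU)
  have hn1 : 1 / ((n : ℝ) + 1) ≤ 1 := by
    rw [div_le_one (by positivity)]
    linarith [(n.cast_nonneg : (0 : ℝ) ≤ n)]
  have hn0 : 0 ≤ 1 / ((n : ℝ) + 1) := by positivity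
  have hk2 : ∫ x : Om, k x ^ 2 ≤ 6 + 3 * ((κ⁻¹) ^ 2 * ∫ x, v x ^ 2) := by
    have key := integral_add_add_sq_le mk' m1 (MemLp.zero' : MemLp (fun _ : Om => (0 : ℝ)) 2 volume)
    have e : ∫ x : Om, k x ^ 2 =
      ∫ x : Om, (k x - entTestGrad κ (moll n) u x + entTestGrad κ (moll n) u x + 0) ^ 2 := by
      congr 1; ext x; ring
    simp only [ne_eq, OfNat.ofNat_ne_zero, not_false_eq_true, zero_pow, integral_zero, add_zero] at key e
    rw [e]
    have := integral_sq_test_sub_le hk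
    nlinarith
  have b1 : |∫ x : Om, diffusivity a (u x) * v x * k x| ≤ c * ((∫ x, v x ^ 2) + ∫ x : Om, k x ^ 2) := by
    rw [← integral_add hU.memLp.integrable_sq mk.integrable_sq, ← integral_const_mul,
      ← Real.norm_eq_abs]
    refine norm_integral_le_of_norm_le ((hU.memLp.integrable_sq.add mk.integrable_sq).const_mul c)
      (ae_of_all _ fun x => ?_)
    rw [mul_assoc, norm_mul, Real.norm_eq_abs, Real.norm_eq_abs]
    refine mul_le_mul (abs_diffusivity_le a (h01 x).1 (h01 x).2) ?_ (abs_nonneg _) hc0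
    rw [abs_le]
    constructor <;> nlinarith [sq_nonneg (v x + k x), sq_nonneg (v x - k x)]
  have b2 : |∫ x : Om, mobility a (u x) * k x ^ 2| ≤ c * ∫ x : Om, k x ^ 2 := by
    rw [← integral_const_mul, ← Real.norm_eq_abs]
    refine norm_integral_le_of_norm_le (mk.integrable_sq.const_mul c) (ae_of_all _ fun x => ?_)
    rw [norm_mul, Real.norm_eq_abs, Real.norm_of_nonneg (sq_nonneg _)]
    exact mul_le_mul_of_nonneg_right (abs_mobility_le a (h01 x).1 (h01 x).2) (sq_nonneg _)
  have hhb : ∀ x ∈ Icc (-1 : ℝ) 1, |h x| ≤ κ⁻¹ + 1 := by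
    intro x hx
    have h1 := abs_entTest_le hκ hκ1 (isMollifier_moll n) hi h01 hx
    have h2 := hh x hx
    have h3 := abs_sub_abs_le_abs_sub (h x) (entTest κ (moll n) u x)
    linarith
  have g1 := hhb 1 (by norm_num)
  have g2 := hhb (-1) (by norm_num)
  have b3 := abs_bdry_le hal hbe (r := rightTrace u v) (l := leftTrace u v)
    (hU.right_eq ▸ hU.mem_Icc h01 (by norm_num)) (hU.left_eq ▸ hU.mem_Icc h01 (by norm_num))
    (abs_exp_sub_one_le_of_abs_le (by rwa [abs_neg])) (abs_exp_sub_one_le_of_abs_le g1)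
    (abs_exp_sub_one_le_of_abs_le (by rwa [abs_neg])) (abs_exp_sub_one_le_of_abs_le g2)
  rw [sliceFun]
  have b4 := abs_sub (∫ x : Om, diffusivity a (u x) * v x * k x) (∫ x : Om, mobility a (u x) * k x ^ 2)
  have b5 := mul_le_mul_of_nonneg_left hk2 hc0
  refine (abs_sub _ _).trans ?_
  nlinarith

/-! ### Lower bound of the limit -/

/-- This is where the factor one half in `ent` matters: the mobility term takes away at most half of
what the drift term provides. -/
theorem chi_mul_ent''_le (hκ : 0 < κ) {r : ℝ} (hr : r ∈ Icc (0 : ℝ) 1) :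
    chi r * ent'' κ r ≤ 1 / 2 := by
  have p1 : 0 < r + κ := by linarith [hr.1]
  have p2 : 0 < 1 - r + κ := by linarith [hr.2]
  have e : ent'' κ r = (1 + 2 * κ) / (2 * ((r + κ) * (1 - r + κ))) := by
    rw [ent'']; field_simp; ring
  rw [e, chi, ← mul_div_assoc, div_le_iff₀ (by positivity)]
  nlinarith [mul_nonneg hκ.le (sq_nonneg (r - 1 / 2)), sq_nonneg κ]

theorem inv_le_ent'' (hκ : 0 < κ) {r : ℝ} (hr : r ∈ Icc (0 : ℝ) 1) :
    ((r + κ) * (1 - r + κ))⁻¹ / 2 ≤ ent'' κ r := by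
  have p1 : 0 < r + κ := by linarith [hr.1]
  have p2 : 0 < 1 - r + κ := by linarith [hr.2]
  have e : ent'' κ r = (1 + 2 * κ) * (((r + κ) * (1 - r + κ))⁻¹ / 2) := by
    rw [ent'']; field_simp; ring
  rw [e]
  have : 0 ≤ ((r + κ) * (1 - r + κ))⁻¹ / 2 := by positivity
  nlinarith

/-- `D` is affine, so its minimum on `[0, 1]` is attained at an end point. The bound is positive
exactly when `a > -1/2`. -/
theorem min_le_diffusivity (a : ℝ) {r : ℝ} (hr : r ∈ Icc (0 : ℝ) 1) :
    min 1 (1 + 2 * a) ≤ diffusivity a r := by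
  rw [diffusivity]
  rcases le_total 0 a with h | h
  · exact (min_le_left _ _).trans (by nlinarith [mul_nonneg h hr.1])
  · exact (min_le_right _ _).trans (by nlinarith [hr.2])

theorem dissipation_ge (ha : -(1 / 2) < a) (hκ : 0 < κ) {r : ℝ} (hr : r ∈ Icc (0 : ℝ) 1)
    (w : ℝ) : min 1 (1 + 2 * a) / 4 * (w ^ 2 * ((r + κ) * (1 - r + κ))⁻¹) ≤
      diffusivity a r * w * (ent'' κ r * w) - mobility a r * (ent'' κ r * w) ^ 2 := by
  have h1 := chi_mul_ent''_le hκ hr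
  have h2 := inv_le_ent'' hκ hr
  have h3 := min_le_diffusivity a hr
  have c0 : 0 < min 1 (1 + 2 * a) := lt_min one_pos (by linarith)
  have p1 : 0 < r + κ := by linarith [hr.1]
  have p2 : 0 < 1 - r + κ := by linarith [hr.2]
  have h4 : 0 < ((r + κ) * (1 - r + κ))⁻¹ := by positivity
  have e : diffusivity a r * w * (ent'' κ r * w) - mobility a r * (ent'' κ r * w) ^ 2 =
      diffusivity a r * (ent'' κ r * (1 - chi r * ent'' κ r)) * w ^ 2 := by
    rw [mobility]; ring
  -- One factor `1/2` comes from `inv_le_ent''`, the other from `1 - χ s'' ≥ 1/2`; together they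
  -- give the `1/4` of the statement.
  have k1 : ((r + κ) * (1 - r + κ))⁻¹ / 2 * (1 / 2) ≤ ent'' κ r * (1 - chi r * ent'' κ r) :=
    mul_le_mul h2 (by linarith) (by norm_num) (ent''_nonneg hκ hr)
  have k2 := mul_le_mul h3 k1 (by positivity) (c0.le.trans h3)
  rw [e]
  have k3 := mul_le_mul_of_nonneg_right k2 (sq_nonneg w)
  linarith

/-- The square of `E = exp (-ent' κ r)` is `(1 - r + κ) / (r + κ)`, whose denominator is compensated
by the prefactor `r`. With `2 E ≤ 1 + E²` this gives `2 r E ≤ r + (1 - r + κ) ≤ 2`; the other bound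
is its mirror image. -/
theorem mul_exp_neg_ent'_le (hκ : 0 < κ) (hκ1 : κ ≤ 1) {r : ℝ} (hr : r ∈ Icc (0 : ℝ) 1) :
    r * Real.exp (-ent' κ r) ≤ 1 ∧ (1 - r) * Real.exp (ent' κ r) ≤ 1 := by
  have key : ∀ {p q s : ℝ}, 0 < p → 0 < q → 0 ≤ s → s ≤ 1 → s ≤ p → s + q ≤ 2 →
      s * Real.exp (-((Real.log p - Real.log q) / 2)) ≤ 1 := by
    intro p q s hp hq hs hs1 hsp hsq
    set E := Real.exp (-((Real.log p - Real.log q) / 2)) with hE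
    have h1 : E ^ 2 = q / p := by
      rw [sq, hE, ← Real.exp_add]
      have : -((Real.log p - Real.log q) / 2) + -((Real.log p - Real.log q) / 2) =
        Real.log q - Real.log p := by ring
      rw [this, Real.exp_sub, Real.exp_log hq, Real.exp_log hp]
    have h2 : s * (q / p) ≤ q := by
      rw [← mul_div_assoc, div_le_iff₀ hp, mul_comm]
      gcongr
    have h3 : s * (2 * E) ≤ s * (1 + E ^ 2) := by
      gcongr; nlinarith [sq_nonneg (E - 1)]
    rw [h1] at h3
    linarith
  constructor
  · exact key (by linarith [hr.1]) (by linarith [hr.2]) hr.1 hr.2 (by linarith) (by linarith)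
  · have := key (p := 1 - r + κ) (q := r + κ) (s := 1 - r) (by linarith [hr.2]) (by linarith [hr.1])
      (by linarith [hr.2]) (by linarith [hr.1]) (by linarith) (by linarith)
    rw [ent']
    convert this using 3
    ring

theorem bdry_ent'_le (hal : al ∈ Icc (0 : ℝ) 1) (hbe : be ∈ Icc (0 : ℝ) 1)
    (hκ : 0 < κ) (hκ1 : κ ≤ 1) {r l : ℝ} (hr : r ∈ Icc (0 : ℝ) 1) (hl : l ∈ Icc (0 : ℝ) 1) :
    bdry al be r l (ent' κ r) (ent' κ l) ≤ 4 := by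
  have key : ∀ {d z : ℝ}, d ∈ Icc (0 : ℝ) 1 → z ≤ 1 → d * z ≤ 1 := by
    intro d z hd hz
    nlinarith [hd.1, hd.2]
  have hs : ∀ {c : ℝ}, c ∈ Icc (0 : ℝ) 1 → 1 - c ∈ Icc (0 : ℝ) 1 := fun hc =>
    ⟨by linarith [hc.2], by linarith [hc.1]⟩
  obtain ⟨r1, r2⟩ := mul_exp_neg_ent'_le hκ hκ1 hr
  obtain ⟨l1, l2⟩ := mul_exp_neg_ent'_le hκ hκ1 hl
  have k1 := key (hs hbe) (z := r * (Real.exp (-ent' κ r) - 1)) (by linarith [hr.1])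
  have k2 := key hbe (z := (1 - r) * (Real.exp (ent' κ r) - 1)) (by linarith [hr.2])
  have k3 := key (hs hal) (z := l * (Real.exp (-ent' κ l) - 1)) (by linarith [hl.1])
  have k4 := key hal (z := (1 - l) * (Real.exp (ent' κ l) - 1)) (by linarith [hl.2])
  rw [bdry]
  linarith

theorem slice_lower_bound (ha : -(1 / 2) < a) (hal : al ∈ Icc (0 : ℝ) 1) (hbe : be ∈ Icc (0 : ℝ) 1)
    (hκ : 0 < κ) (hκ1 : κ ≤ 1) (hi : Integrable u)
    (h01 : ∀ y, u y ∈ Icc (0 : ℝ) 1) (hU : IsContVersion u v U) :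
    min 1 (1 + 2 * a) / 4 * (∫ x, v x ^ 2 * ((u x + κ) * (1 - u x + κ))⁻¹) - 4 ≤
      (∫ x, diffusivity a (u x) * v x * (ent'' κ (u x) * v x))
        - (∫ x, mobility a (u x) * (ent'' κ (u x) * v x) ^ 2)
        - bdry al be (rightTrace u v) (leftTrace u v) (ent' κ (rightTrace u v))
          (ent' κ (leftTrace u v)) := by
  have hb := bdry_ent'_le hal hbe hκ hκ1 (r := rightTrace u v) (l := leftTrace u v)
    (hU.right_eq ▸ hU.mem_Icc h01 (by norm_num)) (hU.left_eq ▸ hU.mem_Icc h01 (by norm_num))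
  have hDm : AEStronglyMeasurable (fun x => diffusivity a (u x)) :=
    (continuous_diffusivity a).comp_aestronglyMeasurable hi.1
  have hSm : AEStronglyMeasurable (fun x => mobility a (u x)) :=
    (continuous_mobility a).comp_aestronglyMeasurable hi.1
  have hum := hi.1.aemeasurable
  have hEm : AEMeasurable (fun x => ent'' κ (u x)) := by
    unfold ent''; fun_prop
  have m1 := (memLp_bdd_mul hDm (ae_of_all _ fun x => abs_diffusivity_le a (h01 x).1 (h01 x).2) hU.memLp).1
  have m2 := (memLp_bdd_mul (C := κ⁻¹) hEm.aestronglyMeasurable (ae_of_all _ fun y => by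
      rw [abs_of_nonneg (ent''_nonneg hκ (h01 y))]
      exact ent''_le hκ (h01 y)) hU.memLp).1
  have i1 : Integrable fun x => diffusivity a (u x) * v x * (ent'' κ (u x) * v x) := m1.integrable_mul m2
  have i2 : Integrable fun x => mobility a (u x) * (ent'' κ (u x) * v x) ^ 2 :=
    m2.integrable_sq.bdd_mul hSm (ae_of_all _ fun x => abs_mobility_le a (h01 x).1 (h01 x).2)
  rw [← integral_sub i1 i2, ← integral_const_mul]
  have i3 : Integrable fun x => v x ^ 2 * ((u x + κ) * (1 - u x + κ))⁻¹ := by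
    refine hU.memLp.integrable_sq.mul_bdd (c := κ⁻¹ * κ⁻¹) ?_ (ae_of_all _ fun x => ?_)
    · exact (by fun_prop : AEMeasurable (fun x => ((u x + κ) * (1 - u x + κ))⁻¹)).aestronglyMeasurable
    · have p1 : κ ≤ u x + κ := by linarith [(h01 x).1]
      have p2 : κ ≤ 1 - u x + κ := by linarith [(h01 x).2]
      have p1' := hκ.trans_le p1
      have p2' := hκ.trans_le p2
      rw [mul_inv, Real.norm_of_nonneg (by positivity)]
      exact mul_le_mul (inv_anti₀ hκ p1) (inv_anti₀ hκ p2) (by positivity) (by positivity)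
  have := integral_mono (i3.const_mul (min 1 (1 + 2 * a) / 4)) (i1.sub i2) fun x =>
    dissipation_ge ha hκ (h01 x) (v x)
  simp only [Pi.sub_apply] at this
  linarith

end Slice

end

section

/-! ### Averages in time -/

/-- The average of `F (·, x)` on the interval `[t, t + ε]`. -/
def steklov (ε : ℝ) (F : ℝ → ℝ → ℝ) (t x : ℝ) : ℝ := ∫ s in (0 : ℝ)..1, F (t + ε * s) x

section Steklov

variable {ε : ℝ} {F : ℝ → ℝ → ℝ}

theorem continuous_steklov (hF : Continuous fun p : ℝ × ℝ => F p.1 p.2) :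
    Continuous fun p : ℝ × ℝ => steklov ε F p.1 p.2 := by
  unfold steklov
  refine intervalIntegral.continuous_parametric_intervalIntegral_of_continuous' ?_ _ _
  exact hF.comp (by fun_prop : Continuous fun q : (ℝ × ℝ) × ℝ => (q.1.1 + ε * q.2, q.1.2))

theorem steklov_eq (hε : 0 < ε) (t x : ℝ) :
    steklov ε F t x = ε⁻¹ * ∫ s in t..(t + ε), F s x := by
  have := intervalIntegral.integral_comp_add_mul (a := 0) (b := 1) (fun s => F s x) hε.ne' t
  rw [steklov, this]; simp

theorem hasDerivAt_steklov_left (hε : 0 < ε) (hF : Continuous fun p : ℝ × ℝ => F p.1 p.2) (t x : ℝ) :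
    HasDerivAt (fun s => steklov ε F s x) (ε⁻¹ * (F (t + ε) x - F t x)) t := by
  have hc : Continuous fun s => F s x := hF.comp (by fun_prop : Continuous fun s : ℝ => (s, x))
  have h1 : ∀ s, HasDerivAt (fun r => ∫ z in (0 : ℝ)..r, F z x) (F s x) s := fun s =>
    intervalIntegral.integral_hasDerivAt_right (hc.intervalIntegrable _ _)
      (hc.stronglyMeasurableAtFilter _ _) hc.continuousAt
  have h2 : HasDerivAt (fun s => ε⁻¹ * ((∫ z in (0 : ℝ)..(s + ε), F z x) - ∫ z in (0 : ℝ)..s, F z x))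
      (ε⁻¹ * (F (t + ε) x - F t x)) t := by
    have h3 := (h1 (t + ε)).comp t ((hasDerivAt_id t).add_const ε)
    rw [mul_one] at h3
    exact (h3.sub (h1 t)).const_mul _
  refine h2.congr_of_eventuallyEq (Eventually.of_forall fun s => ?_)
  simp only
  rw [steklov_eq hε, intervalIntegral.integral_interval_sub_left (hc.intervalIntegrable _ _)
    (hc.intervalIntegrable _ _)]

theorem hasDerivAt_steklov_right {Fx : ℝ → ℝ → ℝ} {B : ℝ}
    (hF : Continuous fun p : ℝ × ℝ => F p.1 p.2) (hFx : Continuous fun p : ℝ × ℝ => Fx p.1 p.2)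
    (hd : ∀ t x, HasDerivAt (F t) (Fx t x) x) (hB : ∀ t x, |Fx t x| ≤ B) (t x : ℝ) :
    HasDerivAt (steklov ε F t) (steklov ε Fx t x) x := by
  have c1 : ∀ z, Continuous fun s => F (t + ε * s) z := fun z =>
    hF.comp (by fun_prop : Continuous fun s : ℝ => (t + ε * s, z))
  have c2 : ∀ z, Continuous fun s => Fx (t + ε * s) z := fun z =>
    hFx.comp (by fun_prop : Continuous fun s : ℝ => (t + ε * s, z))
  exact (intervalIntegral.hasDerivAt_integral_of_dominated_loc_of_deriv_le (bound := fun _ => B)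
    (F := fun z s => F (t + ε * s) z) (F' := fun z s => Fx (t + ε * s) z) (s := univ) univ_mem
    (Eventually.of_forall fun z => (c1 z).aestronglyMeasurable) ((c1 x).intervalIntegrable _ _)
    (c2 x).aestronglyMeasurable (ae_of_all _ fun s _ z _ => hB _ _)
    intervalIntegrable_const (ae_of_all _ fun s _ z _ => hd _ _)).2

theorem abs_steklov_sub_le (hε : 0 < ε) {t x η c : ℝ} (h : ∀ s ∈ Icc t (t + ε), |F s x - c| ≤ η)
    (hF : Continuous fun p : ℝ × ℝ => F p.1 p.2) :
    |steklov ε F t x - c| ≤ η := by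
  have c1 : Continuous fun s => F (t + ε * s) x :=
    hF.comp (by fun_prop : Continuous fun s : ℝ => (t + ε * s, x))
  have e : steklov ε F t x - c = ∫ s in (0 : ℝ)..1, (F (t + ε * s) x - c) := by
    rw [intervalIntegral.integral_sub (c1.intervalIntegrable _ _) intervalIntegrable_const, steklov]
    simp
  rw [e, ← Real.norm_eq_abs]
  have := intervalIntegral.norm_integral_le_of_norm_le_const (a := 0) (b := 1) (C := η)
    (f := fun s => F (t + ε * s) x - c) fun s hs => by
      rw [uIoc_of_le zero_le_one] at hs
      refine h _ ⟨?_, ?_⟩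
      · nlinarith [hs.1]
      · nlinarith [hs.2]
  simpa using this

end Steklov

/-! ### The entropy inequality -/

/-- The duality between `A` and the functions `S` and `r ↦ A r r - S r`, averaged in time. -/
theorem le_increment_of_fenchel {A : ℝ → ℝ → ℝ} {S : ℝ → ℝ} {ε T : ℝ} (hT : 0 < T) (hε : 0 < ε)
    (hA : Continuous fun p : ℝ × ℝ => A p.1 p.2) (hS : Continuous S)
    (h : ∀ t r, A t r ≤ S t + (A r r - S r)) (hAT : ∀ t, T ≤ t → A t t = A T T)
    (hST : ∀ t, T ≤ t → S t = S T) :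
    S T - S 0 ≤ A T T - (∫ s in (0 : ℝ)..1, A 0 (ε * s)) -
      ∫ t in (0 : ℝ)..T, ε⁻¹ * (A t (t + ε) - A t t) := by
  set P : ℝ → ℝ := fun r => A r r - S r with hP
  have hPc : Continuous P := (hA.comp (by fun_prop : Continuous fun r : ℝ => (r, r))).sub hS
  have hi : ∀ x y, IntervalIntegrable P volume x y := fun x y => hPc.intervalIntegrable x y
  have c1 : Continuous fun s => A 0 (ε * s) :=
    hA.comp (by fun_prop : Continuous fun s : ℝ => ((0 : ℝ), ε * s))
  have c2 : Continuous fun t => ε⁻¹ * (A t (t + ε) - A t t) := continuous_const.mul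
    ((hA.comp (by fun_prop : Continuous fun t : ℝ => (t, t + ε))).sub
      (hA.comp (by fun_prop : Continuous fun t : ℝ => (t, t))))
  have c3 : Continuous fun t => ε⁻¹ * (P (t + ε) - P t) := by fun_prop
  -- The Fenchel inequality between time `0` and time `ε s`, averaged over `s`.
  have k1 : ∫ s in (0 : ℝ)..1, A 0 (ε * s) ≤ S 0 + ε⁻¹ * ∫ s in (0 : ℝ)..ε, P s := by
    have e : ∫ s in (0 : ℝ)..1, (S 0 + P (ε * s)) = S 0 + ε⁻¹ * ∫ s in (0 : ℝ)..ε, P s := by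
      rw [intervalIntegral.integral_add intervalIntegrable_const
        ((by fun_prop : Continuous fun s => P (ε * s)).intervalIntegrable _ _),
        intervalIntegral.integral_comp_mul_left P hε.ne']
      simp
    rw [← e]
    exact intervalIntegral.integral_mono_on zero_le_one (c1.intervalIntegrable _ _)
      ((by fun_prop : Continuous fun s => S 0 + P (ε * s)).intervalIntegrable _ _)
      fun s _ => h 0 (ε * s)
  -- The inequality at `(t, t + ε)` reads `A t (t + ε) - A t t ≤ P (t + ε) - P t`. Its integral
  -- telescopes, since `P` is constant after `T`, and the average of `P` over `[0, ε]` cancels the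
  -- one in `k1`.
  have k2 : ∫ t in (0 : ℝ)..T, ε⁻¹ * (A t (t + ε) - A t t) ≤
      P T - ε⁻¹ * ∫ s in (0 : ℝ)..ε, P s := by
    have e : ∫ t in (0 : ℝ)..T, ε⁻¹ * (P (t + ε) - P t) = P T - ε⁻¹ * ∫ s in (0 : ℝ)..ε, P s := by
      rw [intervalIntegral.integral_const_mul, intervalIntegral.integral_sub
        ((by fun_prop : Continuous fun t => P (t + ε)).intervalIntegrable _ _) (hi _ _),
        intervalIntegral.integral_comp_add_right P ε]
      have e1 := intervalIntegral.integral_add_adjacent_intervals (hi 0 ε) (hi ε (T + ε))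
      have e2 := intervalIntegral.integral_add_adjacent_intervals (hi 0 T) (hi T (T + ε))
      have e3 : ∫ t in T..(T + ε), P t = ε * P T := by
        rw [intervalIntegral.integral_congr (g := fun _ => P T)]
        · simp
        · intro t ht
          rw [uIcc_of_le (by linarith)] at ht
          simp only [hP]
          rw [hAT t ht.1, hST t ht.1]
      rw [zero_add]
      have e4 : (∫ t in ε..(T + ε), P t) - ∫ t in (0 : ℝ)..T, P t =
        ε * P T - ∫ t in (0 : ℝ)..ε, P t := by linarith
      rw [e4]
      field_simp
    rw [← e]
    refine intervalIntegral.integral_mono_on hT.le (c2.intervalIntegrable _ _)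
      (c3.intervalIntegrable _ _) fun t _ => ?_
    have := h t (t + ε)
    have h0 : 0 < ε⁻¹ := inv_pos.2 hε
    refine mul_le_mul_of_nonneg_left ?_ h0.le
    simp only [hP]
    linarith
  have : P T = A T T - S T := rfl
  linarith

theorem continuous_integral_of_bounded {X : Type*} [TopologicalSpace X] [FirstCountableTopology X]
    {g : X → ℝ → ℝ} (hg : Continuous fun p : X × ℝ => g p.1 p.2) {C : ℝ} (hC : ∀ x y, |g x y| ≤ C) :
    Continuous fun x => ∫ y : Om, g x y :=
  continuous_of_dominated (bound := fun _ => C)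
    (fun x => (hg.comp (by fun_prop : Continuous fun y : Om => (x, (y : ℝ)))).aestronglyMeasurable)
    (fun x => ae_of_all _ fun y => hC x y) (integrable_const _)
    (ae_of_all _ fun y => hg.comp (by fun_prop : Continuous fun x : X => (x, (y : ℝ))))

/-- A symmetric kernel defines a self-adjoint operator. It moves the outer mollification of the test
function onto the density. -/
theorem integral_mul_integralOp {k : ℝ → ℝ → ℝ} (hk : Continuous fun p : ℝ × ℝ => k p.1 p.2)
    {C : ℝ} (hC : ∀ x y, |k x y| ≤ C) (hs : ∀ x y, k x y = k y x) {f g : Om → ℝ}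
    (hf : Integrable f) (hg : Integrable g) :
    ∫ x : Om, f x * integralOp k g x = ∫ x : Om, integralOp k f x * g x := by
  have hi : Integrable (fun p : Om × Om => k p.1 p.2 * (f p.1 * g p.2)) (volume.prod volume) :=
    (hf.mul_prod hg).bdd_mul (c := C)
      (hk.comp (by fun_prop : Continuous fun p : Om × Om => ((p.1 : ℝ), (p.2 : ℝ)))).aestronglyMeasurable
      (ae_of_all _ fun p => hC _ _)
  have := integral_integral_swap (f := fun x y : Om => k x y * (f x * g y)) hi
  simp only [integralOp, ← integral_const_mul, ← integral_mul_const]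
  refine Eq.trans ?_ (this.trans ?_)
  · congr 1; ext x; congr 1; ext y; ring
  · congr 1; ext x; congr 1; ext y; rw [hs]; ring

end

/-! ### Entropy test functions along a continuous trajectory -/

section

variable {T : ℝ}

section ContinuousPath

variable {π : CadlagPath T MeasSpace} {u : Icc (0 : ℝ) T × Om → ℝ} {ρ : ℝ → ℝ} {κ δ : ℝ}

theorem IsVersion.mem_Icc (hu : IsVersion π u) (p) : u p ∈ Icc (0 : ℝ) 1 := ⟨hu.nonneg p, hu.le_one p⟩

theorem abs_integralOp_le {k : ℝ → ℝ → ℝ} {C : ℝ} (hC : ∀ x y, |k x y| ≤ C) {f : Om → ℝ} {B : ℝ}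
    (hf : ∀ y, |f y| ≤ B) (x : ℝ) : |integralOp k f x| ≤ C * B * 2 := by
  have := norm_integral_le_of_norm_le_const (μ := (volume : Measure Om)) (C := C * B)
    (f := fun y : Om => k x y * f y) (ae_of_all _ fun y => by
      rw [norm_mul]
      exact mul_le_mul (hC x y) (hf y) (norm_nonneg _) ((abs_nonneg _).trans (hC x y)))
  rwa [volume_real_Om] at this

theorem IsVersion.lipschitzWith_integralOp (hu : IsVersion π u) (hm : IsMollifier ρ δ) {C : ℝ}
    (hC0 : 0 ≤ C) (hC : ∀ x y, |refl (deriv ρ) x y| ≤ C) (t : Icc (0 : ℝ) T) :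
    LipschitzWith (C * 1 * 2).toNNReal (integralOp (refl ρ) fun y => u (t, y)) := by
  refine lipschitzWith_of_nnnorm_deriv_le
    (fun x => (hasDerivAt_integralOp hm (hu.integrable_slice t) x).differentiableAt) fun x => ?_
  rw [(hasDerivAt_integralOp hm (hu.integrable_slice t) x).deriv, ← NNReal.coe_le_coe,
    Real.coe_toNNReal _ (by positivity), coe_nnnorm]
  exact abs_integralOp_le hC (fun y => hu.abs_le_one (t, y)) x

/-- The mollification of a continuous trajectory is jointly continuous. -/
theorem continuous_integralOp_path (hu : IsVersion π u) (hπ : Continuous π.toFun)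
    (hm : IsMollifier ρ δ) :
    Continuous fun p : Icc (0 : ℝ) T × ℝ => integralOp (refl ρ) (fun y => u (p.1, y)) p.2 := by
  obtain ⟨C, hC0, h1, -, h2⟩ := hm.exists_refl_bound
  have hcont : ∀ x, Continuous fun t : Icc (0 : ℝ) T => integralOp (refl ρ) (fun y => u (t, y)) x := by
    intro x
    have hc : Continuous fun y : Om => refl ρ x y :=
      hm.continuous_refl.comp (by fun_prop : Continuous fun y : Om => (x, (y : ℝ)))
    have := (continuous_integral_bounded hc fun y => h1 x y).comp hπ
    refine this.congr fun t => ?_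
    simp only [Function.comp_apply]
    rw [hu.integral_eq, integralOp]
    congr 1; ext y; ring
  have := continuous_prod_of_continuous_lipschitzWith
    (fun p : ℝ × Icc (0 : ℝ) T => integralOp (refl ρ) (fun y => u (p.2, y)) p.1) _ hcont
    (hu.lipschitzWith_integralOp hm hC0 h2)
  exact this.comp (by fun_prop : Continuous fun p : Icc (0 : ℝ) T × ℝ => (p.2, p.1))

theorem continuous_ent'_path (hκ : 0 < κ) (hu : IsVersion π u) (hπ : Continuous π.toFun)
    (hm : IsMollifier ρ δ) :
    Continuous fun p : Icc (0 : ℝ) T × ℝ =>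
      ent' κ (integralOp (refl ρ) (fun y => u (p.1, y)) p.2) :=
  (continuousOn_ent' hκ).comp_continuous (continuous_integralOp_path hu hπ hm) fun p =>
    integralOp_refl_mem hm (hu.integrable_slice p.1) (fun y => hu.mem_Icc (p.1, y)) _

theorem abs_ent'_path_le (hκ : 0 < κ) (hκ1 : κ ≤ 1) (hu : IsVersion π u) (hm : IsMollifier ρ δ)
    (t : Icc (0 : ℝ) T) (x : ℝ) : |ent' κ (integralOp (refl ρ) (fun y => u (t, y)) x)| ≤ κ⁻¹ :=
  abs_ent'_le hκ hκ1 (integralOp_refl_mem hm (hu.integrable_slice t) (fun y => hu.mem_Icc (t, y)) _)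

theorem continuous_kernel_ent' (hκ : 0 < κ) (hκ1 : κ ≤ 1) (hu : IsVersion π u)
    (hπ : Continuous π.toFun) (hm : IsMollifier ρ δ) {k : ℝ → ℝ → ℝ}
    (hk : Continuous fun p : ℝ × ℝ => k p.1 p.2) {C : ℝ} (hC : ∀ x y, |k x y| ≤ C) :
    Continuous fun p : Icc (0 : ℝ) T × ℝ =>
      integralOp k (fun y => ent' κ (integralOp (refl ρ) (fun y => u (p.1, y)) y)) p.2 := by
  refine continuous_integral_of_bounded (X := Icc (0 : ℝ) T × ℝ) (C := C * κ⁻¹)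
    (g := fun p y => k p.2 y * ent' κ (integralOp (refl ρ) (fun y => u (p.1, y)) y)) ?_ ?_
  · exact (hk.comp (by fun_prop : Continuous fun q : (Icc (0 : ℝ) T × ℝ) × ℝ => (q.1.2, q.2))).mul
      ((continuous_ent'_path hκ hu hπ hm).comp
        (by fun_prop : Continuous fun q : (Icc (0 : ℝ) T × ℝ) × ℝ => (q.1.1, q.2)))
  · intro p y
    rw [abs_mul]
    exact mul_le_mul (hC _ _) (abs_ent'_path_le hκ hκ1 hu hm _ _) (abs_nonneg _)
      ((abs_nonneg _).trans (hC p.2 y))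

/-- Test functions which approximate `entTest κ ρ u_t` uniformly, with a lower bound of the
linear part of the rate functional. -/
theorem exists_test (hT : 0 < T) (hκ : 0 < κ) (hκ1 : κ ≤ 1) (hu : IsVersion π u)
    (hπ : Continuous π.toFun) (hm : IsMollifier ρ δ) {η : ℝ} (hη : 0 < η) :
    ∃ H Hx : ℝ → ℝ → ℝ, IsCmn 1 1 T H ∧ (∀ t x, HasDerivAt (H t) (Hx t x) x) ∧
      (Continuous fun p : ℝ × ℝ => Hx p.1 p.2) ∧ -8 ≤ L0 hT π H ∧
      ∀ t : Icc (0 : ℝ) T, ∀ x ∈ Icc (-1 : ℝ) 1,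
        |H t x - entTest κ ρ (fun y => u (t, y)) x| ≤ η ∧
        |Hx t x - entTestGrad κ ρ (fun y => u (t, y)) x| ≤ η := by
  obtain ⟨C, hC0, h1, -, h2⟩ := hm.exists_refl_bound
  -- The trajectory is frozen at its end values outside `[0, T]`, so that averages over `[t, t + ε]`
  -- make sense up to `t = T`.
  let pr : ℝ → Icc (0 : ℝ) T := projIcc 0 T hT.le
  have hpr : Continuous pr := continuous_projIcc
  have hpr_coe : ∀ t : Icc (0 : ℝ) T, pr t = t := projIcc_val hT.le
  let F : ℝ → ℝ → ℝ := fun t x => entTest κ ρ (fun y => u (pr t, y)) x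
  let Fx : ℝ → ℝ → ℝ := fun t x => entTestGrad κ ρ (fun y => u (pr t, y)) x
  have cF0 : Continuous fun p : Icc (0 : ℝ) T × ℝ => entTest κ ρ (fun y => u (p.1, y)) p.2 :=
    continuous_kernel_ent' hκ hκ1 hu hπ hm hm.continuous_refl h1
  have cFx0 : Continuous fun p : Icc (0 : ℝ) T × ℝ => entTestGrad κ ρ (fun y => u (p.1, y)) p.2 :=
    continuous_kernel_ent' hκ hκ1 hu hπ hm hm.continuous_refl_deriv h2
  have hpr2 : Continuous fun p : ℝ × ℝ => (pr p.1, p.2) := by fun_prop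
  have cF : Continuous fun p : ℝ × ℝ => F p.1 p.2 := cF0.comp hpr2
  have cFx : Continuous fun p : ℝ × ℝ => Fx p.1 p.2 := cFx0.comp hpr2
  have hd : ∀ t x, HasDerivAt (F t) (Fx t x) x := fun t x =>
    hasDerivAt_entTest hκ hκ1 hm (hu.integrable_slice _) (fun y => hu.mem_Icc _) x
  have hB : ∀ t x, |Fx t x| ≤ C * κ⁻¹ * 2 := fun t x =>
    abs_integralOp_le h2 (fun y => abs_ent'_path_le hκ hκ1 hu hm _ _) x
  -- uniform continuity in time
  have huc : ∀ {G : Icc (0 : ℝ) T × ℝ → ℝ}, Continuous G → ∃ ε > 0, ∀ s t : Icc (0 : ℝ) T,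
      |(s : ℝ) - t| ≤ ε → ∀ x ∈ Icc (-1 : ℝ) 1, |G (s, x) - G (t, x)| ≤ η := by
    intro G hG
    have hK : IsCompact ((univ : Set (Icc (0 : ℝ) T)) ×ˢ Icc (-1 : ℝ) 1) :=
      isCompact_univ.prod isCompact_Icc
    obtain ⟨ε, hε, h⟩ := Metric.uniformContinuousOn_iff.1
      (hK.uniformContinuousOn_of_continuous hG.continuousOn) η hη
    refine ⟨ε / 2, half_pos hε, fun s t hst x hx => ?_⟩
    have := h (s, x) ⟨mem_univ _, hx⟩ (t, x) ⟨mem_univ _, hx⟩ (by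
      rw [Prod.dist_eq, dist_self, max_eq_left dist_nonneg, Subtype.dist_eq, Real.dist_eq]
      linarith)
    rw [Real.dist_eq] at this
    exact this.le
  obtain ⟨ε₁, hε₁, hu1⟩ := huc cF0
  obtain ⟨ε₂, hε₂, hu2⟩ := huc cFx0
  set ε := min ε₁ ε₂ with hεdef
  have hε : 0 < ε := lt_min hε₁ hε₂
  have hclose : ∀ t : Icc (0 : ℝ) T, ∀ s ∈ Icc (t : ℝ) (t + ε), |(pr s : ℝ) - t| ≤ ε := by
    intro t s hs
    have : |(pr s : ℝ) - pr t| ≤ |s - t| := by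
      have := abs_projIcc_sub_projIcc (c := s) (d := (t : ℝ)) hT.le
      exact this
    rw [hpr_coe] at this
    refine this.trans ?_
    rw [abs_of_nonneg (by linarith [hs.1])]
    linarith [hs.2]
  have htd := hasDerivAt_steklov_left hε cF
  have hHd := hasDerivAt_steklov_right (ε := ε) cF cFx hd hB
  have hct : Continuous fun p : ℝ × ℝ => ε⁻¹ * (F (p.1 + ε) p.2 - F p.1 p.2) :=
    continuous_const.mul ((cF.comp (by fun_prop : Continuous fun p : ℝ × ℝ => (p.1 + ε, p.2))).sub cF)
  refine ⟨steklov ε F, steklov ε Fx, isCmn_one_one hT htd hHd (continuous_steklov cF) hct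
    (continuous_steklov cFx), hHd, continuous_steklov cFx, ?_, fun t x hx => ⟨?_, ?_⟩⟩
  -- `W` is the mollified density, `S` its entropy and `A t r` the pairing of `W_t` with
  -- `ent'(W_r)`. Self-adjointness of the mollification identifies `A t r` with the pairing of `u_t`
  -- and the unaveraged test function at time `r`, to which the Fenchel argument applies.
  · let W : ℝ → ℝ → ℝ := fun t x => integralOp (refl ρ) (fun y => u (pr t, y)) x
    have cW : Continuous fun p : ℝ × ℝ => W p.1 p.2 := (continuous_integralOp_path hu hπ hm).comp hpr2
    have mW : ∀ t x, W t x ∈ Icc (0 : ℝ) 1 := fun t x =>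
      integralOp_refl_mem hm (hu.integrable_slice _) (fun y => hu.mem_Icc _) x
    have cE' : Continuous fun p : ℝ × ℝ => ent' κ (W p.1 p.2) :=
      (continuousOn_ent' hκ).comp_continuous cW fun p => mW _ _
    have cE : Continuous fun p : ℝ × ℝ => ent κ (W p.1 p.2) :=
      (continuousOn_ent hκ).comp_continuous cW fun p => mW _ _
    let A : ℝ → ℝ → ℝ := fun t r => ∫ y : Om, W t y * ent' κ (W r y)
    let S : ℝ → ℝ := fun t => ∫ y : Om, ent κ (W t y)
    have bA : ∀ t r x, |W t x * ent' κ (W r x)| ≤ κ⁻¹ := fun t r x => by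
      rw [abs_mul, abs_of_nonneg (mW t x).1]
      exact (mul_le_of_le_one_left (abs_nonneg _) (mW t x).2).trans (abs_ent'_le hκ hκ1 (mW r x))
    have cA : Continuous fun p : ℝ × ℝ => A p.1 p.2 :=
      continuous_integral_of_bounded (X := ℝ × ℝ) (C := κ⁻¹)
        (g := fun p y => W p.1 y * ent' κ (W p.2 y))
        ((cW.comp (by fun_prop : Continuous fun q : (ℝ × ℝ) × ℝ => (q.1.1, q.2))).mul
          (cE'.comp (by fun_prop : Continuous fun q : (ℝ × ℝ) × ℝ => (q.1.2, q.2))))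
        fun p x => bA _ _ _
    have cS : Continuous S :=
      continuous_integral_of_bounded cE fun t x => abs_ent_le hκ hκ1 (mW t x)
    have iA : ∀ t r, Integrable fun y : Om => W t y * ent' κ (W r y) := fun t r =>
      integrable_of_continuous_bounded
        ((cW.comp (by fun_prop : Continuous fun y : Om => (t, (y : ℝ)))).mul
          (cE'.comp (by fun_prop : Continuous fun y : Om => (r, (y : ℝ))))) fun y => bA t r y
    have iS : ∀ t, Integrable fun y : Om => ent κ (W t y) := fun t =>
      integrable_of_continuous_bounded
        (cE.comp (by fun_prop : Continuous fun y : Om => (t, (y : ℝ))))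
        fun y => abs_ent_le hκ hκ1 (mW t y)
    have hF : ∀ t r, A t r ≤ S t + (A r r - S r) := by
      intro t r
      have ir : Integrable fun y : Om => W r y * ent' κ (W r y) - ent κ (W r y) := (iA r r).sub (iS r)
      rw [← integral_sub (iA r r) (iS r), ← integral_add (iS t) ir]
      exact integral_mono (iA t r) ((iS t).add ir) fun y => mul_ent'_le hκ (mW t y) (mW r y)
    have hprT : ∀ t, T ≤ t → pr t = pr T := fun t ht => by
      simp only [pr]
      rw [projIcc_of_right_le _ ht, projIcc_of_right_le _ le_rfl]
    have hWT : ∀ t, T ≤ t → W t = W T := fun t ht => by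
      simp only [W]; rw [hprT t ht]
    have key := le_increment_of_fenchel hT hε cA cS hF (fun t ht => by simp only [A, hWT t ht])
      fun t ht => by simp only [S, hWT t ht]
    -- The regularized entropy is at most `2` in absolute value and `Ω` has length `2`. The entropy
    -- increment is thus at least `-8`, the constant in the statement.
    have bS : ∀ t, |S t| ≤ 4 := by
      intro t
      have := norm_integral_le_of_norm_le_const (μ := (volume : Measure Om)) (C := 2)
        (f := fun y : Om => ent κ (W t y)) (ae_of_all _ fun y => abs_ent_le hκ hκ1 (mW t y))
      rw [volume_real_Om] at this
      exact this.trans (by norm_num)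
    -- the pairings
    have hpair : ∀ t r, ∫ x : Om, u (pr t, x) * F r x = A t r := fun t r =>
      integral_mul_integralOp hm.continuous_refl h1 hm.refl_symm (hu.integrable_slice _)
        (integrable_ent'_integralOp hκ hκ1 hm (hu.integrable_slice _) fun y => hu.mem_Icc _)
    have iF : ∀ t r, Integrable fun x : Om => u (pr t, x) * F r x := fun t r =>
      integrable_mul_of_continuous (hu.integrable_slice _)
        (cF.comp (by fun_prop : Continuous fun x : ℝ => (r, x))).continuousOn
    have hst : ∀ t r, ∫ x : Om, u (pr t, x) * steklov ε F r x = ∫ s in (0 : ℝ)..1, A t (r + ε * s) := by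
      intro t r
      simp only [← hpair, steklov, intervalIntegral.integral_of_le zero_le_one, ← integral_const_mul]
      refine integral_integral_swap (f := fun x s => u (pr t, x) * F (r + ε * s) x) ?_
      have hFb : ∀ p : Om × ℝ, |F (r + ε * p.2) p.1| ≤ C * κ⁻¹ * 2 := fun p =>
        abs_integralOp_le h1 (fun y => abs_ent'_path_le hκ hκ1 hu hm _ _) _
      have hi1 : Integrable (fun p : Om × ℝ => u (pr t, p.1) * (1 : ℝ))
          ((volume : Measure Om).prod (volume.restrict (Ioc 0 1))) :=
        (hu.integrable_slice (pr t)).mul_prod (integrable_const 1)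
      simp only [mul_one] at hi1
      exact hi1.mul_bdd (c := C * κ⁻¹ * 2) (cF.comp (by fun_prop :
        Continuous fun p : Om × ℝ => (r + ε * p.2, (p.1 : ℝ)))).aestronglyMeasurable
        (ae_of_all _ hFb)
    have e1 : pairing (π (endTime hT)) (steklov ε F T) = A T T := by
      rw [hu.pairing_eq]
      have e0 : endTime hT = pr T := (projIcc_right (h := hT.le)).symm
      rw [e0, hst, intervalIntegral.integral_congr (g := fun _ => A T T)]
      · simp
      · intro s hs
        rw [uIcc_of_le zero_le_one] at hs
        simp only [A]
        rw [hWT (T + ε * s) (by nlinarith [hs.1])]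
    have e2 : pairing (π (startTime hT)) (steklov ε F 0) = ∫ s in (0 : ℝ)..1, A 0 (ε * s) := by
      rw [hu.pairing_eq]
      have e0 : startTime hT = pr 0 := (projIcc_left (h := hT.le)).symm
      rw [e0, hst]
      simp
    have e3 : ∫ t : Icc (0 : ℝ) T, pairing (π t) (dt T (steklov ε F) t) =
        ∫ t in (0 : ℝ)..T, ε⁻¹ * (A t (t + ε) - A t t) := by
      rw [← integral_Tm hT.le fun t => ε⁻¹ * (A t (t + ε) - A t t)]
      congr 1; ext t
      rw [hu.pairing_eq, ← hpair, ← hpair, hpr_coe]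
      have i1 := iF t (t + ε)
      have i2 := iF t t
      rw [hpr_coe] at i1 i2
      rw [← integral_sub i1 i2, ← integral_const_mul]
      congr 1; ext x
      rw [dt_eq_of_hasDerivAt hT htd t.2]
      ring
    rw [L0, e1, e2, e3]
    have b1 := abs_le.1 (bS T)
    have b2 := abs_le.1 (bS 0)
    linarith [b1.1, b2.2]
  · refine abs_steklov_sub_le hε (fun s hs => ?_) cF
    exact hu1 (pr s) t ((hclose t s hs).trans (min_le_left _ _)) x hx
  · refine abs_steklov_sub_le hε (fun s hs => ?_) cFx
    exact hu2 (pr s) t ((hclose t s hs).trans (min_le_right _ _)) x hx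

end ContinuousPath

end

/-! ### The energy estimate -/

section

variable {T : ℝ}

theorem bdry_eq (al be r l p q : ℝ) : bdry al be r l p q =
    r * ((1 - be) * (Real.exp (-p) - 1) - be * (Real.exp p - 1)) +
    l * ((1 - al) * (Real.exp (-q) - 1) - al * (Real.exp q - 1)) +
    (be * (Real.exp p - 1) + al * (Real.exp q - 1)) := by
  rw [bdry]; ring

/-- The boundary term is affine in the boundary values, and these are linear in `(u, v)`. Its time
integral is therefore affine in `(u, v)`, with continuous kernels determined by the boundary values
of the test function. -/
theorem integral_bdry (al be : ℝ) {p q : ℝ → ℝ} (hp : ContinuousOn p (Icc 0 T))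
    (hq : ContinuousOn q (Icc 0 T)) : ∃ (A B : ℝ × ℝ → ℝ) (c : ℝ),
      ContinuousOn A (Icc 0 T ×ˢ Icc (-1 : ℝ) 1) ∧ ContinuousOn B (Icc 0 T ×ˢ Icc (-1 : ℝ) 1) ∧
      ∀ u v : Icc (0 : ℝ) T × Om → ℝ, Integrable u → Integrable v →
        Integrable (fun t : Icc (0 : ℝ) T => bdry al be (rightTrace (fun x => u (t, x)) fun x => v (t, x))
          (leftTrace (fun x => u (t, x)) fun x => v (t, x)) (p t) (q t)) ∧
        ∫ t : Icc (0 : ℝ) T, bdry al be (rightTrace (fun x => u (t, x)) fun x => v (t, x))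
          (leftTrace (fun x => u (t, x)) fun x => v (t, x)) (p t) (q t) =
        (∫ z : Icc (0 : ℝ) T × Om, u z * A (z.1, z.2)) +
          (∫ z : Icc (0 : ℝ) T × Om, v z * B (z.1, z.2)) + c := by
  set α : ℝ → ℝ := fun t => (1 - be) * (Real.exp (-p t) - 1) - be * (Real.exp (p t) - 1) with hα
  set β : ℝ → ℝ := fun t => (1 - al) * (Real.exp (-q t) - 1) - al * (Real.exp (q t) - 1) with hβ
  set γ : ℝ → ℝ := fun t => be * (Real.exp (p t) - 1) + al * (Real.exp (q t) - 1) with hγ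
  have cα : ContinuousOn α (Icc 0 T) := by
    simp only [hα]; fun_prop
  have cβ : ContinuousOn β (Icc 0 T) := by
    simp only [hβ]; fun_prop
  have cγ : ContinuousOn γ (Icc 0 T) := by
    simp only [hγ]; fun_prop
  have hα' : ContinuousOn (fun q : ℝ × ℝ => α q.1) (Icc 0 T ×ˢ Icc (-1 : ℝ) 1) :=
    cα.comp continuousOn_fst fun q hq => hq.1
  have hβ' : ContinuousOn (fun q : ℝ × ℝ => β q.1) (Icc 0 T ×ˢ Icc (-1 : ℝ) 1) :=
    cβ.comp continuousOn_fst fun q hq => hq.1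
  have cA : ContinuousOn (fun z : ℝ × ℝ => 1 / 2 * α z.1 + 1 / 2 * β z.1)
      (Icc 0 T ×ˢ Icc (-1 : ℝ) 1) := (hα'.const_mul _).add (hβ'.const_mul _)
  have c1 : ContinuousOn (fun z : ℝ × ℝ => (1 + z.2) / 2 * α z.1) (Icc 0 T ×ˢ Icc (-1 : ℝ) 1) :=
    (show Continuous fun q : ℝ × ℝ => (1 + q.2) / 2 by fun_prop).continuousOn.mul hα'
  have c2 : ContinuousOn (fun z : ℝ × ℝ => (1 - z.2) / 2 * β z.1) (Icc 0 T ×ˢ Icc (-1 : ℝ) 1) :=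
    (show Continuous fun q : ℝ × ℝ => (1 - q.2) / 2 by fun_prop).continuousOn.mul hβ'
  refine ⟨fun z => 1 / 2 * α z.1 + 1 / 2 * β z.1,
    fun z => (1 + z.2) / 2 * α z.1 - (1 - z.2) / 2 * β z.1, ∫ t : Icc (0 : ℝ) T, γ t, cA, c1.sub c2,
    fun u v hu hv => ?_⟩
  obtain ⟨i1, -, e1, -⟩ := integral_trace hu hv cα
  obtain ⟨-, i2, -, e2⟩ := integral_trace hu hv cβ
  have i3 : Integrable fun t : Icc (0 : ℝ) T => γ t := by
    obtain ⟨C, hC⟩ := isCompact_Icc.exists_bound_of_continuousOn cγ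
    exact Integrable.of_bound (cγ.comp_continuous continuous_subtype_val
      fun t => t.2).aestronglyMeasurable C (ae_of_all _ fun t => hC t t.2)
  have i12 : Integrable fun t : Icc (0 : ℝ) T =>
    rightTrace (fun x => u (t, x)) (fun x => v (t, x)) * α t +
      leftTrace (fun x => u (t, x)) (fun x => v (t, x)) * β t := i1.add i2
  have e : ∀ t : Icc (0 : ℝ) T, bdry al be (rightTrace (fun x => u (t, x)) fun x => v (t, x))
          (leftTrace (fun x => u (t, x)) fun x => v (t, x)) (p t) (q t) =
      rightTrace (fun x => u (t, x)) (fun x => v (t, x)) * α t +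
      leftTrace (fun x => u (t, x)) (fun x => v (t, x)) * β t + γ t := fun t => bdry_eq _ _ _ _ _ _
  simp only [e]
  refine ⟨i12.add i3, ?_⟩
  rw [integral_add i12 i3, integral_add i1 i2, e1, e2]
  have j1 : Integrable (fun z : Icc (0 : ℝ) T × Om => u z * (1 / 2 * α z.1)) :=
    integrable_mul_rect hu (F := fun z => 1 / 2 * α z.1) (hα'.const_mul _)
  have j2 : Integrable (fun z : Icc (0 : ℝ) T × Om => u z * (1 / 2 * β z.1)) :=
    integrable_mul_rect hu (F := fun z => 1 / 2 * β z.1) (hβ'.const_mul _)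
  have j3 : Integrable (fun z : Icc (0 : ℝ) T × Om => v z * ((1 + z.2) / 2 * α z.1)) :=
    integrable_mul_rect hv (F := fun z => (1 + z.2) / 2 * α z.1) c1
  have j4 : Integrable (fun z : Icc (0 : ℝ) T × Om => v z * ((1 - z.2) / 2 * β z.1)) :=
    integrable_mul_rect hv (F := fun z => (1 - z.2) / 2 * β z.1) c2
  simp only [mul_add, mul_sub]
  rw [integral_add j1 j2, integral_sub j3 j4]
  ring

section Energy

variable {a al be κ q : ℝ} {hT : 0 < T} {π : CadlagPath T MeasSpace} {u v : Icc (0 : ℝ) T × Om → ℝ}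

theorem Jhat_eq_sliceFun (hu : IsVersion π u) (hv : HasSpaceGrad u v) {H Hx : ℝ → ℝ → ℝ}
    (hH : IsCmn 1 1 T H) (hd : ∀ t x, HasDerivAt (H t) (Hx t x) x) :
    Integrable (fun t : Icc (0 : ℝ) T =>
      sliceFun a al be (fun x => u (t, x)) (fun x => v (t, x)) (H t) (Hx t)) ∧
    Jhat a al be hT H π = L0 hT π H + ∫ t : Icc (0 : ℝ) T,
      sliceFun a al be (fun x => u (t, x)) (fun x => v (t, x)) (H t) (Hx t) := by
  have i1 := integrable_mul_rect (integrable_diffusivity_mul hu hv a) (hH.continuousOn_dx le_rfl)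
  have i2 := integrable_mul_rect (integrable_mobility hu a) (F := fun q => dx H q.1 q.2 ^ 2)
    ((hH.continuousOn_dx le_rfl).pow 2)
  have hdx : ∀ p : Icc (0 : ℝ) T × Om, dx H p.1 p.2 = Hx p.1 p.2 := fun p =>
    dx_eq_of_hasDerivAt hd _ (Ioo_subset_Icc_self p.2.2)
  simp only [hdx] at i1 i2
  have hslice : ∀ {x : ℝ}, x ∈ Icc (-1 : ℝ) 1 → ContinuousOn (fun t => H t x) (Icc 0 T) := fun hx =>
    hH.continuousOn.comp (by fun_prop : Continuous fun t : ℝ => (t, _)).continuousOn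
      fun t ht => ⟨ht, hx⟩
  obtain ⟨_, _, _, -, -, h⟩ := integral_bdry al be (hslice (x := 1) (by norm_num))
    (hslice (x := -1) (by norm_num))
  obtain ⟨i3, -⟩ := h u v hu.integrable (hv.memLp.integrable one_le_two)
  have k1 : Integrable fun t : Icc (0 : ℝ) T => ∫ x : Om,
    diffusivity a (u (t, x)) * v (t, x) * Hx t x := i1.integral_prod_left
  have k2 : Integrable fun t : Icc (0 : ℝ) T => ∫ x : Om,
    mobility a (u (t, x)) * Hx t x ^ 2 := i2.integral_prod_left
  have k12 : Integrable fun t : Icc (0 : ℝ) T => (∫ x : Om,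
    diffusivity a (u (t, x)) * v (t, x) * Hx t x) - ∫ x : Om,
    mobility a (u (t, x)) * Hx t x ^ 2 := k1.sub k2
  refine ⟨k12.sub i3, ?_⟩
  rw [Jhat_eq al be a hT hu hv hH]
  simp only [hdx, sliceFun]
  rw [integral_sub k12 i3, integral_sub k1 k2, ← integral_iterated i1, ← integral_iterated i2]
  ring

theorem integrable_sq_mul_inv (hκ : 0 < κ) (hu : IsVersion π u) (hv : HasSpaceGrad u v) :
    Integrable fun p => v p ^ 2 * ((u p + κ) * (1 - u p + κ))⁻¹ := by
  refine hv.memLp.integrable_sq.mul_bdd (c := κ⁻¹ * κ⁻¹) ?_ (ae_of_all _ fun p => ?_)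
  · have := hu.measurable
    exact (by fun_prop : Measurable (fun p => ((u p + κ) * (1 - u p + κ))⁻¹)).aestronglyMeasurable
  · have p1 : κ ≤ u p + κ := by linarith [hu.nonneg p]
    have p2 : κ ≤ 1 - u p + κ := by linarith [hu.le_one p]
    have p1' := hκ.trans_le p1
    have p2' := hκ.trans_le p2
    rw [mul_inv, Real.norm_of_nonneg (by positivity)]
    exact mul_le_mul (inv_anti₀ hκ p1) (inv_anti₀ hκ p2) (by positivity) (by positivity)

/-- The energy estimate. -/
theorem energy_estimate (ha : -(1 / 2) < a) (hal : al ∈ Icc (0 : ℝ) 1) (hbe : be ∈ Icc (0 : ℝ) 1)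
    (hu : IsVersion π u) (hv : HasSpaceGrad u v)
    (hJ : ∀ H, IsCmn 1 1 T H → Jhat a al be hT H π ≤ q) (hκ : 0 < κ) (hκ1 : κ ≤ 1) :
    min 1 (1 + 2 * a) / 4 * (∫ p, v p ^ 2 * ((u p + κ) * (1 - u p + κ))⁻¹) ≤ q + 8 + 4 * T := by
  -- Time continuity is what makes the mollified entropy test functions jointly continuous, as
  -- `exists_test` requires.
  have hπ := continuous_path hal hbe hu hv hJ
  have hex := fun n : ℕ => exists_test hT hκ hκ1 hu hπ (isMollifier_moll n)
    (show 0 < 1 / ((n : ℝ) + 1) by positivity)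
  choose H Hx hH hd hc hL hclose using hex
  have hle : ∀ n, ∫ t : Icc (0 : ℝ) T,
      sliceFun a al be (fun x => u (t, x)) (fun x => v (t, x)) (H n t) (Hx n t) ≤ q + 8 := by
    intro n
    have h1 := hJ _ (hH n)
    rw [(Jhat_eq_sliceFun hu hv (hH n) (hd n)).2] at h1
    linarith [hL n]
  set Φ : Icc (0 : ℝ) T → ℝ := fun t =>
    (∫ x, diffusivity a (u (t, x)) * v (t, x) * (ent'' κ (u (t, x)) * v (t, x)))
        - (∫ x, mobility a (u (t, x)) * (ent'' κ (u (t, x)) * v (t, x)) ^ 2)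
        - bdry al be (rightTrace (fun x => u (t, x)) fun x => v (t, x))
          (leftTrace (fun x => u (t, x)) fun x => v (t, x))
          (ent' κ (rightTrace (fun x => u (t, x)) fun x => v (t, x)))
          (ent' κ (leftTrace (fun x => u (t, x)) fun x => v (t, x))) with hΦ
  -- A dominating function independent of `n`, integrable because `v` is square-integrable in
  -- space-time.
  set b : Icc (0 : ℝ) T → ℝ := fun t => (1 + 2 * |a|) * ((∫ x, v (t, x) ^ 2) +
      2 * (6 + 3 * ((κ⁻¹) ^ 2 * ∫ x, v (t, x) ^ 2))) + 4 * Real.exp (κ⁻¹ + 1) with hb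
  have hvi : Integrable fun t : Icc (0 : ℝ) T => ∫ x, v (t, x) ^ 2 :=
    (show Integrable (fun p => v p ^ 2) (volume.prod volume) from
      hv.memLp.integrable_sq).integral_prod_left
  have hbi : Integrable b :=
    ((hvi.add (((integrable_const _).add ((hvi.const_mul _).const_mul _)).const_mul _)).const_mul
      _).add (integrable_const _)
  have hCV := hv.ae_exists_isContVersion hu.measurable hu.abs_le_one
  have hbound : ∀ n, ∀ᵐ t : Icc (0 : ℝ) T,
      ‖sliceFun a al be (fun x => u (t, x)) (fun x => v (t, x)) (H n t) (Hx n t)‖ ≤ b t := by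
    intro n
    filter_upwards [hCV] with t ⟨U, hU⟩
    exact abs_sliceFun_le hal hbe hκ hκ1 (hu.integrable_slice t) (fun y => hu.mem_Icc _) hU
      (fun x hx => (hclose n t x hx).1)
      ((hc n).comp (by fun_prop : Continuous fun x : ℝ => ((t : ℝ), x)))
      (fun x hx => (hclose n t x hx).2)
  have hlim : ∀ᵐ t : Icc (0 : ℝ) T, Tendsto (fun n =>
      sliceFun a al be (fun x => u (t, x)) (fun x => v (t, x)) (H n t) (Hx n t)) atTop (𝓝 (Φ t)) := by
    filter_upwards [hCV] with t ⟨U, hU⟩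
    exact tendsto_sliceFun hκ hκ1 (hu.integrable_slice t) (fun y => hu.mem_Icc _) hU
      (fun n x hx => (hclose n t x hx).1)
      (fun n => (hc n).comp (by fun_prop : Continuous fun x : ℝ => ((t : ℝ), x)))
      (fun n x hx => (hclose n t x hx).2)
  have hmeas : ∀ n, AEStronglyMeasurable (fun t : Icc (0 : ℝ) T =>
      sliceFun a al be (fun x => u (t, x)) (fun x => v (t, x)) (H n t) (Hx n t)) := fun n =>
    (Jhat_eq_sliceFun (hT := hT) hu hv (hH n) (hd n)).1.1
  have hΦm : AEStronglyMeasurable Φ := aestronglyMeasurable_of_tendsto_ae atTop hmeas hlim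
  have hΦi : Integrable Φ := by
    refine Integrable.mono' hbi hΦm ?_
    filter_upwards [ae_all_iff.2 hbound, hlim] with t h1 h2
    exact le_of_tendsto h2.norm (Eventually.of_forall h1)
  have hΦle : ∫ t, Φ t ≤ q + 8 :=
    le_of_tendsto (tendsto_integral_of_dominated_convergence b hmeas hbi hbound hlim)
      (Eventually.of_forall hle)
  have hi := integrable_sq_mul_inv hκ hu hv
  have hi' : Integrable fun t : Icc (0 : ℝ) T =>
      ∫ x, v (t, x) ^ 2 * ((u (t, x) + κ) * (1 - u (t, x) + κ))⁻¹ := hi.integral_prod_left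
  -- The boundary term costs at most `4` at each time, hence the `4 * T` in the final bound.
  have hlow : ∫ t : Icc (0 : ℝ) T, (min 1 (1 + 2 * a) / 4 *
      (∫ x, v (t, x) ^ 2 * ((u (t, x) + κ) * (1 - u (t, x) + κ))⁻¹) - 4) ≤ ∫ t, Φ t := by
    refine integral_mono_ae ((hi'.const_mul _).sub (integrable_const _)) hΦi ?_
    filter_upwards [hCV] with t ⟨U, hU⟩
    exact slice_lower_bound ha hal hbe hκ hκ1 (hu.integrable_slice t) (fun y => hu.mem_Icc _) hU
  rw [integral_sub (hi'.const_mul _) (integrable_const _), integral_const_mul, integral_iterated hi,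
    integral_const, volume_real_Icc hT.le, smul_eq_mul] at hlow
  linarith

/-- The energy estimate with `κ = 1`: since `(u + 1)(2 - u) ≤ 9/4`, the weight is at least `4/9`.
The bound is the same for all trajectories of the level set. -/
theorem integral_sq_grad_le (ha : -(1 / 2) < a) (hal : al ∈ Icc (0 : ℝ) 1) (hbe : be ∈ Icc (0 : ℝ) 1)
    (hu : IsVersion π u) (hv : HasSpaceGrad u v)
    (hJ : ∀ H, IsCmn 1 1 T H → Jhat a al be hT H π ≤ q) :
    ∫ p, v p ^ 2 ≤ 9 * (q + 8 + 4 * T) / min 1 (1 + 2 * a) := by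
  have c0 : 0 < min 1 (1 + 2 * a) := lt_min one_pos (by linarith)
  have h := energy_estimate ha hal hbe hu hv hJ one_pos le_rfl
  have h2 : 4 / 9 * ∫ p, v p ^ 2 ≤ ∫ p, v p ^ 2 * ((u p + 1) * (1 - u p + 1))⁻¹ := by
    rw [← integral_const_mul]
    refine integral_mono (hv.memLp.integrable_sq.const_mul _) (integrable_sq_mul_inv one_pos hu hv)
      fun p => ?_
    have p1 := hu.nonneg p
    have p2 := hu.le_one p
    have p3 : 0 < (u p + 1) * (1 - u p + 1) := mul_pos (by linarith) (by linarith)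
    have p4 : (9 / 4 : ℝ)⁻¹ ≤ ((u p + 1) * (1 - u p + 1))⁻¹ :=
      inv_anti₀ p3 (by nlinarith [sq_nonneg (u p - 1 / 2)])
    have := mul_le_mul_of_nonneg_left p4 (sq_nonneg (v p))
    simp only
    norm_num at this ⊢
    linarith
  rw [le_div_iff₀ c0]
  have h3 := mul_le_mul_of_nonneg_left h2 (show 0 ≤ min 1 (1 + 2 * a) / 4 by positivity)
  nlinarith

/-- Integration by parts and completion of the square give `-2 v G - X G² ≤ v² / X` with `X = (u +
κ)(1 - u + κ)`. As `χ ≤ X ≤ χ + 2κ` for `κ ≤ 1`, replacing `X` by `χ` costs a term of order `κ`,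
which disappears as `κ → 0`. -/
theorem energyFun_le (ha : -(1 / 2) < a) (hal : al ∈ Icc (0 : ℝ) 1) (hbe : be ∈ Icc (0 : ℝ) 1)
    (hu : IsVersion π u) (hv : HasSpaceGrad u v)
    (hJ : ∀ H, IsCmn 1 1 T H → Jhat a al be hT H π ≤ q) {G : ℝ → ℝ → ℝ} (hG : IsCmn 1 2 T G)
    (hG0 : HasCompactSupportInOm T G) :
    energyFun π G ≤ 4 * (q + 8 + 4 * T) / min 1 (1 + 2 * a) := by
  have c0 : 0 < min 1 (1 + 2 * a) := lt_min one_pos (by linarith)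
  have mG : MemLp (fun p : Icc (0 : ℝ) T × Om => G p.1 p.2) 2 volume := memLp_rect hG.continuousOn
  set E := 4 * (q + 8 + 4 * T) / min 1 (1 + 2 * a) with hE
  have key : ∀ κ : ℝ, 0 < κ → κ ≤ 1 →
      energyFun π G ≤ E + κ * (2 * ∫ p : Icc (0 : ℝ) T × Om, G p.1 p.2 ^ 2) := by
    intro κ hκ hκ1
    have h := energy_estimate ha hal hbe hu hv hJ hκ hκ1
    have h1 : ∫ p, v p ^ 2 * ((u p + κ) * (1 - u p + κ))⁻¹ ≤ E := by
      rw [hE, le_div_iff₀ c0]; linarith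
    rw [energyFun_eq hu hG, integral_mul_dx_eq hu hv one_le_two hG hG0]
    have i1 : Integrable fun p : Icc (0 : ℝ) T × Om => v p * G p.1 p.2 := hv.memLp.integrable_mul mG
    have i2 : Integrable fun p : Icc (0 : ℝ) T × Om => chi (u p) * G p.1 p.2 ^ 2 :=
      integrable_mul_rect hu.integrable_chi (F := fun q => G q.1 q.2 ^ 2) (hG.continuousOn.pow 2)
    have i3 := integrable_sq_mul_inv hκ hu hv
    have i4 : Integrable fun p : Icc (0 : ℝ) T × Om => κ * (2 * G p.1 p.2 ^ 2) :=
      (mG.integrable_sq.const_mul 2).const_mul κ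
    have hm := integral_mono (((i1.const_mul (-2)).sub i2)) (i3.add i4) fun p => by
      have p1 := hu.nonneg p
      have p2 := hu.le_one p
      have p3 : 0 < (u p + κ) * (1 - u p + κ) := mul_pos (by linarith) (by linarith)
      simp only [Pi.sub_apply, Pi.add_apply, chi]
      set X := (u p + κ) * (1 - u p + κ) with hX
      set g := G p.1 p.2
      have e1 : v p ^ 2 * X⁻¹ + X * g ^ 2 + 2 * (v p * g) = X⁻¹ * (v p + X * g) ^ 2 := by
        field_simp; ring
      have e2 : 0 ≤ X⁻¹ * (v p + X * g) ^ 2 := by positivity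
      have e3 : X * g ^ 2 - u p * (1 - u p) * g ^ 2 ≤ κ * (2 * g ^ 2) := by
        rw [hX]
        nlinarith [mul_nonneg hκ.le (sq_nonneg g), mul_nonneg (mul_nonneg hκ.le (sub_nonneg.2 hκ1)) (sq_nonneg g)]
      linarith
    simp only [Pi.sub_apply, Pi.add_apply] at hm
    rw [integral_sub (i1.const_mul _) i2, integral_add i3 i4, integral_const_mul, integral_const_mul,
      integral_const_mul] at hm
    linarith
  -- Instead of taking a limit, `κ` is chosen so small that the error `κ S` is at most half of the
  -- supposed excess.
  by_contra hcon
  push Not at hcon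
  set S := 2 * ∫ p : Icc (0 : ℝ) T × Om, G p.1 p.2 ^ 2 with hS
  have hS0 : 0 ≤ S := mul_nonneg two_pos.le (integral_nonneg fun p => sq_nonneg _)
  have hd : 0 < energyFun π G - E := by linarith
  have hk := key (min 1 ((energyFun π G - E) / (2 * (S + 1)))) (lt_min one_pos (by positivity))
    (min_le_left _ _)
  have h3 : min 1 ((energyFun π G - E) / (2 * (S + 1))) * S ≤ (energyFun π G - E) / 2 := by
    calc _ ≤ (energyFun π G - E) / (2 * (S + 1)) * S := by gcongr; exact min_le_right _ _
      _ ≤ (energyFun π G - E) / (2 * (S + 1)) * (S + 1) := by gcongr; linarith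
      _ = _ := by field_simp
  linarith

end Energy

end

section

variable {T : ℝ}

/-! ### Weak limits along ultrafilters -/

/-- Banach-Alaoglu for the dual, transported by the Riesz isometry. An ultrafilter on a compact set
converges, so no subsequence has to be extracted. -/
theorem exists_tendsto_inner {X E : Type*} [NormedAddCommGroup E] [InnerProductSpace ℝ E]
    [CompleteSpace E] (F : Ultrafilter X) {w : X → E} {C : ℝ} (h : ∀ x, ‖w x‖ ≤ C) :
    ∃ w', ‖w'‖ ≤ C ∧ ∀ y, Tendsto (fun x => inner ℝ (w x) y) F (𝓝 (inner ℝ w' y)) := by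
  have hc := WeakDual.isCompact_closedBall (𝕜 := ℝ) (E := E) 0 C
  let Φ : X → WeakDual ℝ E := fun x => StrongDual.toWeakDual (InnerProductSpace.toDual ℝ E (w x))
  obtain ⟨l, hl, hlim⟩ := isCompact_iff_ultrafilter_le_nhds'.1 hc (F.map Φ) (by
    rw [Ultrafilter.mem_map]
    refine Filter.univ_mem' fun x => ?_
    simp only [mem_preimage, mem_closedBall_zero_iff]
    exact (LinearIsometryEquiv.norm_map (InnerProductSpace.toDual ℝ E) (w x)).trans_le (h x))
  refine ⟨(InnerProductSpace.toDual ℝ E).symm (WeakDual.toStrongDual l), ?_, fun y => ?_⟩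
  · rw [LinearIsometryEquiv.norm_map]
    simpa using hl
  · rw [InnerProductSpace.toDual_symm_apply]
    exact ((WeakDual.eval_continuous y).tendsto l).comp (show Tendsto Φ F (𝓝 l) from hlim)

theorem inner_toLp {α : Type*} [MeasurableSpace α] {μ : Measure α} {f g : α → ℝ} (hf : MemLp f 2 μ)
    (hg : MemLp g 2 μ) : inner ℝ hf.toLp hg.toLp = ∫ x, f x * g x ∂μ := by
  rw [L2.inner_def]
  apply integral_congr_ae
  filter_upwards [hf.coeFn_toLp, hg.coeFn_toLp] with x h1 h2
  rw [h1, h2]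
  simp [mul_comm]

theorem norm_toLp_sq {α : Type*} [MeasurableSpace α] {μ : Measure α} {f : α → ℝ} (hf : MemLp f 2 μ) :
    ‖hf.toLp‖ ^ 2 = ∫ x, f x ^ 2 ∂μ := by
  rw [← real_inner_self_eq_norm_sq, inner_toLp]
  simp only [sq]

theorem exists_tendsto_integral_mul {X α : Type*} [MeasurableSpace α] {μ : Measure α}
    (F : Ultrafilter X) {f : X → α → ℝ} (hf : ∀ x, MemLp (f x) 2 μ) {V : ℝ}
    (hV : ∀ x, ∫ y, f x y ^ 2 ∂μ ≤ V) :
    ∃ g, Measurable g ∧ MemLp g 2 μ ∧ ∫ y, g y ^ 2 ∂μ ≤ V ∧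
      ∀ h, MemLp h 2 μ → Tendsto (fun x => ∫ y, f x y * h y ∂μ) F (𝓝 (∫ y, g y * h y ∂μ)) := by
  have hV0 : 0 ≤ V := by
    obtain ⟨x, -⟩ := F.nonempty_of_mem Filter.univ_mem
    exact (integral_nonneg fun y => sq_nonneg _).trans (hV x)
  obtain ⟨w, hw, hlim⟩ := exists_tendsto_inner F (w := fun x => (hf x).toLp) (C := √V) fun x => by
    rw [← Real.sqrt_sq (norm_nonneg _), norm_toLp_sq]
    exact Real.sqrt_le_sqrt (hV x)
  have hg : MemLp w 2 μ := Lp.memLp w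
  have ew : hg.toLp = w := Lp.toLp_coeFn w hg
  refine ⟨w, (Lp.stronglyMeasurable w).measurable, hg, ?_, fun h hh => ?_⟩
  · rw [← norm_toLp_sq hg, ew, ← Real.sq_sqrt hV0]
    gcongr
  · have := hlim hh.toLp
    simp only [inner_toLp] at this
    rwa [← ew, inner_toLp] at this

theorem integral_withDensity_mul {g : Om → ℝ} (hg : Measurable g) (h0 : ∀ᵐ x, 0 ≤ g x) (f : Om → ℝ) :
    ∫ x, f x ∂((volume : Measure Om).withDensity fun x => ENNReal.ofReal (g x)) =
      ∫ x, g x * f x := by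
  rw [integral_withDensity_eq_integral_toReal_smul hg.ennreal_ofReal (by simp)]
  apply integral_congr_ae
  filter_upwards [h0] with x hx
  simp [ENNReal.toReal_ofReal hx]

theorem integrable_boundedContinuous (f : BoundedContinuousFunction Om ℝ) : Integrable fun x => f x :=
  integrable_of_continuous_bounded f.continuous f.norm_coe_le_norm

/-- The densities are bounded in `L²` and have a weak limit; testing with indicators preserves `0 ≤
w ≤ 1`. Bounded continuous functions on `Ω` belong to `L²`, so weak convergence of measures follows
and no mass escapes to the end points. -/
theorem isCompact_absCont : IsCompact AbsCont := by
  rw [isCompact_iff_ultrafilter_le_nhds']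
  intro F hF
  -- Passing to the subtype provides a density for every index, not only for those in a set of the
  -- ultrafilter.
  let F' : Ultrafilter AbsCont := F.comap Subtype.val_injective (by simpa using hF)
  have hF' : Filter.map Subtype.val (F' : Filter AbsCont) = F :=
    Filter.map_comap_of_mem (by simpa using hF)
  choose g hgm hg01 hg using fun μ : AbsCont => μ.2
  have hL : ∀ μ, MemLp (g μ) 2 volume := fun μ =>
    MemLp.of_bound (hgm μ).aestronglyMeasurable 1 (by
      filter_upwards [hg01 μ] with x hx
      exact abs_le.2 ⟨by linarith [hx.1], hx.2⟩)
  obtain ⟨w, hwm, hw, -, hlim⟩ := exists_tendsto_integral_mul F' hL (V := 2) fun μ => by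
    have := integral_mono_ae (hL μ).integrable_sq (integrable_const 1) (by
      filter_upwards [hg01 μ] with x hx
      nlinarith [hx.1, hx.2])
    simpa [volume_real_Om] using this
  have hwi : Integrable w := hw.integrable one_le_two
  have hset : ∀ {s : Set Om}, MeasurableSet s → ∀ {f : Om → ℝ},
      ∫ x, f x * s.indicator (fun _ => (1 : ℝ)) x = ∫ x in s, f x := by
    intro s hs f
    rw [← integral_indicator hs]
    congr 1; ext x
    by_cases hx : x ∈ s <;> simp [hx]
  have hind : ∀ {s : Set Om}, MeasurableSet s → Tendsto (fun μ => ∫ x in s, g μ x) F'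
      (𝓝 (∫ x in s, w x)) := by
    intro s hs
    have := hlim (s.indicator fun _ => (1 : ℝ)) ((memLp_const 1).indicator hs)
    simpa only [hset hs] using this
  have h0 : ∀ᵐ x, 0 ≤ w x := ae_nonneg_of_forall_setIntegral_nonneg hwi fun s hs _ =>
    ge_of_tendsto (hind hs) (Eventually.of_forall fun μ =>
      integral_nonneg_of_ae (ae_restrict_of_ae ((hg01 μ).mono fun x hx => hx.1)))
  have h1 : ∀ᵐ x, 0 ≤ 1 - w x := by
    refine ae_nonneg_of_forall_setIntegral_nonneg (f := fun x => 1 - w x)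
      ((integrable_const 1).sub hwi) fun s hs _ => ?_
    rw [integral_sub (integrable_const 1) hwi.integrableOn]
    refine ge_of_tendsto ((hind hs).const_sub _) (Eventually.of_forall fun μ => ?_)
    rw [← integral_sub (integrable_const 1) ((hL μ).integrable one_le_two).integrableOn]
    exact integral_nonneg_of_ae (ae_restrict_of_ae ((hg01 μ).mono fun x hx => by
      simpa using hx.2))
  have hfin : IsFiniteMeasure ((volume : Measure Om).withDensity fun x => ENNReal.ofReal (w x)) :=
    isFiniteMeasure_withDensity_ofReal hwi.2
  let ν : FiniteMeasure Om := ⟨_, hfin⟩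
  have hmass : ν.mass ≤ 2 := by
    rw [← ENNReal.coe_le_coe, FiniteMeasure.ennreal_mass]
    change (volume : Measure Om).withDensity (fun x => ENNReal.ofReal (w x)) univ ≤ _
    rw [withDensity_apply _ MeasurableSet.univ, Measure.restrict_univ]
    calc ∫⁻ x : Om, ENNReal.ofReal (w x) ≤ ∫⁻ _ : Om, 1 := by
          apply lintegral_mono_ae
          filter_upwards [h1] with x hx
          rw [← ENNReal.ofReal_one]
          exact ENNReal.ofReal_le_ofReal (by linarith)
      _ = (volume : Measure Om) univ := by simp
      _ = ENNReal.ofReal 2 := by rw [← volume_real_Om, Measure.real, ENNReal.ofReal_toReal (by simp)]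
      _ = _ := by simp
  refine ⟨⟨ν, hmass⟩, ⟨w, hwm, ?_, rfl⟩, ?_⟩
  · filter_upwards [h0, h1] with x k0 k1
    exact ⟨k0, by linarith⟩
  · rw [← hF']
    change Tendsto Subtype.val _ _
    rw [tendsto_subtype_rng]
    refine FiniteMeasure.tendsto_iff_forall_integral_tendsto.2 fun f => ?_
    have hfL : MemLp (fun x => f x) 2 (volume : Measure Om) :=
      MemLp_two_of_bound f.continuous.aestronglyMeasurable f.norm_coe_le_norm
    have := hlim _ hfL
    have e1 : ∫ x, f x ∂(ν : Measure Om) = ∫ x, w x * f x := integral_withDensity_mul hwm h0 _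
    have e2 : ∀ μ : AbsCont, ∫ x, f x ∂(μ.1.1 : Measure Om) = ∫ x, g μ x * f x := fun μ => by
      rw [hg μ]
      exact integral_withDensity_mul (hgm μ) ((hg01 μ).mono fun x hx => hx.1) _
    change Tendsto (fun μ : AbsCont => ∫ x, f x ∂(μ.1.1 : Measure Om)) F' (𝓝 (∫ x, f x ∂(ν : Measure Om)))
    simp only [e1, e2]
    exact this

/-! ### Uniform convergence -/

/-- The Arzelà-Ascoli argument: pointwise convergence on a finite `δ`-net is spread by the common
modulus of continuity, which the limit inherits. Each of the three errors is `ε / 3`. -/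
theorem eventually_forall_abs_sub_le {X Y : Type*} [PseudoMetricSpace Y] [CompactSpace Y]
    {F : Filter X} [F.NeBot] {g : X → Y → ℝ} {g' : Y → ℝ}
    (hpt : ∀ t, Tendsto (fun x => g x t) F (𝓝 (g' t)))
    (heq : ∀ ε > 0, ∃ δ > 0, ∀ x, ∀ s t, dist t s < δ → |g x t - g x s| ≤ ε) {ε : ℝ} (hε : 0 < ε) :
    ∀ᶠ x in F, ∀ t, |g x t - g' t| ≤ ε := by
  obtain ⟨δ, hδ, h⟩ := heq (ε / 3) (by positivity)
  obtain ⟨S, -, hS, hcov⟩ := finite_cover_balls_of_compact (isCompact_univ (X := Y)) hδ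
  have hev : ∀ᶠ x in F, ∀ s ∈ S, |g x s - g' s| ≤ ε / 3 := by
    rw [eventually_all_finite hS]
    intro s _
    have := (hpt s).eventually (Metric.ball_mem_nhds (g' s) (show 0 < ε / 3 by positivity))
    filter_upwards [this] with x hx
    rw [Real.dist_eq] at hx
    exact hx.le
  filter_upwards [hev] with x hx t
  obtain ⟨s, hs, hts⟩ := mem_iUnion₂.1 (hcov (mem_univ t))
  have h1 := h x s t hts
  have h2 := hx s hs
  have h3 : |g' t - g' s| ≤ ε / 3 :=
    le_of_tendsto ((hpt t).sub (hpt s)).abs (Eventually.of_forall fun x => h x s t hts)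
  rw [abs_le] at *
  constructor <;> linarith

/-- The uniform structure of `𝓜` is that of pointwise convergence on nonnegative bounded continuous
functions, so it can be tested on one function at a time. -/
theorem tendsto_uniformity_measSpace {X : Type*} {F : Filter X} {μ ν : X → MeasSpace}
    (h : ∀ f : BoundedContinuousFunction Om ℝ≥0, Tendsto (fun x =>
      (∫ y, (f y : ℝ) ∂((μ x).1 : Measure Om)) - ∫ y, (f y : ℝ) ∂((ν x).1 : Measure Om)) F (𝓝 0)) :
    Tendsto (fun x => (μ x, ν x)) F (𝓤 MeasSpace) := by
  have e : 𝓤 MeasSpace = Filter.comap (fun p : MeasSpace × MeasSpace =>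
      (MeasSpace.eval p.1, MeasSpace.eval p.2)) (𝓤 _) := rfl
  rw [e, tendsto_comap_iff, Pi.uniformity, tendsto_iInf]
  intro f
  rw [tendsto_comap_iff]
  have e2 : 𝓤 ℝ≥0 = Filter.comap (fun p : ℝ≥0 × ℝ≥0 => ((p.1 : ℝ), (p.2 : ℝ))) (𝓤 ℝ) := rfl
  rw [e2, tendsto_comap_iff, Metric.uniformity_eq_comap_nhds_zero, tendsto_comap_iff]
  have := (h f).abs
  rw [abs_zero] at this
  refine this.congr fun x => ?_
  have k : ∀ κ : MeasSpace, (MeasSpace.eval κ f : ℝ) = ∫ y, (f y : ℝ) ∂(κ.1 : Measure Om) := by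
    intro κ
    have := integral_toReal (μ := (κ.1 : Measure Om)) (f := fun y => (f y : ℝ≥0∞))
      f.continuous.measurable.coe_nnreal_ennreal.aemeasurable (ae_of_all _ fun y => by simp)
    simp only [ENNReal.coe_toReal] at this
    rw [this]
    rfl
  simp only [Function.comp_apply]
  rw [Real.dist_eq, k, k]

end

/-! ### Uniform limits of trajectories -/

section

variable {T : ℝ}

/-- A continuous trajectory. -/
def CadlagPath.ofContinuous {E : Type*} [TopologicalSpace E] (f : Icc (0 : ℝ) T → E)
    (hf : Continuous f) : CadlagPath T E where
  toFun := f
  right_continuous := fun _ => hf.continuousWithinAt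
  left_limit := fun t => ⟨f t, hf.continuousAt.mono_left nhdsWithin_le_nhds⟩

/-- Uniform convergence is stronger than Skorohod convergence: the identity serves as change of
time. -/
theorem CadlagPath.tendsto_of_uniform {X E : Type*} [UniformSpace E] {F : Filter X}
    {p : X → CadlagPath T E} {π : CadlagPath T E}
    (h : Tendsto (fun z : X × Icc (0 : ℝ) T => (π z.2, p z.1 z.2)) (F ×ˢ ⊤) (𝓤 E)) :
    Tendsto p F (𝓝 π) := by
  refine (nhds_basis_uniformity' (hasBasis_uniformity_cadlagPath T E)).tendsto_right_iff.2 ?_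
  rintro ⟨V, ε⟩ ⟨hV, hε⟩
  have := mem_prod_top.1 (h hV)
  filter_upwards [this] with x hx
  exact ⟨OrderIso.refl _, fun t => ⟨by simpa using hε, hx t⟩⟩

theorem tendsto_prod_top_iff {X Y : Type*} {F : Filter X} {g : X → Y → ℝ} :
    Tendsto (fun z : X × Y => g z.1 z.2) (F ×ˢ ⊤) (𝓝 0) ↔
      ∀ ε > 0, ∀ᶠ x in F, ∀ y, |g x y| ≤ ε := by
  constructor
  · intro h ε hε
    have := mem_prod_top.1 (h (Metric.closedBall_mem_nhds 0 hε))
    filter_upwards [this] with x hx y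
    simpa using hx y
  · intro h
    refine Metric.nhds_basis_closedBall.tendsto_right_iff.2 fun ε hε => ?_
    refine mem_prod_top.2 ?_
    filter_upwards [h ε hε] with x hx y
    simpa using hx y

section Limit

variable {X : Type*} {F : Ultrafilter X} {p : X → CadlagPath T MeasSpace}
  {uu vv : X → Icc (0 : ℝ) T × Om → ℝ} {a al be q V : ℝ} {hT : 0 < T}

/-- Arzelà-Ascoli along the ultrafilter. Limits at each fixed time exist by compactness of `𝓜⁰`; the
equicontinuity shared by the whole family makes the limit continuous and the convergence uniform in
time. -/
theorem exists_limit_path (hal : al ∈ Icc (0 : ℝ) 1) (hbe : be ∈ Icc (0 : ℝ) 1)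
    (hu : ∀ x, IsVersion (p x) (uu x)) (hv : ∀ x, HasSpaceGrad (uu x) (vv x))
    (hV : ∀ x, ∫ z, vv x z ^ 2 ≤ V) (hJ : ∀ x H, IsCmn 1 1 T H → Jhat a al be hT H (p x) ≤ q) :
    ∃ π : CadlagPath T MeasSpace, Continuous π.toFun ∧ (∀ t, π t ∈ AbsCont) ∧
      (∀ t, Tendsto (fun x => p x t) F (𝓝 (π t))) ∧ Tendsto p F (𝓝 π) ∧
      ∀ f : Om → ℝ, Continuous f → ∀ C, (∀ y, |f y| ≤ C) → ∀ ε > 0, ∀ᶠ x in F, ∀ t,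
        |∫ y, f y ∂((p x t).1 : Measure Om) - ∫ y, f y ∂((π t).1 : Measure Om)| ≤ ε := by
  have hpt : ∀ t, ∃ μ ∈ AbsCont, Tendsto (fun x => p x t) F (𝓝 μ) := fun t =>
    isCompact_iff_ultrafilter_le_nhds'.1 isCompact_absCont (F.map fun x => p x t) (by
      rw [Ultrafilter.mem_map]
      exact Filter.univ_mem' fun x => (hu x).mem_absCont t)
  choose π₀ hπ₀ hlim using hpt
  have hmod : ∀ f : Om → ℝ, Integrable f → ∀ ε > 0, ∃ δ > 0, ∀ x, ∀ s t : Icc (0 : ℝ) T,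
      dist t s < δ →
      |∫ y, f y ∂((p x t).1 : Measure Om) - ∫ y, f y ∂((p x s).1 : Measure Om)| ≤ ε := by
    intro f hf ε hε
    obtain ⟨δ, hδ, h⟩ := exists_equicontinuity (V := V) (q := q) (a := a) (hT := hT) hal hbe hf hε
    exact ⟨δ, hδ, fun x s t hst => h (p x) _ _ (hu x) (hv x) (hV x) (hJ x) s t hst⟩
  have hcont : Continuous π₀ := by
    refine continuous_of_forall_integral fun f => Metric.continuous_iff.2 fun s ε hε => ?_
    obtain ⟨δ, hδ, h⟩ := hmod f (integrable_boundedContinuous f) (ε / 2) (half_pos hε)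
    refine ⟨δ, hδ, fun t hts => ?_⟩
    have hc := continuous_integral_bounded f.continuous f.norm_coe_le_norm
    rw [Real.dist_eq]
    refine (le_of_tendsto (((hc.tendsto _).comp (hlim t)).sub
      ((hc.tendsto _).comp (hlim s))).abs (Eventually.of_forall fun x => h x s t hts)).trans_lt
      (half_lt_self hε)
  have hunif : ∀ f : Om → ℝ, Continuous f → ∀ C, (∀ y, |f y| ≤ C) → ∀ ε > 0, ∀ᶠ x in F, ∀ t,
        |∫ y, f y ∂((p x t).1 : Measure Om) - ∫ y, f y ∂((π₀ t).1 : Measure Om)| ≤ ε := by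
    intro f hf C hC ε hε
    exact eventually_forall_abs_sub_le (F := (F : Filter X))
      (g := fun x t => ∫ y, f y ∂((p x t).1 : Measure Om))
      (fun t => ((continuous_integral_bounded hf hC).tendsto _).comp (hlim t))
      (hmod f (integrable_of_continuous_bounded hf hC)) hε
  refine ⟨CadlagPath.ofContinuous π₀ hcont, hcont, hπ₀, hlim, ?_, hunif⟩
  refine CadlagPath.tendsto_of_uniform (tendsto_uniformity_measSpace fun f => ?_)
  refine (tendsto_prod_top_iff (g := fun x t => ∫ y, (f y : ℝ) ∂((π₀ t).1 : Measure Om) -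
    ∫ y, (f y : ℝ) ∂((p x t).1 : Measure Om))).2 fun ε hε => ?_
  have hC : ∀ y, |(f y : ℝ)| ≤ dist f 0 := fun y => by
    have := BoundedContinuousFunction.dist_coe_le_dist (f := f) (g := 0) y
    rw [NNReal.dist_eq] at this
    simpa using this
  filter_upwards [hunif (fun y => (f y : ℝ)) (NNReal.continuous_coe.comp f.continuous) _ hC ε hε] with x hx t
  rw [abs_sub_comm]
  exact hx t

end Limit

theorem HasSpaceGrad.integral_test {π : CadlagPath T MeasSpace} {u v : Icc (0 : ℝ) T × Om → ℝ}
    (hu : IsVersion π u) (hv : HasSpaceGrad u v) {θ : ℝ → ℝ} (hθ : Continuous θ) {φ : ℝ → ℝ}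
    (hφ : φ ∈ testFun) :
    ∫ p : Icc (0 : ℝ) T × Om, u p * (θ p.1 * deriv φ p.2) =
        - ∫ p : Icc (0 : ℝ) T × Om, v p * (θ p.1 * φ p.2) := by
  have hφc : Continuous φ := hφ.1.continuous
  have hφd : Continuous (deriv φ) := hφ.1.continuous_deriv (by simp)
  have i1 := integrable_mul_rect hu.integrable (F := fun p => θ p.1 * deriv φ p.2)
    (by fun_prop : Continuous _).continuousOn
  have i2 := integrable_mul_rect (hv.memLp.integrable one_le_two) (F := fun p => θ p.1 * φ p.2)
    (by fun_prop : Continuous _).continuousOn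
  rw [← integral_iterated i1, ← integral_iterated i2, ← integral_neg]
  apply integral_congr_ae
  filter_upwards [hv.ae_grad] with t ht
  have h := ht.2 φ hφ.1 hφ.2.1 hφ.2.2
  have e1 : ∫ x : Om, u (t, x) * (θ t * deriv φ x) = θ t * ∫ x : Om, u (t, x) * deriv φ x := by
    rw [← integral_const_mul]; congr 1; ext x; ring
  have e2 : ∫ x : Om, v (t, x) * (θ t * φ x) = θ t * ∫ x : Om, v (t, x) * φ x := by
    rw [← integral_const_mul]; congr 1; ext x; ring
  rw [e1, e2, h]; ring

/-- The mollification of a trajectory with bounded gradient is close to it. -/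
theorem integral_sq_integralOp_sub_le {π : CadlagPath T MeasSpace} {u v : Icc (0 : ℝ) T × Om → ℝ}
    {ρ : ℝ → ℝ} {δ : ℝ} (hu : IsVersion π u) (hv : HasSpaceGrad u v) (hπ : Continuous π.toFun)
    (hm : IsMollifier ρ δ) :
    MemLp (fun p : Icc (0 : ℝ) T × Om => integralOp (refl ρ) (fun y => u (p.1, y)) p.2 - u p) 2 volume ∧
    ∫ p : Icc (0 : ℝ) T × Om, (integralOp (refl ρ) (fun y => u (p.1, y)) p.2 - u p) ^ 2 ≤
      2 * δ * ∫ p, v p ^ 2 := by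
  have hmem : MemLp (fun p : Icc (0 : ℝ) T × Om =>
      integralOp (refl ρ) (fun y => u (p.1, y)) p.2 - u p) 2 volume := by
    refine MemLp_two_of_bound (C := 1) ?_ fun p => ?_
    · exact ((continuous_integralOp_path hu hπ hm).comp (by fun_prop :
        Continuous fun p : Icc (0 : ℝ) T × Om => (p.1, (p.2 : ℝ)))).aestronglyMeasurable.sub
        hu.measurable.aestronglyMeasurable
    · have h1 := integralOp_refl_mem hm (hu.integrable_slice p.1) (fun y => hu.mem_Icc _) p.2
      have h2 := hu.mem_Icc p
      rw [abs_le]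
      constructor <;> linarith [h1.1, h1.2, h2.1, h2.2]
  refine ⟨hmem, ?_⟩
  have hi := hmem.integrable_sq
  have hvi : Integrable fun t : Icc (0 : ℝ) T => ∫ x, v (t, x) ^ 2 :=
    (show Integrable (fun p => v p ^ 2) (volume.prod volume) from
      hv.memLp.integrable_sq).integral_prod_left
  have hi' : Integrable fun t : Icc (0 : ℝ) T =>
      ∫ x : Om, (integralOp (refl ρ) (fun y => u (t, y)) x - u (t, x)) ^ 2 := hi.integral_prod_left
  rw [← integral_iterated hi, ← integral_iterated hv.memLp.integrable_sq, ← integral_const_mul]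
  refine integral_mono_ae hi' (hvi.const_mul _) ?_
  filter_upwards [hv.ae_exists_isContVersion hu.measurable hu.abs_le_one] with t ⟨U, hU⟩
  have hW0 : 0 ≤ ∫ x, v (t, x) ^ 2 := integral_nonneg fun x => sq_nonneg _
  have := norm_integral_le_of_norm_le_const (μ := (volume : Measure Om))
    (f := fun x : Om => (integralOp (refl ρ) (fun y => u (t, y)) x - u (t, x)) ^ 2)
    (C := δ * ∫ x, v (t, x) ^ 2) (by
      filter_upwards [hU.ae_eq] with x hx
      have h1 := abs_integralOp_refl_sub_le hm (hu.integrable_slice t) hU (Ioo_subset_Icc_self x.2)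
      rw [← hx] at h1
      rw [Real.norm_of_nonneg (sq_nonneg _), ← sq_abs]
      calc _ ≤ (√δ * √(∫ x, v (t, x) ^ 2)) ^ 2 := by gcongr
        _ = _ := by rw [mul_pow, Real.sq_sqrt hm.pos.le, Real.sq_sqrt hW0])
  rw [volume_real_Om] at this
  refine (le_abs_self _).trans (this.trans_eq ?_)
  ring

end

/-! ### Convergence of gradients and densities -/

section

variable {T : ℝ}

section Limit

variable {X : Type*} {F : Ultrafilter X} {p : X → CadlagPath T MeasSpace} {π : CadlagPath T MeasSpace}
  {uu vv : X → Icc (0 : ℝ) T × Om → ℝ} {u v : Icc (0 : ℝ) T × Om → ℝ} {V : ℝ}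

theorem tendsto_integral_prod_test (hT : 0 < T) (hu : ∀ x, IsVersion (p x) (uu x))
    (hu' : IsVersion π u)
    (hunif : ∀ f : Om → ℝ, Continuous f → ∀ C, (∀ y, |f y| ≤ C) → ∀ ε > 0, ∀ᶠ x in F, ∀ t,
        |∫ y, f y ∂((p x t).1 : Measure Om) - ∫ y, f y ∂((π t).1 : Measure Om)| ≤ ε)
    {θ ψ : ℝ → ℝ} (hθ : Continuous θ) (hψ : Continuous ψ) :
    Tendsto (fun x => ∫ z : Icc (0 : ℝ) T × Om, uu x z * (θ z.1 * ψ z.2)) F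
      (𝓝 (∫ z : Icc (0 : ℝ) T × Om, u z * (θ z.1 * ψ z.2))) := by
  obtain ⟨M, hM⟩ := isCompact_Icc.exists_bound_of_continuousOn (s := Icc (0 : ℝ) T) hθ.continuousOn
  obtain ⟨C, hC⟩ := isCompact_Icc.exists_bound_of_continuousOn (s := Icc (-1 : ℝ) 1) hψ.continuousOn
  have hM0 : 0 ≤ M := (norm_nonneg _).trans (hM 0 ⟨le_rfl, hT.le⟩)
  have hi : ∀ {w : Icc (0 : ℝ) T × Om → ℝ} {ϖ : CadlagPath T MeasSpace}, IsVersion ϖ w →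
      Integrable fun z : Icc (0 : ℝ) T × Om => w z * (θ z.1 * ψ z.2) := fun h =>
    integrable_mul_rect h.integrable (F := fun z => θ z.1 * ψ z.2)
      (by fun_prop : Continuous _).continuousOn
  have he : ∀ {w : Icc (0 : ℝ) T × Om → ℝ} {ϖ : CadlagPath T MeasSpace}, IsVersion ϖ w →
      ∀ t : Icc (0 : ℝ) T, ∫ x : Om, w (t, x) * (θ t * ψ x) =
        θ t * ∫ x : Om, ψ x ∂((ϖ t).1 : Measure Om) := by
    intro w ϖ h t
    rw [h.integral_eq, ← integral_const_mul]
    congr 1; ext x; ring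
  rw [Metric.tendsto_nhds]
  intro ε hε
  filter_upwards [hunif (fun x => ψ x) (hψ.comp continuous_subtype_val) C
    (fun y => hC y (Ioo_subset_Icc_self y.2)) (ε / (2 * (M * T + 1))) (by positivity)] with x hx
  rw [Real.dist_eq, ← integral_iterated (hi (hu x)), ← integral_iterated (hi hu'),
    ← integral_sub (hi (hu x)).integral_prod_left (hi hu').integral_prod_left]
  have := norm_integral_le_of_norm_le_const (μ := (volume : Measure (Icc (0 : ℝ) T)))
    (f := fun t : Icc (0 : ℝ) T => (∫ y : Om, uu x (t, y) * (θ t * ψ y)) -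
      ∫ y : Om, u (t, y) * (θ t * ψ y)) (C := M * (ε / (2 * (M * T + 1)))) (ae_of_all _ fun t => by
      rw [he (hu x), he hu', ← mul_sub, norm_mul]
      exact mul_le_mul (hM t t.2) (hx t) (norm_nonneg _) hM0)
  rw [volume_real_Icc hT.le] at this
  refine this.trans_lt ?_
  have e : M * (ε / (2 * (M * T + 1))) * T = ε / 2 * (M * T / (M * T + 1)) := by field_simp
  have h2 : M * T / (M * T + 1) ≤ 1 := by
    rw [div_le_one (by positivity)]; linarith
  rw [e]
  nlinarith

/-- The gradients converge weakly to a gradient of the limit. -/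
theorem exists_limit_grad (hT : 0 < T) (hu : ∀ x, IsVersion (p x) (uu x))
    (hv : ∀ x, HasSpaceGrad (uu x) (vv x)) (hV : ∀ x, ∫ z, vv x z ^ 2 ≤ V)
    (hu' : IsVersion π u)
    (hunif : ∀ f : Om → ℝ, Continuous f → ∀ C, (∀ y, |f y| ≤ C) → ∀ ε > 0, ∀ᶠ x in F, ∀ t,
        |∫ y, f y ∂((p x t).1 : Measure Om) - ∫ y, f y ∂((π t).1 : Measure Om)| ≤ ε) :
    ∃ v, HasSpaceGrad u v ∧ ∫ z, v z ^ 2 ≤ V ∧ ∀ h, MemLp h 2 volume →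
      Tendsto (fun x => ∫ z, vv x z * h z) F (𝓝 (∫ z, v z * h z)) := by
  obtain ⟨v, hvm, hvL, hvV, hlim⟩ := exists_tendsto_integral_mul F (fun x => (hv x).memLp) hV
  refine ⟨v, hasSpaceGrad_of_test hu'.measurable hu'.abs_le_one hvm hvL fun θ hθ φ hφ => ?_, hvV, hlim⟩
  have hφc : Continuous φ := hφ.1.continuous
  have hφd : Continuous (deriv φ) := hφ.1.continuous_deriv (by simp)
  have hθc := hθ.continuous
  have t1 := tendsto_integral_prod_test hT hu hu' hunif hθc hφd
  have t2 := (hlim (fun z => θ z.1 * φ z.2) (memLp_rect (F := fun z => θ z.1 * φ z.2)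
    (by fun_prop : Continuous _).continuousOn)).neg
  refine tendsto_nhds_unique t1 (t2.congr fun x => ?_)
  exact ((hv x).integral_test (hu x) hθc hφ).symm

/-- Uniformity in `t` at a fixed `y` is the hypothesis applied to `refl ρ y`. Uniformity in `y`
follows from a Lipschitz constant depending only on `ρ`; the two are combined by running
`eventually_forall_abs_sub_le` in `y` along the product of `F` with `⊤` on times. -/
theorem eventually_abs_integralOp_sub_le (hT : 0 < T) (hu : ∀ x, IsVersion (p x) (uu x))
    (hu' : IsVersion π u)
    (hunif : ∀ f : Om → ℝ, Continuous f → ∀ C, (∀ y, |f y| ≤ C) → ∀ ε > 0, ∀ᶠ x in F, ∀ t,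
        |∫ y, f y ∂((p x t).1 : Measure Om) - ∫ y, f y ∂((π t).1 : Measure Om)| ≤ ε)
    {ρ : ℝ → ℝ} {δ : ℝ} (hm : IsMollifier ρ δ) {ε : ℝ} (hε : 0 < ε) :
    ∀ᶠ x in F, ∀ t, ∀ y ∈ Icc (-1 : ℝ) 1, |integralOp (refl ρ) (fun z => uu x (t, z)) y -
      integralOp (refl ρ) (fun z => u (t, z)) y| ≤ ε := by
  have : Nonempty (Icc (0 : ℝ) T) := ⟨startTime hT⟩
  obtain ⟨C, hC0, h1, -, h2⟩ := hm.exists_refl_bound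
  have he : ∀ {w : Icc (0 : ℝ) T × Om → ℝ} {ϖ : CadlagPath T MeasSpace}, IsVersion ϖ w →
      ∀ (t : Icc (0 : ℝ) T) (y : ℝ), integralOp (refl ρ) (fun z => w (t, z)) y =
        ∫ x : Om, refl ρ y x ∂((ϖ t).1 : Measure Om) := by
    intro w ϖ h t y
    rw [h.integral_eq, integralOp]
    congr 1; ext x; ring
  have key := eventually_forall_abs_sub_le (F := (F : Filter X) ×ˢ (⊤ : Filter (Icc (0 : ℝ) T)))
    (Y := Icc (-1 : ℝ) 1) (g' := fun _ => 0)
    (g := fun z y => integralOp (refl ρ) (fun x => uu z.1 (z.2, x)) y -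
      integralOp (refl ρ) (fun x => u (z.2, x)) y) (fun y => by
        refine (tendsto_prod_top_iff (g := fun x t => integralOp (refl ρ) (fun z => uu x (t, z)) y -
          integralOp (refl ρ) (fun z => u (t, z)) y)).2 fun η hη => ?_
        filter_upwards [hunif (fun x => refl ρ y x) (hm.continuous_refl.comp
          (by fun_prop : Continuous fun x : Om => ((y : ℝ), (x : ℝ)))) C (fun x => h1 _ _) η hη] with x hx t
        rw [he (hu x), he hu']
        exact hx t) (fun η hη => by
        refine ⟨η / (2 * (C * 1 * 2 + 1)), by positivity, fun z s t hst => ?_⟩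
        have k1 := ((hu z.1).lipschitzWith_integralOp hm hC0 h2 z.2).dist_le_mul t s
        have k2 := (hu'.lipschitzWith_integralOp hm hC0 h2 z.2).dist_le_mul t s
        rw [Real.dist_eq, Real.coe_toNNReal _ (by positivity)] at k1 k2
        have k3 : C * 1 * 2 * dist (t : ℝ) s ≤ η / 2 := by
          have : dist (t : ℝ) s < η / (2 * (C * 1 * 2 + 1)) := hst
          calc _ ≤ (C * 1 * 2 + 1) * (η / (2 * (C * 1 * 2 + 1))) := by
                have := this.le
                gcongr
                linarith
            _ = _ := by field_simp
        have k4 := abs_le.1 (k1.trans k3)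
        have k5 := abs_le.1 (k2.trans k3)
        rw [abs_le]
        constructor <;> linarith [k4.1, k4.2, k5.1, k5.2]) hε
  have := mem_prod_top.1 key
  filter_upwards [this] with x hx t y hy
  have := hx t ⟨y, hy⟩
  simpa using this

/-- The densities converge strongly. -/
theorem tendsto_integral_sq_sub (hT : 0 < T) (hp : ∀ x, Continuous (p x).toFun)
    (hπ : Continuous π.toFun) (hu : ∀ x, IsVersion (p x) (uu x))
    (hv : ∀ x, HasSpaceGrad (uu x) (vv x)) (hV : ∀ x, ∫ z, vv x z ^ 2 ≤ V)
    (hu' : IsVersion π u) (hv' : HasSpaceGrad u v) (hV' : ∫ z, v z ^ 2 ≤ V)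
    (hunif : ∀ f : Om → ℝ, Continuous f → ∀ C, (∀ y, |f y| ≤ C) → ∀ ε > 0, ∀ᶠ x in F, ∀ t,
        |∫ y, f y ∂((p x t).1 : Measure Om) - ∫ y, f y ∂((π t).1 : Measure Om)| ≤ ε) :
    Tendsto (fun x => ∫ z, (uu x z - u z) ^ 2) F (𝓝 0) := by
  have hV0 : 0 ≤ V := (integral_nonneg fun z => sq_nonneg _).trans hV'
  set M := (volume : Measure (Icc (0 : ℝ) T × Om)).real univ with hM
  have hM0 : 0 ≤ M := measureReal_nonneg
  rw [Metric.tendsto_nhds]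
  intro ε hε
  -- The two mollification errors are at most `2 V / (n + 2)` each, and the three-term split
  -- multiplies them by `3`: in total `12 V / (n + 2)`, required to be below `ε / 2`. The middle
  -- term will contribute at most `ε / 4`.
  have t0 : Tendsto (fun n : ℕ => 12 * (1 / ((n : ℝ) + 2)) * V) atTop (𝓝 0) := by
    simpa using (tendsto_inv_nat_add_two.const_mul 12).mul_const V
  obtain ⟨n, hn⟩ := (t0.eventually_lt_const (half_pos hε)).exists
  have hm := isMollifier_moll n
  have hη : 0 < √(ε / (12 * (M + 1))) := by positivity
  filter_upwards [eventually_abs_integralOp_sub_le hT hu hu' hunif hm hη] with x hx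
  rw [Real.dist_eq, sub_zero, abs_of_nonneg (integral_nonneg fun z => sq_nonneg _)]
  obtain ⟨m1, c1⟩ := integral_sq_integralOp_sub_le (hu x) (hv x) (hp x) hm
  obtain ⟨m2, c2⟩ := integral_sq_integralOp_sub_le hu' hv' hπ hm
  have hKm : ∀ {w : Icc (0 : ℝ) T × Om → ℝ} {ϖ : CadlagPath T MeasSpace}, IsVersion ϖ w →
      Continuous ϖ.toFun → AEStronglyMeasurable (fun z : Icc (0 : ℝ) T × Om =>
        integralOp (refl (moll n)) (fun y => w (z.1, y)) z.2) := fun h hc =>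
    ((continuous_integralOp_path h hc hm).comp (by fun_prop :
        Continuous fun p : Icc (0 : ℝ) T × Om => (p.1, (p.2 : ℝ)))).aestronglyMeasurable
  have hb : ∀ z : Icc (0 : ℝ) T × Om, |integralOp (refl (moll n)) (fun y => uu x (z.1, y)) z.2 -
      integralOp (refl (moll n)) (fun y => u (z.1, y)) z.2| ≤ √(ε / (12 * (M + 1))) := fun z =>
    hx z.1 z.2 (Ioo_subset_Icc_self z.2.2)
  have m3 : MemLp (fun z : Icc (0 : ℝ) T × Om => integralOp (refl (moll n)) (fun y => uu x (z.1, y)) z.2 -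
      integralOp (refl (moll n)) (fun y => u (z.1, y)) z.2) 2 volume :=
    MemLp_two_of_bound ((hKm (hu x) (hp x)).sub (hKm hu' hπ)) hb
  have key := integral_add_add_sq_le m1.neg m3 m2
  have c3 := norm_integral_le_of_norm_le_const (μ := (volume : Measure (Icc (0 : ℝ) T × Om)))
    (f := fun z => (integralOp (refl (moll n)) (fun y => uu x (z.1, y)) z.2 -
      integralOp (refl (moll n)) (fun y => u (z.1, y)) z.2) ^ 2) (C := ε / (12 * (M + 1)))
    (ae_of_all _ fun z => by
      rw [Real.norm_of_nonneg (sq_nonneg _), ← sq_abs,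
        ← Real.sq_sqrt (show 0 ≤ ε / (12 * (M + 1)) by positivity)]
      have := hb z
      gcongr)
  have c3' := (le_abs_self _).trans c3
  rw [← hM] at c3'
  have c4 : ε / (12 * (M + 1)) * M ≤ ε / 12 := by
    have e : ε / (12 * (M + 1)) * M = ε / 12 * (M / (M + 1)) := by field_simp
    have h2 : M / (M + 1) ≤ 1 := by
      rw [div_le_one (by positivity)]; linarith
    rw [e]
    nlinarith
  have e1 : ∫ z, (uu x z - u z) ^ 2 = ∫ z : Icc (0 : ℝ) T × Om,
      ((-fun z : Icc (0 : ℝ) T × Om => integralOp (refl (moll n)) (fun y => uu x (z.1, y)) z.2 - uu x z) z +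
      (integralOp (refl (moll n)) (fun y => uu x (z.1, y)) z.2 -
        integralOp (refl (moll n)) (fun y => u (z.1, y)) z.2) +
      (integralOp (refl (moll n)) (fun y => u (z.1, y)) z.2 - u z)) ^ 2 := by
    congr 1; ext z; simp only [Pi.neg_apply]; ring
  have e2 : ∫ z : Icc (0 : ℝ) T × Om,
      (-fun z : Icc (0 : ℝ) T × Om => integralOp (refl (moll n)) (fun y => uu x (z.1, y)) z.2 - uu x z) z ^ 2 =
      ∫ z : Icc (0 : ℝ) T × Om,
        (integralOp (refl (moll n)) (fun y => uu x (z.1, y)) z.2 - uu x z) ^ 2 := by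
    congr 1; ext z; simp only [Pi.neg_apply]; ring
  rw [e1]
  refine key.trans_lt ?_
  rw [e2]
  have hδ : 0 ≤ 2 * (1 / ((n : ℝ) + 2)) := by positivity
  have k1 := c1.trans (mul_le_mul_of_nonneg_left (hV x) hδ)
  have k2 := c2.trans (mul_le_mul_of_nonneg_left hV' hδ)
  linarith

end Limit

end

/-! ### Passage to the limit in the functionals -/

section

variable {T : ℝ}

theorem abs_chi_sub_le {r s : ℝ} (hr : r ∈ Icc (0 : ℝ) 1) (hs : s ∈ Icc (0 : ℝ) 1) :
    |chi r - chi s| ≤ 1 * |r - s| := by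
  have e : chi r - chi s = (1 - r - s) * (r - s) := by simp only [chi]; ring
  rw [e, abs_mul]
  gcongr
  rw [abs_le]
  constructor <;> linarith [hr.1, hr.2, hs.1, hs.2]

theorem abs_diffusivity_sub_le (a r s : ℝ) :
    |diffusivity a r - diffusivity a s| ≤ 2 * |a| * |r - s| := by
  have e : diffusivity a r - diffusivity a s = 2 * a * (r - s) := by simp only [diffusivity]; ring
  rw [e, abs_mul, abs_mul, abs_two]

theorem abs_mobility_sub_le (a : ℝ) {r s : ℝ} (hr : r ∈ Icc (0 : ℝ) 1) (hs : s ∈ Icc (0 : ℝ) 1) :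
    |mobility a r - mobility a s| ≤ (1 + 4 * |a|) * |r - s| := by
  have e : mobility a r - mobility a s = (chi r - chi s) * diffusivity a r +
    chi s * (diffusivity a r - diffusivity a s) := by simp only [mobility]; ring
  have h1 := mul_le_mul (abs_chi_sub_le hr hs) (abs_diffusivity_le a hr.1 hr.2) (abs_nonneg _)
    (by positivity)
  have h2 := mul_le_mul (abs_chi_le hs.1 hs.2) (abs_diffusivity_sub_le a r s) (abs_nonneg _)
    (by positivity)
  rw [e]
  refine (abs_add_le _ _).trans ?_
  rw [abs_mul, abs_mul]
  linarith

section Limit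

variable {X : Type*} {F : Ultrafilter X} {p : X → CadlagPath T MeasSpace} {π : CadlagPath T MeasSpace}
  {uu vv : X → Icc (0 : ℝ) T × Om → ℝ} {u v : Icc (0 : ℝ) T × Om → ℝ} {V : ℝ}

theorem memLp_comp_sub {ϖ : CadlagPath T MeasSpace} {w : Icc (0 : ℝ) T × Om → ℝ}
    (hw : IsVersion ϖ w) (hu' : IsVersion π u) {Φ : ℝ → ℝ} (hΦ : Continuous Φ) {L : ℝ}
    (hL : ∀ r ∈ Icc (0 : ℝ) 1, ∀ s ∈ Icc (0 : ℝ) 1, |Φ r - Φ s| ≤ L * |r - s|) :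
    MemLp (fun z => Φ (w z) - Φ (u z)) 2 volume ∧
      √(∫ z, (Φ (w z) - Φ (u z)) ^ 2) ≤ |L| * √(∫ z, (w z - u z) ^ 2) := by
  have m1 : MemLp (fun z => w z - u z) 2 volume :=
    MemLp_two_of_bound (C := 1 + 1) (hw.measurable.sub hu'.measurable).aestronglyMeasurable fun z =>
      (abs_sub _ _).trans (add_le_add (hw.abs_le_one z) (hu'.abs_le_one z))
  have hb : ∀ z, |Φ (w z) - Φ (u z)| ≤ |L| * |w z - u z| := fun z =>
    (hL _ (hw.mem_Icc z) _ (hu'.mem_Icc z)).trans (by gcongr; exact le_abs_self L)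
  have m2 : MemLp (fun z => Φ (w z) - Φ (u z)) 2 volume := by
    refine (m1.const_mul |L|).mono ((hΦ.measurable.comp hw.measurable).sub
      (hΦ.measurable.comp hu'.measurable)).aestronglyMeasurable (ae_of_all _ fun z => ?_)
    rw [norm_mul, Real.norm_eq_abs, Real.norm_eq_abs, Real.norm_eq_abs, abs_abs]
    exact hb z
  refine ⟨m2, ?_⟩
  rw [← Real.sqrt_sq (abs_nonneg L), ← Real.sqrt_mul (sq_nonneg _), ← integral_const_mul]
  refine Real.sqrt_le_sqrt (integral_mono m2.integrable_sq (m1.integrable_sq.const_mul _) fun z => ?_)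
  simp only
  rw [← sq_abs, ← sq_abs (w z - u z), ← mul_pow]
  exact pow_le_pow_left₀ (abs_nonneg _) (hb z) 2

theorem tendsto_integral_comp_mul (hu : ∀ x, IsVersion (p x) (uu x)) (hu' : IsVersion π u)
    (hs : Tendsto (fun x => ∫ z, (uu x z - u z) ^ 2) F (𝓝 0)) {Φ : ℝ → ℝ} (hΦ : Continuous Φ) {L : ℝ}
    (hL : ∀ r ∈ Icc (0 : ℝ) 1, ∀ s ∈ Icc (0 : ℝ) 1, |Φ r - Φ s| ≤ L * |r - s|) {G : ℝ × ℝ → ℝ}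
    (hG : ContinuousOn G (Icc 0 T ×ˢ Icc (-1 : ℝ) 1)) :
    Tendsto (fun x => ∫ z : Icc (0 : ℝ) T × Om, Φ (uu x z) * G (z.1, z.2)) F
      (𝓝 (∫ z : Icc (0 : ℝ) T × Om, Φ (u z) * G (z.1, z.2))) := by
  obtain ⟨C, hC⟩ := isCompact_Icc.exists_bound_of_continuousOn (s := Icc (0 : ℝ) 1) hΦ.continuousOn
  have hi : ∀ {w : Icc (0 : ℝ) T × Om → ℝ} {ϖ : CadlagPath T MeasSpace}, IsVersion ϖ w →
      Integrable fun z : Icc (0 : ℝ) T × Om => Φ (w z) * G (z.1, z.2) := fun h =>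
    integrable_mul_rect (Integrable.of_bound (hΦ.measurable.comp h.measurable).aestronglyMeasurable C
      (ae_of_all _ fun z => hC _ (h.mem_Icc z))) hG
  have t0 : Tendsto (fun x => |L| * √(∫ z, (uu x z - u z) ^ 2) *
      √(∫ z : Icc (0 : ℝ) T × Om, G (z.1, z.2) ^ 2)) F (𝓝 0) := by
    simpa using (hs.sqrt.const_mul |L|).mul_const (√(∫ z : Icc (0 : ℝ) T × Om, G (z.1, z.2) ^ 2))
  rw [tendsto_iff_norm_sub_tendsto_zero]
  refine squeeze_zero (fun x => norm_nonneg _) (fun x => ?_) t0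
  obtain ⟨m, c⟩ := memLp_comp_sub (hu x) hu' hΦ hL
  rw [← integral_sub (hi (hu x)) (hi hu'), Real.norm_eq_abs]
  simp only [← sub_mul]
  exact (abs_integral_mul_le m (memLp_rect hG)).trans (by gcongr)

/-- A product of strong and weak limits. With the limit coefficient `D(u)` weak convergence of the
gradients applies; the error from `D(uu x) - D(u)` is bounded by `√V` times the strong distance of
the densities, up to a constant. -/
theorem tendsto_integral_diffusivity_mul (a : ℝ) (hu : ∀ x, IsVersion (p x) (uu x))
    (hu' : IsVersion π u) (hv : ∀ x, HasSpaceGrad (uu x) (vv x)) (hV : ∀ x, ∫ z, vv x z ^ 2 ≤ V)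
    (hs : Tendsto (fun x => ∫ z, (uu x z - u z) ^ 2) F (𝓝 0))
    (hw : ∀ h, MemLp h 2 volume → Tendsto (fun x => ∫ z, vv x z * h z) F (𝓝 (∫ z, v z * h z)))
    {G : ℝ × ℝ → ℝ} (hG : ContinuousOn G (Icc 0 T ×ˢ Icc (-1 : ℝ) 1)) :
    Tendsto (fun x => ∫ z : Icc (0 : ℝ) T × Om, diffusivity a (uu x z) * vv x z * G (z.1, z.2)) F
      (𝓝 (∫ z : Icc (0 : ℝ) T × Om, diffusivity a (u z) * v z * G (z.1, z.2))) := by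
  obtain ⟨C, hC0, hC⟩ := exists_bound_rect hG
  have hGm := (continuous_rect hG).aestronglyMeasurable (μ := (volume : Measure (Icc (0 : ℝ) T × Om)))
  have hGb : ∀ z : Icc (0 : ℝ) T × Om, |G (z.1, z.2)| ≤ C := fun z =>
    hC _ z.1.2 _ (Ioo_subset_Icc_self z.2.2)
  have m0 : MemLp (fun z : Icc (0 : ℝ) T × Om => diffusivity a (u z) * G (z.1, z.2)) 2 volume :=
    (memLp_bdd_mul (((continuous_diffusivity a).measurable.comp
      hu'.measurable).aestronglyMeasurable) (ae_of_all _ fun z =>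
      abs_diffusivity_le a (hu'.nonneg z) (hu'.le_one z)) (memLp_rect hG)).1
  have t1 := hw _ m0
  have t2 : Tendsto (fun x => √V * (C * (|(2 * |a|)| * √(∫ z, (uu x z - u z) ^ 2)))) F (𝓝 0) := by
    simpa using ((hs.sqrt.const_mul (|(2 * |a|)|)).const_mul C).const_mul (√V)
  have t3 : Tendsto (fun x => ∫ z : Icc (0 : ℝ) T × Om, vv x z *
      (G (z.1, z.2) * (diffusivity a (uu x z) - diffusivity a (u z)))) F (𝓝 0) := by
    rw [tendsto_zero_iff_norm_tendsto_zero]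
    refine squeeze_zero (fun x => norm_nonneg _) (fun x => ?_) t2
    obtain ⟨m, c⟩ := memLp_comp_sub (hu x) hu' (continuous_diffusivity a)
      (fun r _ s _ => abs_diffusivity_sub_le a r s)
    obtain ⟨m', c'⟩ := memLp_bdd_mul hGm (ae_of_all _ hGb) m
    refine (abs_integral_mul_le (hv x).memLp m').trans ?_
    refine mul_le_mul (Real.sqrt_le_sqrt (hV x)) ?_ (Real.sqrt_nonneg _) (Real.sqrt_nonneg _)
    refine (Real.sqrt_le_sqrt c').trans ?_
    rw [Real.sqrt_mul (sq_nonneg _), Real.sqrt_sq hC0]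
    gcongr
  have t4 := t1.add t3
  have e0 : (∫ z : Icc (0 : ℝ) T × Om, v z * (diffusivity a (u z) * G (z.1, z.2))) + 0 =
      ∫ z : Icc (0 : ℝ) T × Om, diffusivity a (u z) * v z * G (z.1, z.2) := by
    rw [add_zero]; congr 1; ext z; ring
  rw [e0] at t4
  refine t4.congr fun x => ?_
  obtain ⟨m, c⟩ := memLp_comp_sub (hu x) hu' (continuous_diffusivity a)
      (fun r _ s _ => abs_diffusivity_sub_le a r s)
  have i1 : Integrable fun z : Icc (0 : ℝ) T × Om => vv x z * (diffusivity a (u z) * G (z.1, z.2)) :=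
    (hv x).memLp.integrable_mul m0
  have i2 : Integrable fun z : Icc (0 : ℝ) T × Om => vv x z *
      (G (z.1, z.2) * (diffusivity a (uu x z) - diffusivity a (u z))) :=
    (hv x).memLp.integrable_mul (memLp_bdd_mul hGm (ae_of_all _ hGb) m).1
  rw [← integral_add i1 i2]
  congr 1; ext z; ring

theorem abs_sub_le_one_mul (r : ℝ) (_ : r ∈ Icc (0 : ℝ) 1) (s : ℝ) (_ : s ∈ Icc (0 : ℝ) 1) :
    |r - s| ≤ 1 * |r - s| := (one_mul _).ge

theorem tendsto_energyFun (hu : ∀ x, IsVersion (p x) (uu x)) (hu' : IsVersion π u)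
    (hs : Tendsto (fun x => ∫ z, (uu x z - u z) ^ 2) F (𝓝 0)) {G : ℝ → ℝ → ℝ} (hG : IsCmn 1 2 T G) :
    Tendsto (fun x => energyFun (p x) G) F (𝓝 (energyFun π G)) := by
  simp only [energyFun_eq (hu _) hG, energyFun_eq hu' hG]
  exact ((tendsto_integral_comp_mul hu hu' hs continuous_id (L := 1) abs_sub_le_one_mul
    (hG.continuousOn_dx one_le_two)).const_mul 2).sub
    (tendsto_integral_comp_mul hu hu' hs continuous_chi (fun r hr s hs => abs_chi_sub_le hr hs)
      (G := fun q => G q.1 q.2 ^ 2) (hG.continuousOn.pow 2))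

theorem continuous_pairing {f : ℝ → ℝ} (hf : ContinuousOn f (Icc (-1) 1)) :
    Continuous fun μ : MeasSpace => pairing μ f := by
  obtain ⟨C, hC⟩ := isCompact_Icc.exists_bound_of_continuousOn hf
  exact continuous_integral_bounded (φ := fun x : Om => f x)
    (hf.comp_continuous continuous_subtype_val fun x => Ioo_subset_Icc_self x.2)
    fun x => hC x (Ioo_subset_Icc_self x.2)

/-- The end-point pairings use convergence at fixed times, the terms in the density alone use strong
convergence, and the drift a weak-strong product. The boundary term is handled by `integral_bdry`,
as an affine functional of density and gradient. -/
theorem tendsto_Jhat (a al be : ℝ) (hT : 0 < T) (hu : ∀ x, IsVersion (p x) (uu x))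
    (hu' : IsVersion π u) (hv : ∀ x, HasSpaceGrad (uu x) (vv x)) (hv' : HasSpaceGrad u v)
    (hV : ∀ x, ∫ z, vv x z ^ 2 ≤ V) (hpt : ∀ t, Tendsto (fun x => p x t) F (𝓝 (π t)))
    (hs : Tendsto (fun x => ∫ z, (uu x z - u z) ^ 2) F (𝓝 0))
    (hw : ∀ h, MemLp h 2 volume → Tendsto (fun x => ∫ z, vv x z * h z) F (𝓝 (∫ z, v z * h z)))
    {H : ℝ → ℝ → ℝ} (hH : IsCmn 1 1 T H) :
    Tendsto (fun x => Jhat a al be hT H (p x)) F (𝓝 (Jhat a al be hT H π)) := by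
  have hslice : ∀ {x : ℝ}, x ∈ Icc (-1 : ℝ) 1 → ContinuousOn (fun t => H t x) (Icc 0 T) := fun hx =>
    hH.continuousOn.comp (by fun_prop : Continuous fun t : ℝ => (t, _)).continuousOn
      fun t ht => ⟨ht, hx⟩
  obtain ⟨A, B, c, hA, hB, h⟩ := integral_bdry al be (hslice (x := 1) (by norm_num))
    (hslice (x := -1) (by norm_num))
  have e1 := fun x => (h (uu x) (vv x) (hu x).integrable ((hv x).memLp.integrable one_le_two)).2
  have e2 := (h u v hu'.integrable (hv'.memLp.integrable one_le_two)).2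
  simp only [Jhat_eq al be a hT (hu _) (hv _) hH, Jhat_eq al be a hT hu' hv' hH,
    L0_eq hT (hu _) hH, L0_eq hT hu' hH, e1, e2]
  refine ((((?_ : Tendsto _ _ _).sub ?_).sub ?_).add ?_).sub ?_ |>.sub (((?_ : Tendsto _ _ _).add ?_).add
    tendsto_const_nhds)
  · exact ((continuous_pairing (hH.contDiffOn_slice le_rfl ⟨hT.le, le_rfl⟩).continuousOn).tendsto _).comp
      (hpt (endTime hT))
  · exact ((continuous_pairing (hH.contDiffOn_slice le_rfl ⟨le_rfl, hT.le⟩).continuousOn).tendsto _).comp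
      (hpt (startTime hT))
  · exact tendsto_integral_comp_mul hu hu' hs continuous_id (L := 1) abs_sub_le_one_mul
      (hH.continuousOn_dt le_rfl)
  · exact tendsto_integral_diffusivity_mul a hu hu' hv hV hs hw (hH.continuousOn_dx le_rfl)
  · exact tendsto_integral_comp_mul hu hu' hs (continuous_mobility a)
      (fun r hr s hs => abs_mobility_sub_le a hr hs)
      (G := fun q => dx H q.1 q.2 ^ 2) ((hH.continuousOn_dx le_rfl).pow 2)
  · exact tendsto_integral_comp_mul hu hu' hs continuous_id (L := 1) abs_sub_le_one_mul hA
  · exact hw _ (memLp_rect hB)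

end Limit

/-! ### Compactness of the level sets -/

/-- Common source of compactness and closedness. Continuity of the limit is recorded because it
makes the limit unique. -/
theorem exists_limit_of_rate_le {a al be q : ℝ} {hT : 0 < T} (ha : -(1 / 2) < a)
    (hal : al ∈ Icc (0 : ℝ) 1) (hbe : be ∈ Icc (0 : ℝ) 1) {F : Ultrafilter (CadlagPath T MeasSpace)}
    (hF : {π | rate a al be hT π ≤ (q : EReal)} ∈ F) :
    ∃ π, rate a al be hT π ≤ (q : EReal) ∧ Continuous π.toFun ∧ ↑F ≤ 𝓝 π := by
  let X := {π | rate a al be hT π ≤ (q : EReal)}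
  let F' : Ultrafilter X := F.comap Subtype.val_injective (by rw [Subtype.range_coe]; exact hF)
  have hF' : Filter.map Subtype.val (F' : Filter X) = F :=
    Filter.map_comap_of_mem (by rw [Subtype.range_coe]; exact hF)
  let p : X → CadlagPath T MeasSpace := Subtype.val
  have hX := fun x : X => rate_le_iff.1 x.2
  choose uu hu using fun x : X => exists_isVersion (hX x).1.1
  choose vv hv using fun x : X => (hX x).1.exists_hasSpaceGrad hT (hu x)
  have hV := fun x : X => integral_sq_grad_le ha hal hbe (hu x) (hv x) (hX x).2
  have hp := fun x : X => continuous_path hal hbe (hu x) (hv x) (hX x).2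
  obtain ⟨π, hπ, hπA, hpt, hlim, hunif⟩ := exists_limit_path (F := F') hal hbe hu hv hV
    fun x => (hX x).2
  obtain ⟨u, hu'⟩ := exists_isVersion hπA
  obtain ⟨v, hv', hV', hw⟩ := exists_limit_grad hT hu hv hV hu' hunif
  have hs := tendsto_integral_sq_sub hT hp hπ hu hv hV hu' hv' hV' hunif
  refine ⟨π, rate_le_iff.2 ⟨⟨hπA, ?_⟩, fun H hH => ?_⟩, hπ, ?_⟩
  -- The energy of the limit is finite thanks to the bound of `energyFun_le`, which is uniform on
  -- the level set; finiteness of each single energy would not suffice.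
  · refine lt_of_le_of_lt (b := ((4 * (q + 8 + 4 * T) / min 1 (1 + 2 * a) : ℝ) : EReal))
      (iSup₂_le fun G hG => ?_) (EReal.coe_lt_top _)
    exact EReal.coe_le_coe_iff.2 (le_of_tendsto (tendsto_energyFun hu hu' hs hG.1)
      (Eventually.of_forall fun x => energyFun_le ha hal hbe (hu x) (hv x) (hX x).2 hG.1 hG.2))
  · exact le_of_tendsto (tendsto_Jhat a al be hT hu hu' hv hv' hV hpt hs hw hH)
      (Eventually.of_forall fun x => (hX x).2 H hH)
  · rw [← hF']
    exact hlim

theorem isCompact_rate_le {a al be : ℝ} (hT : 0 < T) (ha : -(1 / 2) < a)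
    (hal : al ∈ Icc (0 : ℝ) 1) (hbe : be ∈ Icc (0 : ℝ) 1) (q : ℝ) :
    IsCompact {π | rate a al be hT π ≤ (q : EReal)} := by
  refine isCompact_iff_ultrafilter_le_nhds'.2 fun F hF => ?_
  obtain ⟨π, h1, -, h2⟩ := exists_limit_of_rate_le ha hal hbe hF
  exact ⟨π, h1, h2⟩

end

/-! ### Closedness, lower semicontinuity and the initial condition -/

section

variable {T : ℝ}

/-- Continuity of `π` turns a small change of time into a small change of value, so `π` and `π'` are
inseparable at every time, hence equal as `𝓜` is separated. -/
theorem eq_of_mem_skorohodEntourage {π π' : CadlagPath T MeasSpace} (hπ : Continuous π.toFun)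
    (h : ∀ V ∈ 𝓤 MeasSpace, ∀ ε > 0, (π, π') ∈ skorohodEntourage T V ε) : π = π' := by
  have key : ∀ s, π s = π' s := by
    intro s
    refine Inseparable.eq (inseparable_iff_ker_uniformity.2 (Filter.mem_ker.2 fun V hV => ?_))
    obtain ⟨W, hW, hWV⟩ := comp_mem_uniformity_sets hV
    obtain ⟨ε, hε, hball⟩ := Metric.mem_nhds_iff.1 (hπ.continuousAt (UniformSpace.ball_mem_nhds (π s) hW))
    obtain ⟨φ, hφ⟩ := h W hW ε hε
    obtain ⟨h1, h2⟩ := hφ (φ.symm s)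
    rw [OrderIso.apply_symm_apply, abs_sub_comm] at h1
    rw [OrderIso.apply_symm_apply] at h2
    exact hWV ⟨π (φ.symm s), hball h1, h2⟩
  cases π; cases π'
  congr
  exact funext key

/-- In a uniform space two limits of the same ultrafilter are inseparable; as one of them is
continuous, they coincide. -/
theorem eq_of_ultrafilter_le_nhds {π π' : CadlagPath T MeasSpace} (hπ : Continuous π.toFun)
    {F : Ultrafilter (CadlagPath T MeasSpace)} (h : ↑F ≤ 𝓝 π) (h' : ↑F ≤ 𝓝 π') : π = π' := by
  have hi : Inseparable π π' := tendsto_nhds_unique_inseparable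
    (tendsto_id'.2 h) (tendsto_id'.2 h')
  refine eq_of_mem_skorohodEntourage hπ fun V hV ε hε => ?_
  exact Filter.mem_ker.1 (inseparable_iff_ker_uniformity.1 hi) _
    ((hasBasis_uniformity_cadlagPath T MeasSpace).mem_of_mem (i := (V, ε)) ⟨hV, hε⟩)

theorem isClosed_rate_le {a al be : ℝ} (hT : 0 < T) (ha : -(1 / 2) < a)
    (hal : al ∈ Icc (0 : ℝ) 1) (hbe : be ∈ Icc (0 : ℝ) 1) (q : ℝ) :
    IsClosed {π | rate a al be hT π ≤ (q : EReal)} := by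
  refine isClosed_iff_ultrafilter.2 fun π' F hF' hF => ?_
  obtain ⟨π, h1, h2, h3⟩ := exists_limit_of_rate_le ha hal hbe hF
  rw [← eq_of_ultrafilter_le_nhds h2 h3 hF']
  exact h1

theorem lowerSemicontinuous_of_isClosed {E : Type*} [TopologicalSpace E] {f : E → EReal}
    (h0 : ∀ x, 0 ≤ f x) (h : ∀ q : ℝ, IsClosed {x | f x ≤ (q : EReal)}) : LowerSemicontinuous f := by
  refine lowerSemicontinuous_iff_isClosed_preimage.2 fun y => ?_
  induction y with
  | bot =>
    have : f ⁻¹' Iic ⊥ = ∅ := eq_empty_of_forall_notMem fun x hx =>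
      absurd ((h0 x).trans hx) (by simp)
    rw [this]; exact isClosed_empty
  | coe q => exact h q
  | top =>
    have : f ⁻¹' Iic ⊤ = univ := eq_univ_of_forall fun x =>
      (le_top : f x ≤ ⊤)
    rw [this]; exact isClosed_univ

/-- An increasing bijection of `[0, T]` fixes `0`, so Skorohod-close trajectories have close values
at time `0`, without any shift of time. -/
theorem CadlagPath.continuous_eval_startTime (hT : 0 < T) (E : Type*) [UniformSpace E] :
    Continuous fun π : CadlagPath T E => π (startTime hT) := by
  refine continuous_iff_continuousAt.2 fun π => ?_
  refine (nhds_basis_uniformity' (𝓤 E).basis_sets).tendsto_right_iff.2 fun V hV => ?_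
  filter_upwards [(nhds_basis_uniformity' (hasBasis_uniformity_cadlagPath T E)).mem_of_mem
    (i := (V, 1)) ⟨hV, one_pos⟩] with π' ⟨φ, hφ⟩
  have h0 : φ (startTime hT) = startTime hT := by
    refine le_antisymm ?_ (φ (startTime hT)).2.1
    have : startTime hT ≤ φ.symm (startTime hT) := (φ.symm (startTime hT)).2.1
    simpa using φ.monotone this
  have := (hφ (startTime hT)).2
  rw [h0] at this
  exact this

section InitialCondition

variable {a al be : ℝ} {hT : 0 < T} {γ : Icc (-1 : ℝ) 1 → Icc (0 : ℝ) 1}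

theorem rateFrom_nonneg (π : CadlagPath T MeasSpace) : 0 ≤ rateFrom a al be hT γ π := by
  rw [rateFrom]
  split_ifs
  · exact rate_nonneg a al be hT π
  · exact le_top

theorem rateFrom_le_eq (q : ℝ) : {π | rateFrom a al be hT γ π ≤ (q : EReal)} =
    {π | rate a al be hT π ≤ (q : EReal)} ∩ (fun π : CadlagPath T MeasSpace => π (startTime hT)) ⁻¹'
      {μ | (μ.1 : Measure Om) = (volume : Measure Om).withDensity
        fun x => ENNReal.ofReal (γ (inclusion Ioo_subset_Icc_self x))} := by
  ext π
  simp only [mem_ofPred_eq, mem_inter_iff, mem_preimage]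
  rw [rateFrom]
  split_ifs with h
  · simp [h]
  · simp [h]

theorem isClosed_initialCondition : IsClosed ((fun π : CadlagPath T MeasSpace => π (startTime hT)) ⁻¹'
      {μ | (μ.1 : Measure Om) = (volume : Measure Om).withDensity
        fun x => ENNReal.ofReal (γ (inclusion Ioo_subset_Icc_self x))}) := by
  refine IsClosed.preimage (CadlagPath.continuous_eval_startTime hT MeasSpace)
    (Set.Subsingleton.isClosed fun μ hμ ν hν => ?_)
  exact Subtype.ext (Subtype.ext (hμ.trans hν.symm))

end InitialCondition

end

end Exclusion

end

theorem mainTheorem3 (a al be T : ℝ) (ha : -(1 / 2) < a) (hal : 0 < al) (hal1 : al < 1)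
    (hbe : 0 < be) (hbe1 : be < 1) (hT : 0 < T)
    (γ : Set.Icc (-1 : ℝ) 1 → Set.Icc (0 : ℝ) 1) (hγ : Measurable γ) :
    ((∀ π, 0 ≤ Exclusion.rateFrom a al be hT γ π) ∧
      LowerSemicontinuous (Exclusion.rateFrom a al be hT γ) ∧
      ∀ q : ℝ, IsCompact {π | Exclusion.rateFrom a al be hT γ π ≤ (q : EReal)}) ∧
    ((∀ π, 0 ≤ Exclusion.rate a al be hT π) ∧
      LowerSemicontinuous (Exclusion.rate a al be hT) ∧
      ∀ q : ℝ, IsCompact {π | Exclusion.rate a al be hT π ≤ (q : EReal)}) := by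
  have hal' : al ∈ Set.Icc (0 : ℝ) 1 := ⟨hal.le, hal1.le⟩
  have hbe' : be ∈ Set.Icc (0 : ℝ) 1 := ⟨hbe.le, hbe1.le⟩
  have hcl := Exclusion.isClosed_rate_le hT ha hal' hbe'
  have hco := Exclusion.isCompact_rate_le hT ha hal' hbe'
  refine ⟨⟨Exclusion.rateFrom_nonneg,
    Exclusion.lowerSemicontinuous_of_isClosed Exclusion.rateFrom_nonneg fun q => ?_, fun q => ?_⟩,
    Exclusion.rate_nonneg a al be hT,
    Exclusion.lowerSemicontinuous_of_isClosed (Exclusion.rate_nonneg a al be hT) hcl, hco⟩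
  · rw [Exclusion.rateFrom_le_eq]
    exact (hcl q).inter Exclusion.isClosed_initialCondition
  · rw [Exclusion.rateFrom_le_eq]
    exact (hco q).inter_right Exclusion.isClosed_initialCondition
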